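/- A tree-depth decomposition of a finite undirected graph $G$ is a rooted forest $\mathcal T$ together with a bijection $\mu$ from $V(G)$ to the nodes of $\mathcal T$ such that for every edge $uv$ of $G$, $\mu(u)$ is an ancestor of $\mu(v)$ or $\mu(v)$ is an ancestor of $\mu(u)$; its depth is the largest number of nodes on a path of $\mathcal T$ from a root to a leaf. A set $S\subseteq V(G)$ is a dominating set of $G$ if every vertex of $G$ is in $S$ or is adjacent to some vertex of $S$. There exists a deterministic algorithm (a multitape Turing machine) that, given a graph $G$ on $n$ vertices and a tree-depth decomposition of $G$ of depth $s$, runs in time $3^s\cdot \mathrm{poly}(n)$ and space $\mathrm{poly}(n)$, and outputs the sequence $(q_i)_{0\leq i\leq n}$, written in binary, where $q_i$ is the number of dominating sets of $G$ of cardinality $i$. The machine and both polynomials are independent of $G$, the decomposition, $n$ and $s$. -/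

import Mathlib

namespace DomSetTreeDepth

/-- A rooted forest on the node set `N`, given by its parent function: `parent x = none` means
that `x` is a root. Well-foundedness says that iterating `parent` always ends in a root. -/
structure RootedForest (N : Type) where
  parent : N → Option N
  wf : WellFounded fun a b : N => parent b = some a

/-- `a` is an ancestor of `b` (every node is an ancestor of itself). -/
def RootedForest.IsAncestor {N : Type} (F : RootedForest N) (a b : N) : Prop :=
  Relation.ReflTransGen (fun x y : N => F.parent y = some x) a b

/-- The set of nodes on the path from the root of the tree of `x` to `x`, both ends included. -/
def RootedForest.tail {N : Type} (F : RootedForest N) (x : N) : Set N :=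
  {a | F.IsAncestor a x}

/-- The depth of a finite rooted forest: the largest number of nodes on a path that starts in a
root and goes downwards. A longest such path ends in a leaf. The empty forest has depth `0`. -/
noncomputable def RootedForest.depth {N : Type} (F : RootedForest N) : ℕ :=
  ⨆ x : N, (F.tail x).ncard

/-- A tree-depth decomposition of `G`: a rooted forest and a bijection `μ` from the vertices of `G`
to its nodes, such that the images of the ends of every edge are in the ancestor relation. -/
structure TreeDepthDecomposition {V : Type} (G : SimpleGraph V) where
  Node : Type
  forest : RootedForest Node
  μ : V ≃ Node
  ancestor_of_adj : ∀ u v : V, G.Adj u v →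
    forest.IsAncestor (μ u) (μ v) ∨ forest.IsAncestor (μ v) (μ u)

/-- The depth of a tree-depth decomposition is the depth of its forest. -/
noncomputable def TreeDepthDecomposition.depth {V : Type} {G : SimpleGraph V}
    (D : TreeDepthDecomposition G) : ℕ :=
  D.forest.depth

/-- Every vertex of `G` is in `S` or is adjacent to some vertex of `S`. -/
def IsDominatingSet {V : Type} (G : SimpleGraph V) (S : Finset V) : Prop :=
  ∀ v : V, v ∈ S ∨ ∃ u ∈ S, G.Adj v u

open Classical in
/-- The number of dominating sets of `G` of cardinality `i`. -/
noncomputable def domCount {V : Type} [Fintype V] (G : SimpleGraph V) (i : ℕ) : ℕ :=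
  (Finset.univ.filter fun S : Finset V => IsDominatingSet G S ∧ S.card = i).card

/-- The input and output alphabet: `some false` and `some true` are the digits `0` and `1`,
and `none` is a separator. -/
abbrev Symbol : Type := Option Bool

open Classical in
/-- The `0`/`1` matrix of a binary relation, row by row, with a separator after each row. -/
noncomputable def encodeMatrix {n : ℕ} (R : Fin n → Fin n → Prop) : List Symbol :=
  (List.finRange n).flatMap fun v =>
    (List.finRange n).map (fun w => some (decide (R v w))) ++ [none]

/-- The input word: the adjacency matrix of `G`, followed by the matrix whose entry `(v, w)` is `1`
iff `w` is the parent of `v` in the forest (vertices being identified with nodes through `μ`). -/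
noncomputable def encodeInput {n : ℕ} (G : SimpleGraph (Fin n)) (D : TreeDepthDecomposition G) :
    List Symbol :=
  encodeMatrix G.Adj ++
    encodeMatrix (fun v w => D.forest.parent (D.μ v) = some (D.μ w))

/-- The output word: the numbers of the list in binary, least significant digit first and without
leading zeros, with a separator after each number. -/
def encodeNumbers (l : List ℕ) : List Symbol :=
  l.flatMap fun q => (Nat.bits q).map some ++ [none]

/-- The space that a configuration of a machine with finitely many stacks uses: the total number
of symbols stored, the input and the output stack included. -/
def cfgSpace (tm : Turing.FinTM2) (c : tm.Cfg) : ℕ :=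
  letI := tm.kFin
  ∑ k : tm.K, (c.stk k).length

/-- Every configuration that the machine reaches on the input `l` uses at most `b` space. -/
def RunsInSpace (tm : Turing.FinTM2) (l : List (tm.Γ tm.k₀)) (b : ℕ) : Prop :=
  ∀ c : tm.Cfg, StateTransition.Reaches tm.step (Turing.initList tm l) c → cfgSpace tm c ≤ b

end DomSetTreeDepth

/-! Colour every vertex `taken`, `free` or `banned`, with weights x, 1 and -1, and give weight 0 to
every colouring in which some edge joins a taken to a banned vertex. Fix the set S of taken
vertices. A vertex outside S then contributes 1 + 0 if it has a neighbour in S, and 1 - 1 otherwise.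
Hence the sum of all weights is the sum of x^|S| over the dominating sets S, that is, the sum of q_i
x^i (`sum_colorings`, `sum_dominating`).

Every edge joins a vertex to one of its ancestors, so its test can be made at the lower end
(`IsLevel.prod_factor`). Once the colours of v and of its ancestors are fixed, the subtrees of the
children of v are independent. Branching over the three colours along root-to-leaf paths therefore
needs about 3^s branches and polynomial space. The recursion `solve` treats all vertices of a level
at once: a branch colours whole levels and produces a vector with one entry per vertex. The sets of
taken and banned vertices then contain vertices from other branches of the forest, but this is
harmless: on the levels above v, only ancestors of v can be adjacent to v, and v has at most one
ancestor on each level (`IsLevel.exists_mem_upper`). Different vertices of a level can still take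
entries computed under different colours, so the product over the roots is the sum over all
colourings (`IsLevel.prod_solve`, `IsLevel.prod_roots_eq`).

The polynomial is evaluated at x = 2^(n+1) in the integers modulo 2^((n+1)^2), where words of fixed
length are added and multiplied with overflow dropped. Since q_i ≤ 2^n, the numbers q_i are the
blocks of n + 1 bits of the result (`eq_flatten_of_valZ_eq`).

For the machine, structured programs on stacks of words are compiled to `FinTM2` (`Run.trace`,
`Run.machine`). If every loop is executed at most N times, the time is at most `Prog.cost` evaluated
at N, and the space is at most the initial size plus the time. The one loop outside this scheme is
the main loop, which simulates the recursion with an explicit stack. For it, `iter_solve` bounds the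
number of iterations by 3^(s+1) and the storage by one frame of polynomial size per level.
`run_countProg` assembles the program, and `Represents.solveW` identifies what it computes on words
with `solve`. -/

namespace DomSetTreeDepth

open Turing Function

/-! ### Structured stack programs: semantics with time and space -/

/-- Structured programs that operate on stacks of binary words, the stacks being indexed by `K`.
`push k b` puts a bit on the top word of `k`, `new k` puts an empty word on `k`, `pop k f` removes
the first bit of the top word of `k` (or the top word itself if it is empty) and branches on the
result, and `loop k f` repeats this until the top word has been removed. -/
inductive Prog (K : Type) : Type
  | skip : Prog K
  | push (k : K) (b : Bool) : Prog K
  | new (k : K) : Prog K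
  | seq (p q : Prog K) : Prog K
  | pop (k : K) (f : Option Bool → Prog K) : Prog K
  | loop (k : K) (f : Bool → Prog K) : Prog K

/-- The contents of the stacks. -/
abbrev Store (K : Type) : Type := K → List (List Bool)

/-- A stack of words as a stack of symbols: every word is followed by a separator. -/
def encodeWords (l : List (List Bool)) : List Symbol :=
  l.flatMap fun w => w.map some ++ [none]

@[simp] lemma encodeWords_nil : encodeWords [] = [] := rfl

@[simp] lemma encodeWords_cons_nil (l : List (List Bool)) :
    encodeWords ([] :: l) = none :: encodeWords l := rfl

@[simp] lemma encodeWords_cons_cons (b : Bool) (w : List Bool) (l : List (List Bool)) :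
    encodeWords ((b :: w) :: l) = some b :: encodeWords (w :: l) := rfl

lemma encodeWords_append (l l' : List (List Bool)) :
    encodeWords (l ++ l') = encodeWords l ++ encodeWords l' := by
  simp [encodeWords]

/-- The encoding of a store as a family of symbol stacks. -/
def Store.encode {K : Type} (s : Store K) (k : K) : List Symbol := encodeWords (s k)

lemma Store.encode_update {K : Type} [DecidableEq K] (s : Store K) (k : K)
    (l : List (List Bool)) :
    Store.encode (update s k l) = update s.encode k (encodeWords l) := by
  funext j
  by_cases h : j = k
  · subst h; simp [Store.encode]
  · simp [Store.encode, h]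

/-- The number of symbols in a store. -/
def Store.size {K : Type} [Fintype K] (s : Store K) : ℕ := ∑ k, (encodeWords (s k)).length

lemma Store.size_update_le {K : Type} [Fintype K] [DecidableEq K] {s : Store K} {k : K}
    {l : List (List Bool)} {d : ℕ} (h : (encodeWords l).length ≤ (encodeWords (s k)).length + d) :
    Store.size (update s k l) ≤ s.size + d := by
  unfold Store.size
  rw [← Finset.add_sum_erase _ _ (Finset.mem_univ k),
    ← Finset.add_sum_erase _ (fun k => (encodeWords (s k)).length) (Finset.mem_univ k)]
  have : ∑ x ∈ Finset.univ.erase k, (encodeWords (update s k l x)).length =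
      ∑ x ∈ Finset.univ.erase k, (encodeWords (s x)).length :=
    Finset.sum_congr rfl fun x hx => by rw [update_of_ne (Finset.ne_of_mem_erase hx)]
  rw [this]
  simp only [update_self]
  omega

section semantics

variable {K : Type} [Fintype K] [DecidableEq K]

/-- `Run m p s s' t`: started in the store `s`, the program `p` ends in the store `s'` after `t`
steps, and all stores on the way have size at most `m`. -/
inductive Run (m : ℕ) : Prog K → Store K → Store K → ℕ → Prop
  | skip (s : Store K) : s.size ≤ m → Run m .skip s s 1
  | push (s : Store K) (k : K) (b : Bool) (w : List Bool) (l : List (List Bool)) :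
      s k = w :: l → s.size + 1 ≤ m → Run m (.push k b) s (update s k ((b :: w) :: l)) 1
  | new (s : Store K) (k : K) : s.size + 1 ≤ m → Run m (.new k) s (update s k ([] :: s k)) 1
  | seq {p q : Prog K} {s s' s'' : Store K} {t t' : ℕ} :
      Run m p s s' t → Run m q s' s'' t' → Run m (.seq p q) s s'' (t + t')
  | pop_bit {f : Option Bool → Prog K} {s s' : Store K} {k : K} {t : ℕ} (b : Bool) (w : List Bool)
      (l : List (List Bool)) : s k = (b :: w) :: l → s.size ≤ m →
      Run m (f (some b)) (update s k (w :: l)) s' t → Run m (.pop k f) s s' (t + 1)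
  | pop_end {f : Option Bool → Prog K} {s s' : Store K} {k : K} {t : ℕ}
      (l : List (List Bool)) : s k = [] :: l → s.size ≤ m →
      Run m (f none) (update s k l) s' t → Run m (.pop k f) s s' (t + 1)
  | pop_nil {f : Option Bool → Prog K} {s s' : Store K} {k : K} {t : ℕ} :
      s k = [] → s.size ≤ m → Run m (f none) s s' t → Run m (.pop k f) s s' (t + 1)
  | loop_bit {f : Bool → Prog K} {s s' s'' : Store K} {k : K} {t t' : ℕ} (b : Bool) (w : List Bool)
      (l : List (List Bool)) : s k = (b :: w) :: l → s.size ≤ m →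
      Run m (f b) (update s k (w :: l)) s' t → Run m (.loop k f) s' s'' t' →
      Run m (.loop k f) s s'' (t + 1 + t')
  | loop_end {f : Bool → Prog K} {s : Store K} {k : K} (l : List (List Bool)) :
      s k = [] :: l → s.size ≤ m → Run m (.loop k f) s (update s k l) 1

lemma size_update_word {s : Store K} {k : K} {b : Bool} {w : List Bool} {l : List (List Bool)}
    (h : s k = (b :: w) :: l) : Store.size (update s k (w :: l)) ≤ s.size :=
  Store.size_update_le (d := 0) (by simp [h])

lemma size_update_end {s : Store K} {k : K} {l : List (List Bool)}
    (h : s k = [] :: l) : Store.size (update s k l) ≤ s.size :=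
  Store.size_update_le (d := 0) (by simp [h])

/-- A step adds at most one symbol. Together with `Run.of_size_add_le`, this turns time bounds into
space bounds. -/
lemma Run.size_le {m : ℕ} {p : Prog K} {s s' : Store K} {t : ℕ} (h : Run m p s s' t) :
    s'.size ≤ s.size + t := by
  induction h with
  | skip => omega
  | push s k b w l h _ => exact Store.size_update_le (by simp [h])
  | new s k _ => exact Store.size_update_le (by simp)
  | seq _ _ h1 h2 => omega
  | pop_bit b w l h _ _ ih => have := size_update_word h; omega
  | pop_end l h _ _ ih => have := size_update_end h; omega
  | pop_nil h _ _ ih => omega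
  | loop_bit b w l h _ _ _ ih ih' => have := size_update_word h; omega
  | loop_end l h _ => have := size_update_end h; omega

/-- The space of a run is bounded by the size of the first store plus the running time. -/
lemma Run.of_size_add_le {m m' : ℕ} {p : Prog K} {s s' : Store K} {t : ℕ} (h : Run m p s s' t)
    (hm : s.size + t ≤ m') : Run m' p s s' t := by
  induction h with
  | skip => exact .skip _ (by omega)
  | push s k b w l h _ => exact .push _ _ _ _ _ h hm
  | new s k _ => exact .new _ _ hm
  | seq a b h1 h2 =>
    have := a.size_le
    exact .seq (h1 (by omega)) (h2 (by omega))
  | pop_bit b w l h _ _ ih =>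
    have := size_update_word h
    exact .pop_bit b w l h (by omega) (ih (by omega))
  | pop_end l h _ _ ih =>
    have := size_update_end h
    exact .pop_end l h (by omega) (ih (by omega))
  | pop_nil h _ _ ih => exact .pop_nil h (by omega) (ih (by omega))
  | loop_bit b w l h _ r _ ih ih' =>
    have := size_update_word h
    have := r.size_le
    exact .loop_bit b w l h (by omega) (ih (by omega)) (ih' (by omega))
  | loop_end l h _ => exact .loop_end l h (by omega)

end semantics

/-! ### Compilation of programs to Turing machines -/

section compilation

variable {K : Type}

/-- The labels of the machine for a program. -/
def Prog.Lab : Prog K → Type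
  | .skip => Unit
  | .push _ _ => Unit
  | .new _ => Unit
  | .seq p q => p.Lab ⊕ q.Lab
  | .pop _ f => Option (Σ o, (f o).Lab)
  | .loop _ f => Option (Σ b, (f b).Lab)

lemma Prog.finite_lab : ∀ p : Prog K, Finite p.Lab
  | .skip => inferInstanceAs (Finite Unit)
  | .push _ _ => inferInstanceAs (Finite Unit)
  | .new _ => inferInstanceAs (Finite Unit)
  | .seq p q => by
    have := p.finite_lab
    have := q.finite_lab
    exact inferInstanceAs (Finite (p.Lab ⊕ q.Lab))
  | .pop _ f => by
    have := fun o => (f o).finite_lab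
    exact inferInstanceAs (Finite (Option (Σ o, (f o).Lab)))
  | .loop _ f => by
    have := fun b => (f b).finite_lab
    exact inferInstanceAs (Finite (Option (Σ b, (f b).Lab)))

/-- The first label of a program. -/
def Prog.entry : (p : Prog K) → p.Lab
  | .skip => ()
  | .push _ _ => ()
  | .new _ => ()
  | .seq p _ => Sum.inl p.entry
  | .pop _ _ => none
  | .loop _ _ => none

/-- The statements of the machine for a program whose labels are embedded into `Λ` by `e` and which
continues with the label `x`. The internal state of the machine is the bit popped last. -/
def Prog.code {Λ : Type} : (p : Prog K) → (e : p.Lab → Λ) → (x : Λ) → p.Lab →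
    TM2.Stmt (fun _ : K => Symbol) Λ (Option Bool)
  | .skip, _, x, _ => .goto fun _ => x
  | .push k b, _, x, _ => .push k (fun _ => some b) (.goto fun _ => x)
  | .new k, _, x, _ => .push k (fun _ => none) (.goto fun _ => x)
  | .seq p q, e, _, .inl l => p.code (fun l => e (.inl l)) (e (.inr q.entry)) l
  | .seq _ q, e, x, .inr l => q.code (fun l => e (.inr l)) x l
  | .pop k f, e, _, none => .pop k (fun _ a => a.join) (.goto fun v => e (some ⟨v, (f v).entry⟩))
  | .pop _ f, e, x, some ⟨o, l⟩ => (f o).code (fun l => e (some ⟨o, l⟩)) x l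
  | .loop k f, e, x, none => .pop k (fun _ a => a.join)
      (.goto fun v => v.elim x fun b => e (some ⟨b, (f b).entry⟩))
  | .loop _ f, e, _, some ⟨b, l⟩ => (f b).code (fun l => e (some ⟨b, l⟩)) (e none) l

/-- `Trace f sz m t c c'`: `t` steps of `f` lead from `c` to `c'`, and all configurations before
`c'` have size at most `m`. -/
inductive Trace {C : Type} (f : C → Option C) (sz : C → ℕ) (m : ℕ) : ℕ → C → C → Prop
  | nil (c : C) : Trace f sz m 0 c c
  | cons {c d e : C} {t : ℕ} : f c = some d → sz c ≤ m → Trace f sz m t d e →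
      Trace f sz m (t + 1) c e

lemma Trace.trans {C : Type} {f : C → Option C} {sz : C → ℕ} {m t t' : ℕ} {c d e : C}
    (h : Trace f sz m t c d) (h' : Trace f sz m t' d e) : Trace f sz m (t + t') c e := by
  induction h with
  | nil => simpa using h'
  | cons h1 h2 _ ih =>
    have := Trace.cons h1 h2 (ih h')
    rwa [add_right_comm] at this

lemma Trace.one {C : Type} {f : C → Option C} {sz : C → ℕ} {m : ℕ} {c d : C}
    (h : f c = some d) (hm : sz c ≤ m) : Trace f sz m 1 c d :=
  .cons h hm (.nil d)

lemma Trace.iterate {C : Type} {f : C → Option C} {sz : C → ℕ} {m t : ℕ} {c d : C}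
    (h : Trace f sz m t c d) : (flip bind f)^[t] (some c) = some d := by
  induction h with
  | nil => rfl
  | cons h1 _ _ ih =>
    rw [iterate_succ_apply]
    simpa [flip, h1] using ih

/-- Since `f` is a function, a computation cannot leave the trace: whatever is reachable from `c`
lies on the way to the halting configuration `d`. -/
lemma Trace.size_le_of_reaches {C : Type} {f : C → Option C} {sz : C → ℕ} {m t : ℕ} {c d e : C}
    (h : Trace f sz m t c d) (hd : f d = none) (hm : sz d ≤ m)
    (he : StateTransition.Reaches f c e) : sz e ≤ m := by
  induction h with
  | nil c =>
    rcases Relation.ReflTransGen.cases_head he with rfl | ⟨x, hx, _⟩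
    · exact hm
    · simp [hd] at hx
  | cons h1 h2 _ ih =>
    rcases Relation.ReflTransGen.cases_head he with rfl | ⟨x, hx, hxe⟩
    · exact h2
    · rw [h1, Option.mem_some_iff] at hx
      subst hx
      exact ih hd hm hxe

variable [Fintype K]

/-- The number of symbols on the stacks of a configuration. -/
def stackSize {Λ : Type} (c : TM2.Cfg (fun _ : K => Symbol) Λ (Option Bool)) : ℕ :=
  ∑ k, (c.stk k).length

lemma stackSize_encode {Λ : Type} (l : Option Λ) (v : Option Bool) (s : Store K) :
    stackSize (⟨l, v, s.encode⟩ : TM2.Cfg (fun _ : K => Symbol) Λ (Option Bool)) = s.size := rfl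

variable [DecidableEq K]

/-- A run of a program is a trace of every machine that contains the code of the program. -/
theorem Run.trace {m : ℕ} {p : Prog K} {s s' : Store K} {t : ℕ} (h : Run m p s s' t)
    {Λ : Type} (M : Λ → TM2.Stmt (fun _ : K => Symbol) Λ (Option Bool)) (e : p.Lab → Λ) (x : Λ)
    (hM : ∀ l, M (e l) = p.code e x l) (v : Option Bool) :
    ∃ v', Trace (TM2.step M) stackSize m t ⟨some (e p.entry), v, s.encode⟩
      ⟨some x, v', s'.encode⟩ := by
  induction h generalizing x v with
  | skip s h => exact ⟨v, .one (by simp [TM2.step, hM, Prog.code]) h⟩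
  | push s k b w l h hm =>
    refine ⟨v, .one ?_ (by rw [stackSize_encode]; omega)⟩
    simp [TM2.step, hM, Prog.code, Store.encode_update, Store.encode, h]
  | new s k hm =>
    refine ⟨v, .one ?_ (by rw [stackSize_encode]; omega)⟩
    simp [TM2.step, hM, Prog.code, Store.encode_update, Store.encode]
  | seq _ _ h1 h2 =>
    obtain ⟨v1, t1⟩ := h1 _ _ (fun l => by rw [hM (.inl l)]; rfl) v
    obtain ⟨v2, t2⟩ := h2 _ x (fun l => by rw [hM (.inr l)]; rfl) v1
    exact ⟨v2, t1.trans t2⟩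
  | @pop_bit f s s' k t b w l h hm _ ih =>
    obtain ⟨v1, t1⟩ := ih (fun l => e (some ⟨some b, l⟩)) x
      (fun l => by rw [hM (some ⟨_, l⟩)]; rfl) (some b)
    have h0 : M (e (Prog.pop k f).entry) = .pop k (fun _ a => a.join)
      (.goto fun v => e (some ⟨v, (f v).entry⟩)) := hM none
    refine ⟨v1, .cons ?_ hm t1⟩
    simp [TM2.step, h0, Store.encode_update, Store.encode, h]
  | @pop_end f s s' k t l h hm _ ih =>
    obtain ⟨v1, t1⟩ := ih (fun l => e (some ⟨none, l⟩)) x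
      (fun l => by rw [hM (some ⟨_, l⟩)]; rfl) none
    have h0 : M (e (Prog.pop k f).entry) = .pop k (fun _ a => a.join)
      (.goto fun v => e (some ⟨v, (f v).entry⟩)) := hM none
    refine ⟨v1, .cons ?_ hm t1⟩
    simp [TM2.step, h0, Store.encode_update, Store.encode, h]
  | @pop_nil f s s' k t h hm _ ih =>
    obtain ⟨v1, t1⟩ := ih (fun l => e (some ⟨none, l⟩)) x
      (fun l => by rw [hM (some ⟨_, l⟩)]; rfl) none
    have h0 : M (e (Prog.pop k f).entry) = .pop k (fun _ a => a.join)
      (.goto fun v => e (some ⟨v, (f v).entry⟩)) := hM none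
    refine ⟨v1, .cons ?_ hm t1⟩
    -- On an empty stack the machine reads `none`, on a separator `some none`; `Option.join` sends
    -- both to `none`, so the branch is that of `pop_end`.
    have hk : s.encode k = [] := by simp [Store.encode, h]
    simp [TM2.step, h0, hk]
  | @loop_bit f s s' s'' k t t' b w l h hm _ _ ih ih' =>
    obtain ⟨v1, t1⟩ := ih (fun l => e (some ⟨b, l⟩)) (e none)
      (fun l => by rw [hM (some ⟨_, l⟩)]; rfl) (some b)
    obtain ⟨v2, t2⟩ := ih' e x hM v1
    have h0 : M (e (Prog.loop k f).entry) = .pop k (fun _ a => a.join)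
      (.goto fun v => v.elim x fun b => e (some ⟨b, (f b).entry⟩)) := hM none
    refine ⟨v2, Trace.trans (.cons ?_ hm t1) t2⟩
    simp [TM2.step, h0, Store.encode_update, Store.encode, h]
  | @loop_end f s k l h hm =>
    have h0 : M (e (Prog.loop k f).entry) = .pop k (fun _ a => a.join)
      (.goto fun v => v.elim x fun b => e (some ⟨b, (f b).entry⟩)) := hM none
    refine ⟨none, .one ?_ hm⟩
    simp [TM2.step, h0, Store.encode_update, Store.encode, h]

/-- The machine of a program with input stack `i` and output stack `o`. -/
noncomputable def Prog.machine (p : Prog K) (i o : K) : FinTM2 where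
  K := K
  k₀ := i
  k₁ := o
  Γ _ := Symbol
  Λ := Option p.Lab
  main := some p.entry
  ΛFin := by
    have := p.finite_lab
    exact Fintype.ofFinite _
  σ := Option Bool
  initialState := none
  Γk₀Fin := inferInstanceAs (Fintype (Option Bool))
  m
    | none => .load (fun _ => none) .halt
    | some l => p.code some none l

/-- The machine of a program as a machine over the alphabet `Symbol`. -/
noncomputable def Prog.aux (p : Prog K) (i o : K) : TM2ComputableAux Symbol Symbol where
  tm := p.machine i o
  inputAlphabet := Equiv.refl _
  outputAlphabet := Equiv.refl _

/-- The store in which the stack `k` contains `l` and all other stacks are empty. -/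
def Store.single (k : K) (l : List (List Bool)) : Store K := update (fun _ => []) k l

/-- The additional step is the one at the final label: it halts and resets the internal state to the
initial one, as `haltList` demands. -/
theorem Run.machine {m t : ℕ} {p : Prog K} {i o : K} {l l' : List (List Bool)}
    (h : Run m p (Store.single i l) (Store.single o l') t) (hm : (Store.single o l').size ≤ m) :
    Nonempty (TM2OutputsInTime (p.machine i o) (encodeWords l) (some (encodeWords l')) (t + 1)) ∧
      RunsInSpace (p.machine i o) (encodeWords l) m := by
  obtain ⟨v, tr⟩ := h.trace (p.machine i o).m some none (fun _ => rfl) none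
  have hstk : ∀ (k : K) (l : List (List Bool)) (j : K), Store.encode (Store.single k l) j =
      @dite (List Symbol) (j = k) (inferInstance) (fun _ => encodeWords l) fun _ => [] := by
    intro k l j
    by_cases h : j = k
    · subst h; simp [Store.encode, Store.single]
    · simp [Store.encode, Store.single, h]
  have hi : initList (p.machine i o) (encodeWords l) =
      ⟨some (some p.entry), none, (Store.single i l).encode⟩ := by
    unfold initList
    congr 1
    funext j
    exact (hstk i l j).symm
  have ho : haltList (p.machine i o) (encodeWords l') =
      ⟨none, none, (Store.single o l').encode⟩ := by
    unfold haltList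
    congr 1
    funext j
    exact (hstk o l' j).symm
  have tr' : Trace (p.machine i o).step (cfgSpace (p.machine i o)) m (t + 1)
      (initList (p.machine i o) (encodeWords l)) (haltList (p.machine i o) (encodeWords l')) := by
    rw [hi, ho]
    exact tr.trans (.one rfl hm)
  refine ⟨⟨⟨⟨t + 1, tr'.iterate⟩, le_rfl⟩⟩, fun c hc => ?_⟩
  have := tr'.size_le_of_reaches (by rw [ho]; rfl) (by rw [ho]; exact hm) hc
  exact this

end compilation

end DomSetTreeDepth
namespace DomSetTreeDepth

open Turing Function

/-! ### Polynomial time bounds for programs -/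

section cost

variable {K : Type}

/-- A bound for the running time of a program all of whose loops are executed at most `X` times. -/
noncomputable def Prog.cost : Prog K → Polynomial ℕ
  | .skip => 1
  | .push _ _ => 1
  | .new _ => 1
  | .seq p q => p.cost + q.cost
  | .pop _ f => (f none).cost + (f (some false)).cost + (f (some true)).cost + 1
  | .loop _ f => 1 + Polynomial.X * (1 + (f false).cost + (f true).cost)

lemma Prog.cost_pop_ge (k : K) (f : Option Bool → Prog K) (o : Option Bool) (N : ℕ) :
    (f o).cost.eval N + 1 ≤ (Prog.pop k f).cost.eval N := by
  rcases o with _ | _ | _ <;> simp [Prog.cost] <;> omega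

variable [Fintype K] [DecidableEq K]

/-- The program `p` leads from `s` to `s'` within the time `p.cost` evaluated at `N`. -/
def RunB (N : ℕ) (p : Prog K) (s s' : Store K) : Prop :=
  ∃ t ≤ p.cost.eval N, Run (s.size + t) p s s' t

/-- The loop `.loop k f` leads from `s` to `s'` with at most `j` iterations, each of them within
the time bound for the body evaluated at `N`. -/
def RunL (N : ℕ) (k : K) (f : Bool → Prog K) (j : ℕ) (s s' : Store K) : Prop :=
  ∃ t ≤ 1 + j * (1 + (f false).cost.eval N + (f true).cost.eval N),
    Run (s.size + t) (.loop k f) s s' t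

variable {N : ℕ}

lemma RunB.skip (s : Store K) : RunB N .skip s s :=
  ⟨1, by simp [Prog.cost], .skip _ (by omega)⟩

lemma RunB.push {s : Store K} {k : K} {w : List Bool} {l : List (List Bool)} (h : s k = w :: l)
    (b : Bool) : RunB N (.push k b) s (update s k ((b :: w) :: l)) :=
  ⟨1, by simp [Prog.cost], .push _ _ _ _ _ h le_rfl⟩

lemma RunB.new (s : Store K) (k : K) : RunB N (.new k) s (update s k ([] :: s k)) :=
  ⟨1, by simp [Prog.cost], .new _ _ le_rfl⟩

lemma RunB.seq {p q : Prog K} {s s' s'' : Store K} (h : RunB N p s s') (h' : RunB N q s' s'') :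
    RunB N (.seq p q) s s'' := by
  obtain ⟨t, ht, r⟩ := h
  obtain ⟨t', ht', r'⟩ := h'
  -- The second run starts in a store of size at most `s.size + t`, so size plus time remains a
  -- space bound for the composition.
  have := r.size_le
  exact ⟨t + t', by simp [Prog.cost]; omega,
    .seq (r.of_size_add_le (by omega)) (r'.of_size_add_le (by omega))⟩

lemma RunB.pop_bit {f : Option Bool → Prog K} {s s' : Store K} {k : K} {b : Bool} {w : List Bool}
    {l : List (List Bool)} (h : s k = (b :: w) :: l)
    (h' : RunB N (f (some b)) (update s k (w :: l)) s') : RunB N (.pop k f) s s' := by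
  obtain ⟨t, ht, r⟩ := h'
  have := Prog.cost_pop_ge k f (some b) N
  have := size_update_word h
  exact ⟨t + 1, by omega, .pop_bit b w l h (by omega) (r.of_size_add_le (by omega))⟩

lemma RunB.pop_end {f : Option Bool → Prog K} {s s' : Store K} {k : K}
    {l : List (List Bool)} (h : s k = [] :: l)
    (h' : RunB N (f none) (update s k l) s') : RunB N (.pop k f) s s' := by
  obtain ⟨t, ht, r⟩ := h'
  have := Prog.cost_pop_ge k f none N
  have := size_update_end h
  exact ⟨t + 1, by omega, .pop_end l h (by omega) (r.of_size_add_le (by omega))⟩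

lemma RunL.end {f : Bool → Prog K} {s : Store K} {k : K} {l : List (List Bool)}
    (h : s k = [] :: l) : RunL N k f 0 s (update s k l) :=
  ⟨1, by omega, .loop_end l h (by omega)⟩

lemma RunL.bit {f : Bool → Prog K} {s s' s'' : Store K} {k : K} {b : Bool} {w : List Bool}
    {l : List (List Bool)} {j : ℕ} (h : s k = (b :: w) :: l)
    (h' : RunB N (f b) (update s k (w :: l)) s') (h'' : RunL N k f j s' s'') :
    RunL N k f (j + 1) s s'' := by
  obtain ⟨t, ht, r⟩ := h'
  obtain ⟨t', ht', r'⟩ := h''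
  have := size_update_word h
  have := r.size_le
  have hc : (f b).cost.eval N ≤ (f false).cost.eval N + (f true).cost.eval N := by
    cases b <;> omega
  refine ⟨t + 1 + t', ?_, .loop_bit b w l h (by omega) (r.of_size_add_le (by omega))
    (r'.of_size_add_le (by omega))⟩
  rw [add_mul, one_mul]
  omega

/-- Here the parameter `N` becomes a bound for the number of iterations. The main loop, with
exponentially many iterations, is kept away from this rule. -/
lemma RunL.runB {f : Bool → Prog K} {s s' : Store K} {k : K} {j : ℕ} (h : RunL N k f j s s')
    (hj : j ≤ N) : RunB N (.loop k f) s s' := by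
  obtain ⟨t, ht, r⟩ := h
  refine ⟨t, ht.trans ?_, r⟩
  simp only [Prog.cost, Polynomial.eval_add, Polynomial.eval_mul, Polynomial.eval_one,
    Polynomial.eval_X]
  gcongr

end cost

/-! ### The stacks of the concrete machine and rules for its runs -/

/-- The stacks of the machine. -/
inductive Reg : Type
  | inp | out | nn | ee | z0 | o1 | cx | cm | A | P | B | T | F | D | acc | rv | M
  | cnt | A1 | P1 | R1 | acc2 | ms | tm | x | y | u | c | fl | w
  deriving DecidableEq

instance : Fintype Reg where
  elems := {.inp, .out, .nn, .ee, .z0, .o1, .cx, .cm, .A, .P, .B, .T, .F, .D, .acc, .rv, .M, .cnt,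
    .A1, .P1, .R1, .acc2, .ms, .tm, .x, .y, .u, .c, .fl, .w}
  complete k := by cases k <;> decide

/-- The contents of the stacks of the machine. `nn` and `ee` hold `n` and `n + 1` in unary, `z0`,
`o1`, `cx`, `cm` the numbers `0`, `1`, `2 ^ (n + 1)`, `-1`, and `A` and `P` the matrices of the
input; `B`, `T`, `F`, `D`, `acc` belong to the recursion, `rv` is its result, `M` its mode; the
others are for temporary use. -/
def St : Type := Store Reg

namespace St

/-- The contents of a stack. -/
def get (s : St) : Store Reg := s

/-- Change the contents of a stack. -/
def set (s : St) (k : Reg) (v : List (List Bool)) : St := update s.get k v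

lemma get_set (s : St) (k j : Reg) (v : List (List Bool)) :
    (s.set k v).get j = if j = k then v else s.get j := update_apply _ _ _ _

lemma get_set_self (s : St) (k : Reg) (v : List (List Bool)) : (s.set k v).get k = v := by
  rw [get_set, if_pos rfl]

lemma get_set_ne (s : St) {k j : Reg} (v : List (List Bool)) (h : j ≠ k) :
    (s.set k v).get j = s.get j := by
  rw [get_set, if_neg h]

lemma ext_get {s s' : St} (h : ∀ k, s.get k = s'.get k) : s = s' := funext h

lemma set_get (s : St) (k : Reg) : s.set k (s.get k) = s :=
  ext_get fun j => by rw [get_set]; split_ifs with h <;> simp [h]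

lemma set_set (s : St) (k : Reg) (v v' : List (List Bool)) : (s.set k v).set k v' = s.set k v' :=
  ext_get fun j => by simp only [get_set]; split_ifs <;> rfl

lemma update_get (s : St) (k : Reg) (v : List (List Bool)) :
    update s.get k v = (s.set k v).get := rfl

end St

/-- `RunS N p s s'`: the program `p` leads from `s` to `s'` within the time `p.cost` evaluated at
`N`. -/
def RunS (N : ℕ) (p : Prog Reg) (s s' : St) : Prop := RunB N p s.get s'.get

/-- `RunLS N k f j s s'`: the loop `.loop k f` leads from `s` to `s'` with at most `j` iterations,
each of them within the time bound for the body evaluated at `N`. -/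
def RunLS (N : ℕ) (k : Reg) (f : Bool → Prog Reg) (j : ℕ) (s s' : St) : Prop :=
  RunL N k f j s.get s'.get

section rules

variable {N : ℕ} {s s' s'' : St} {k : Reg} {w : List Bool} {l : List (List Bool)}

lemma RunS.skip (s : St) : RunS N .skip s s := RunB.skip _

lemma RunS.push (h : s.get k = w :: l) (b : Bool) :
    RunS N (.push k b) s (s.set k ((b :: w) :: l)) := by
  unfold RunS; rw [← St.update_get]; exact RunB.push h b

lemma RunS.new (s : St) (k : Reg) : RunS N (.new k) s (s.set k ([] :: s.get k)) := by
  unfold RunS; rw [← St.update_get]; exact RunB.new _ _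

lemma RunS.seq {p q : Prog Reg} (h : RunS N p s s') (h' : RunS N q s' s'') :
    RunS N (.seq p q) s s'' := RunB.seq h h'

lemma RunS.of_eq {p : Prog Reg} (h : RunS N p s s') (h' : s' = s'') : RunS N p s s'' := h' ▸ h

lemma RunS.pop_bit {f : Option Bool → Prog Reg} {b : Bool} (h : s.get k = (b :: w) :: l)
    (h' : RunS N (f (some b)) (s.set k (w :: l)) s') : RunS N (.pop k f) s s' := by
  unfold RunS at h'; rw [← St.update_get] at h'; exact RunB.pop_bit h h'

lemma RunS.pop_end {f : Option Bool → Prog Reg} (h : s.get k = [] :: l)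
    (h' : RunS N (f none) (s.set k l) s') : RunS N (.pop k f) s s' := by
  unfold RunS at h'; rw [← St.update_get] at h'; exact RunB.pop_end h h'

lemma RunLS.end {f : Bool → Prog Reg} (h : s.get k = [] :: l) :
    RunLS N k f 0 s (s.set k l) := by
  unfold RunLS; rw [← St.update_get]; exact RunL.end h

lemma RunLS.bit {f : Bool → Prog Reg} {b : Bool} {j : ℕ} (h : s.get k = (b :: w) :: l)
    (h' : RunS N (f b) (s.set k (w :: l)) s') (h'' : RunLS N k f j s' s'') :
    RunLS N k f (j + 1) s s'' := by
  unfold RunS at h'; rw [← St.update_get] at h'; exact RunL.bit h h' h''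

lemma RunLS.of_eq {f : Bool → Prog Reg} {j : ℕ} (h : RunLS N k f j s s') (h' : s' = s'') :
    RunLS N k f j s s'' := h' ▸ h

lemma RunLS.runS {f : Bool → Prog Reg} {j : ℕ} (h : RunLS N k f j s s') (hj : j ≤ N) :
    RunS N (.loop k f) s s' := RunL.runB h hj

/-- The rule for a loop over a word: `S d r` is the state when the bits `d` have been read, the last
one first, and the bits `r` remain, except for the contents of the stack of the word. -/
lemma RunS.loop_word {f : Bool → Prog Reg} (S : List Bool → List Bool → St) (h : s.get k = w :: l)
    (hN : w.length ≤ N) (h0 : S [] w = s)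
    (hS : ∀ d b r, d.reverse ++ b :: r = w →
      RunS N (f b) ((S d (b :: r)).set k (r :: l)) ((S (b :: d) r).set k (r :: l)))
    (h1 : (S w.reverse []).set k l = s') :
    RunS N (.loop k f) s s' := by
  refine RunLS.runS (j := w.length) ?_ hN
  suffices H : ∀ r d, d.reverse ++ r = w →
      RunLS N k f r.length ((S d r).set k (r :: l)) ((S (r.reverse ++ d) []).set k l) by
    simpa [h0, ← h, St.set_get, h1] using H w [] rfl
  intro r
  induction r with
  | nil =>
    intro d hd
    have := RunLS.end (N := N) (f := f) (St.get_set_self (S d []) k ([] :: l))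
    rwa [St.set_set] at this
  | cons b r ih =>
    intro d hd
    have h1 := hS d b r hd
    rw [← St.set_set _ _ ((b :: r) :: l)] at h1
    have h2 := RunLS.bit (St.get_set_self _ _ _) h1 (ih (b :: d) (by simpa using hd))
    simpa using h2

end rules

end DomSetTreeDepth
namespace DomSetTreeDepth

/-! ### Moving and copying words and vectors; counting loops -/

section basic

variable {N : ℕ} {s s' : St} {a b k : Reg} {w : List Bool} {l : List (List Bool)}

/-- Remove the top word. -/
def drop (k : Reg) : Prog Reg := .loop k fun _ => .skip

lemma runS_drop (h : s.get k = w :: l) (hw : w.length ≤ N) : RunS N (drop k) s (s.set k l) :=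
  RunS.loop_word (fun _ _ => s) h hw rfl (fun _ _ _ _ => RunS.skip _) rfl

/-- Move the reversal of the top word of `a` to `b`. -/
def rev (a b : Reg) : Prog Reg := .seq (.new b) (.loop a fun x => .push b x)

lemma runS_rev (h : s.get a = w :: l) (hw : w.length ≤ N) (hab : a ≠ b) :
    RunS N (rev a b) s ((s.set a l).set b (w.reverse :: s.get b)) := by
  refine (RunS.new _ _).seq (RunS.loop_word (fun d _ => s.set b (d :: s.get b))
    (by rw [St.get_set_ne _ _ hab, h]) hw rfl (fun d x r _ => ?_) ?_)
  · refine (RunS.push (w := d) (l := s.get b) ?_ x).of_eq (St.ext_get fun j => ?_)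
    · rw [St.get_set_ne _ _ hab.symm, St.get_set_self]
    · simp only [St.get_set]
      split_ifs <;> simp_all
  · refine St.ext_get fun j => ?_
    simp only [St.get_set]
    split_ifs <;> simp_all

/-- Copy the top word of `a` to `b`. -/
def dup (a b : Reg) : Prog Reg :=
  .seq (rev a .u) (.seq (.new a) (.seq (.new b)
    (.loop .u fun x => .seq (.push a x) (.push b x))))

/-- Moving a word between stacks reverses it. The reversal is parked on `u`, and reading it back
restores the order on both `a` and `b`. -/
lemma runS_dup (h : s.get a = w :: l) (hw : w.length ≤ N) (hab : a ≠ b) (ha : a ≠ .u)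
    (hb : b ≠ .u) : RunS N (dup a b) s (s.set b (w :: s.get b)) := by
  refine (runS_rev h hw ha).seq ((RunS.new _ _).seq ((RunS.new _ _).seq
    (RunS.loop_word (w := w.reverse) (l := s.get .u)
      (fun d _ => (((s.set a (d :: l)).set b (d :: s.get b)).set .u (w.reverse :: s.get .u)))
    ?_ (by simpa using hw) ?_ (fun d x r _ => ?_) ?_)))
  · rw [St.get_set_ne _ _ hb.symm, St.get_set_ne _ _ ha.symm, St.get_set_self]
  · refine St.ext_get fun j => ?_
    simp only [St.get_set]
    split_ifs <;> simp_all
  · refine (RunS.push (w := d) (l := l) ?_ x).seq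
      ((RunS.push (w := d) (l := s.get b) ?_ x).of_eq (St.ext_get fun j => ?_))
    · simp only [St.get_set]
      split_ifs <;> simp_all
    · simp only [St.get_set]
      split_ifs <;> simp_all
    · simp only [St.get_set]
      split_ifs <;> simp_all
  · refine St.ext_get fun j => ?_
    simp only [St.get_set]
    split_ifs <;> simp_all

/-- Branch on the flag on top of `fl` and remove it. -/
def cnd (p q : Prog Reg) : Prog Reg :=
  .pop .fl fun o => .seq (.pop .fl fun _ => .skip) (if o = some true then p else q)

lemma runS_cnd {p q : Prog Reg} {x : Bool} (h : s.get .fl = [x] :: l)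
    (h' : RunS N (if x = true then p else q) (s.set .fl l) s') : RunS N (cnd p q) s s' := by
  -- A flag is a word of one bit: the first `pop` reads the bit, the second removes the remaining
  -- empty word.
  refine RunS.pop_bit (k := .fl) h ((RunS.pop_end (k := .fl) rfl (RunS.skip _)).seq ?_)
  cases x <;> simpa [St.set_set] using h'

/-- Set the flag on top of `fl` to `true`. -/
def setFlag : Prog Reg := .pop .fl fun _ => .push .fl true

lemma runS_setFlag {x : Bool} (h : s.get .fl = [x] :: l) :
    RunS N setFlag s (s.set .fl ([true] :: l)) :=
  RunS.pop_bit (k := .fl) h ((RunS.push (St.get_set_self _ _ _) true).of_eq (St.set_set _ _ _ _))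

/-- Execute `p` as often as the unary number on top of `a` says. -/
def timesOf (a : Reg) (p : Prog Reg) : Prog Reg := .seq (dup a .cnt) (.loop .cnt fun _ => p)

/-- The rule for a counting loop that handles the elements of a list one by one: `S d r` is the
state when the elements `d` have been handled, the last one first, and the elements `r` remain. -/
lemma runS_timesOf {p : Prog Reg} {α : Type} (as : List α) {n : ℕ} (hl : as.length = n) (hn : n ≤ N)
    (hs : s.get a = [List.replicate n false]) (ha : a ≠ .cnt) (ha' : a ≠ .u)
    (S : List α → List α → St) (h0 : S [] as = s)
    (hS : ∀ d x r C, d.reverse ++ x :: r = as →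
      RunS N p ((S d (x :: r)).set .cnt C) ((S (x :: d) r).set .cnt C))
    (h1 : (S as.reverse []).set .cnt (s.get .cnt) = s') : RunS N (timesOf a p) s s' := by
  refine (runS_dup (a := a) (b := .cnt) hs (by simpa using hn) ha ha'
    (by decide)).seq (RunLS.runS (j := n) ?_ hn)
  suffices H : ∀ r d, d.reverse ++ r = as → RunLS N .cnt (fun _ => p) r.length
      ((S d r).set .cnt (List.replicate r.length false :: s.get .cnt))
      ((S (r.reverse ++ d) []).set .cnt (s.get .cnt)) by
    simpa [h0, h1, hl] using H as [] rfl
  intro r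
  induction r with
  | nil =>
    exact fun d _ => (RunLS.end (k := .cnt) (St.get_set_self _ _ _)).of_eq (St.set_set _ _ _ _)
  | cons x r ih =>
    intro d hd
    have h2 := RunLS.bit (k := .cnt) (b := false) (f := fun _ => p) (St.get_set_self _ _ _)
      (by rw [St.set_set]; exact hS d x r _ hd) (ih (x :: d) (by simpa using hd))
    simpa [List.replicate_succ] using h2

/-- Execute `p` as often as the unary number in `nn` says. -/
def times (p : Prog Reg) : Prog Reg := timesOf .nn p

/-- The rule for a counting loop with the counter `nn`. -/
lemma runS_times {p : Prog Reg} {α : Type} (as : List α) {n : ℕ} (hl : as.length = n) (hn : n ≤ N)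
    (hs : s.get .nn = [List.replicate n false]) (S : List α → List α → St) (h0 : S [] as = s)
    (hS : ∀ d x r C, d.reverse ++ x :: r = as →
      RunS N p ((S d (x :: r)).set .cnt C) ((S (x :: d) r).set .cnt C))
    (h1 : (S as.reverse []).set .cnt (s.get .cnt) = s') : RunS N (times p) s s' :=
  runS_timesOf as hl hn hs (by decide) (by decide) S h0 hS h1

variable {n : ℕ} {ws : List (List Bool)}

/-- Remove as many words as the unary number in `nn` says. -/
def dropVec (k : Reg) : Prog Reg := times (drop k)

lemma runS_dropVec (hs : s.get .nn = [List.replicate n false]) (hn : n ≤ N) (hl : ws.length = n)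
    (hw : ∀ w ∈ ws, w.length ≤ N) (h : s.get k = ws ++ l) (hk : k ≠ .cnt) :
    RunS N (dropVec k) s (s.set k l) := by
  refine runS_times ws hl hn hs (fun _ r => s.set k (r ++ l)) ?_ (fun d x r C hd => ?_) ?_
  · simp only [← h, St.set_get]
  · refine (runS_drop (w := x) (l := r ++ l) ?_ (hw _ (by simp [← hd]))).of_eq
      (St.ext_get fun j => ?_)
    · rw [St.get_set_ne _ _ hk, St.get_set_self]; rfl
    · simp only [St.get_set]
      split_ifs <;> simp_all
  · refine St.ext_get fun j => ?_
    simp only [St.get_set]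
    split_ifs <;> simp_all

/-- Move a vector of words from `a` to `b`, reversing it and its words. -/
def revVec (a b : Reg) : Prog Reg := times (rev a b)

lemma runS_revVec (hs : s.get .nn = [List.replicate n false]) (hn : n ≤ N) (hl : ws.length = n)
    (hw : ∀ w ∈ ws, w.length ≤ N) (h : s.get a = ws ++ l) (hab : a ≠ b) (ha : a ≠ .cnt)
    (hb : b ≠ .cnt) :
    RunS N (revVec a b) s
      ((s.set a l).set b ((ws.reverse.map List.reverse) ++ s.get b)) := by
  refine runS_times ws hl hn hs
    (fun d r => (s.set a (r ++ l)).set b (d.map List.reverse ++ s.get b)) ?_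
    (fun d x r C hd => ?_) ?_
  · refine St.ext_get fun j => ?_
    simp only [St.get_set]
    split_ifs <;> simp_all
  · refine (runS_rev (w := x) (l := r ++ l) ?_ (hw _ (by simp [← hd])) hab).of_eq
      (St.ext_get fun j => ?_)
    · simp only [St.get_set]
      split_ifs <;> simp_all
    · simp only [St.get_set]
      split_ifs <;> simp_all
  · refine St.ext_get fun j => ?_
    simp only [St.get_set]
    split_ifs <;> simp_all

/-- Copy a vector of words from `a` to `b`. -/
def dupVec (a b : Reg) : Prog Reg := .seq (revVec a .w) (times (.seq (rev .w a) (dup a b)))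

/-- `revVec` reverses both the vector and its words; the second pass over `w` undoes both reversals
while it makes the copies. -/
lemma runS_dupVec (hs : s.get .nn = [List.replicate n false]) (hn : n ≤ N) (hl : ws.length = n)
    (hw : ∀ w ∈ ws, w.length ≤ N) (h : s.get a = ws ++ l) (hab : a ≠ b) (ha : a ≠ .cnt)
    (hb : b ≠ .cnt) (ha' : a ≠ .w) (hb' : b ≠ .w) (hau : a ≠ .u) (hbu : b ≠ .u)
    (han : a ≠ .nn) :
    RunS N (dupVec a b) s (s.set b (ws ++ s.get b)) := by
  refine (runS_revVec hs hn hl hw h ha' ha (by decide)).seq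
    (runS_times (ws.reverse.map List.reverse) (by simpa using hl) hn ?_
      (fun d r => ((s.set a (d.map List.reverse ++ l)).set b
        (d.map List.reverse ++ s.get b)).set .w (r ++ s.get .w)) ?_ (fun d x r C hd => ?_) ?_)
  · simp only [St.get_set]
    split_ifs <;> simp_all
  · refine St.ext_get fun j => ?_
    simp only [St.get_set]
    split_ifs <;> simp_all
  · have hx : x.length ≤ N := by
      have : x ∈ ws.reverse.map List.reverse := by rw [← hd]; simp
      obtain ⟨y, hy, rfl⟩ := List.mem_map.1 this
      simpa using hw y (by simpa using hy)
    refine (runS_rev (w := x) (l := r ++ s.get .w) ?_ hx ha'.symm).seq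
      ((runS_dup (w := x.reverse) (l := d.map List.reverse ++ l) ?_ (by simpa using hx) hab hau
        hbu).of_eq (St.ext_get fun j => ?_))
    · simp only [St.get_set]
      split_ifs <;> simp_all
    · simp only [St.get_set]
      split_ifs <;> simp_all
    · simp only [St.get_set]
      split_ifs <;> simp_all
  · refine St.ext_get fun j => ?_
    simp only [St.get_set]
    split_ifs <;> simp_all

/-- Put as many copies of the top word of `a` on `k` as the unary number in `nn` says. -/
def fill (a k : Reg) : Prog Reg := times (dup a k)

lemma runS_fill (hs : s.get .nn = [List.replicate n false]) (hn : n ≤ N) (h : s.get a = w :: l)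
    (hw : w.length ≤ N) (hak : a ≠ k) (ha : a ≠ .cnt) (hk : k ≠ .cnt) (hau : a ≠ .u)
    (hku : k ≠ .u) :
    RunS N (fill a k) s (s.set k (List.replicate n w ++ s.get k)) := by
  refine runS_times (List.replicate n w) (by simp) hn hs (fun d _ => s.set k (d ++ s.get k)) ?_
    (fun d x r C hd => ?_) ?_
  · simp [St.set_get]
  · have hx : x = w := List.eq_of_mem_replicate (n := n) (by rw [← hd]; simp)
    subst hx
    refine (runS_dup (w := x) (l := l) ?_ hw hak hau hku).of_eq (St.ext_get fun j => ?_)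
    · simp only [St.get_set]
      split_ifs <;> simp_all
    · simp only [St.get_set]
      split_ifs <;> simp_all
  · refine St.ext_get fun j => ?_
    simp only [St.get_set]
    split_ifs <;> simp_all

end basic

end DomSetTreeDepth
namespace DomSetTreeDepth

/-! ### Arithmetic on binary words of fixed length -/

/-- The majority of three bits. -/
def maj (x y z : Bool) : Bool := (x && y) || (x && z) || (y && z)

/-- Addition of binary words of equal length, least significant bit first, with carry `c`; the last
carry is dropped. -/
def addc : Bool → List Bool → List Bool → List Bool
  | c, x :: xs, y :: ys => (x ^^ (y ^^ c)) :: addc (maj x y c) xs ys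
  | _, _, _ => []

/-- Addition of binary words of equal length. -/
def addW (x y : List Bool) : List Bool := addc false x y

lemma length_addc : ∀ (c : Bool) {x y : List Bool}, x.length = y.length →
    (addc c x y).length = x.length
  | _, [], [], _ => rfl
  | _, _ :: _, _ :: _, h => by simp [addc, length_addc _ (Nat.succ.inj h)]

lemma length_addW {x y : List Bool} (h : x.length = y.length) : (addW x y).length = x.length :=
  length_addc _ h

/-- `mulAux t r z` is `r + t * z`. -/
def mulAux : List Bool → List Bool → List Bool → List Bool
  | [], r, _ => r
  | b :: t, r, z => mulAux t (if b then addW r z else r) (addW z z)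

/-- Multiplication of binary words of equal length. -/
def mulW (t z : List Bool) : List Bool := mulAux t (List.replicate t.length false) z

lemma length_mulAux : ∀ (t : List Bool) {r z : List Bool}, r.length = z.length →
    (mulAux t r z).length = r.length
  | [], _, _, _ => rfl
  | b :: t, r, z, h => by
    have hz : (addW z z).length = z.length := length_addW rfl
    have hr : (addW r z).length = r.length := length_addW h
    cases b
    · simp [mulAux, length_mulAux t (h.trans hz.symm)]
    · simp [mulAux, length_mulAux t ((hr.trans h).trans hz.symm), hr]

lemma length_mulW {t z : List Bool} (h : t.length = z.length) : (mulW t z).length = t.length := by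
  simp [mulW, length_mulAux t (r := List.replicate t.length false) (z := z) (by simpa using h)]

/-- Do two sets that are given as words of bits have a common element? -/
def meetW : List Bool → List Bool → Bool
  | x :: xs, y :: ys => (x && y) || meetW xs ys
  | _, _ => false

section arithmetic

variable {N : ℕ} {s : St} {a b : Reg} {A B : List (List Bool)}

/-- The body of the loop for addition. -/
def addBody (b : Reg) (x : Bool) : Prog Reg :=
  .pop b fun y => .pop .c fun z => .seq (.push .u (x ^^ (y.getD false ^^ z.getD false)))
    (.push .c (maj x (y.getD false) (z.getD false)))

/-- Add the top word of `b` to that of `a` and remove it from `b`. -/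
def add (a b : Reg) : Prog Reg :=
  .seq (.new .u) (.seq (.new .c) (.seq (.push .c false) (.seq (.loop a (addBody b))
    (.seq (drop .c) (.seq (drop b) (rev .u a))))))

/-- Loop invariant: `u` holds the reversed sum of the digits read so far and `c` the current carry.
The final carry `cr'` is left unspecified because it is discarded. -/
lemma runLS_add (hab : a ≠ b) (ha : a ≠ .u) (hb : b ≠ .u) (ha' : a ≠ .c) (hb' : b ≠ .c)
    {U C : List (List Bool)} :
    ∀ (x y v : List Bool) (cr : Bool) (s : St), s.get a = x :: A → s.get b = y :: B →
      s.get .u = v :: U → s.get .c = [cr] :: C → x.length = y.length →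
      ∃ cr', RunLS N a (addBody b) x.length s ((((s.set a A).set b ([] :: B)).set .u
        (((addc cr x y).reverse ++ v) :: U)).set .c ([cr'] :: C))
  | [], [], v, cr, s, h1, h2, h3, h4, _ => by
    refine ⟨cr, (RunLS.end h1).of_eq (St.ext_get fun j => ?_)⟩
    simp only [St.get_set, addc]
    split_ifs <;> simp_all
  | x :: xs, y :: ys, v, cr, s, h1, h2, h3, h4, h5 => by
    obtain ⟨cr', ih⟩ := runLS_add (U := U) (C := C) hab ha hb ha' hb' xs ys ((x ^^ (y ^^ cr)) :: v) (maj x y cr)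
      ((((s.set a (xs :: A)).set b (ys :: B)).set .u (((x ^^ (y ^^ cr)) :: v) :: U)).set .c
        ([maj x y cr] :: C))
      (by simp only [St.get_set]; split_ifs <;> simp_all)
      (by simp only [St.get_set]; split_ifs <;> simp_all)
      (by simp only [St.get_set]; split_ifs <;> simp_all)
      (by simp only [St.get_set]; split_ifs <;> simp_all) (Nat.succ.inj h5)
    refine ⟨cr', (RunLS.bit h1 ?_ ih).of_eq (St.ext_get fun j => ?_)⟩
    · refine RunS.pop_bit (b := y) (w := ys) (l := B) ?_ (RunS.pop_bit (b := cr) (w := []) (l := C)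
        ?_ ((RunS.push (w := v) (l := U) ?_ _).seq
        ((RunS.push (w := []) (l := C) ?_ _).of_eq (St.ext_get fun j => ?_))))
      · simp only [St.get_set]; split_ifs <;> simp_all
      · simp only [St.get_set]; split_ifs <;> simp_all
      · simp only [St.get_set]; split_ifs <;> simp_all
      · simp only [St.get_set]; split_ifs <;> simp_all
      · simp only [St.get_set]; split_ifs <;> simp_all
    · simp only [St.get_set, addc]
      split_ifs <;> simp_all

lemma runS_add {x y : List Bool} (hx : s.get a = x :: A) (hy : s.get b = y :: B)
    (h : x.length = y.length) (hN : x.length ≤ N) (hN1 : 1 ≤ N)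
    (hab : a ≠ b) (ha : a ≠ .u) (hb : b ≠ .u) (ha' : a ≠ .c) (hb' : b ≠ .c) :
    RunS N (add a b) s ((s.set a (addW x y :: A)).set b B) := by
  obtain ⟨cr, hl⟩ := runLS_add (N := N) (U := s.get .u) (C := s.get .c) (A := A) (B := B)
    hab ha hb ha' hb' x y [] false
    ((s.set .u ([] :: s.get .u)).set .c ([false] :: s.get .c))
    (by simp only [St.get_set]; split_ifs <;> simp_all)
    (by simp only [St.get_set]; split_ifs <;> simp_all)
    (by simp only [St.get_set]; split_ifs <;> simp_all)
    (by simp only [St.get_set]; split_ifs <;> simp_all) h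
  refine (RunS.new _ _).seq ((RunS.new _ _).seq
    (((RunS.push (w := []) (l := s.get .c) ?_ _).of_eq ?_).seq ((hl.runS hN).seq
      ((runS_drop (w := [cr]) (l := s.get .c) ?_ (by simpa using hN1)).seq
        ((runS_drop (w := []) (l := B) ?_ (by simp)).seq
          ((runS_rev (w := (addW x y).reverse) (l := s.get .u) ?_ ?_ ha.symm).of_eq
            (St.ext_get fun j => ?_)))))))
  · simp only [St.get_set]; split_ifs <;> simp_all
  · refine St.ext_get fun j => ?_
    simp only [St.get_set]; split_ifs <;> simp_all
  · simp only [St.get_set]; split_ifs <;> simp_all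
  · simp only [St.get_set]; split_ifs <;> simp_all
  · simp only [St.get_set]; split_ifs <;> simp_all [addW]
  · simpa [length_addW h] using hN
  · simp only [St.get_set]; split_ifs <;> simp_all

/-- The body of the loop for multiplication. -/
def mulBody (b : Bool) : Prog Reg :=
  .seq (if b then .seq (dup .R1 .w) (add .x .w) else .skip) (.seq (dup .R1 .w) (add .R1 .w))

/-- Multiply the top word of `tm` by that of `R1` and remove the latter. -/
def mul : Prog Reg :=
  .seq (dup .z0 .x) (.seq (.loop .tm mulBody) (.seq (drop .R1) (.seq (rev .x .u) (rev .u .tm))))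

/-- Multiplication by shift and add: `x` is the accumulator, and the factor on `R1` is doubled for
every digit of `tm`. What becomes of that factor is irrelevant; its length `L` is needed to bound
the time for removing it. -/
lemma runLS_mul {L : ℕ} (hN : L ≤ N) (hN1 : 1 ≤ N) {TM X R : List (List Bool)} :
    ∀ (t r z : List Bool) (s : St), s.get .tm = t :: TM → s.get .x = r :: X → s.get .R1 = z :: R →
      r.length = L → z.length = L →
      ∃ z', z'.length = L ∧ RunLS N .tm mulBody t.length s
        (((s.set .tm TM).set .x (mulAux t r z :: X)).set .R1 (z' :: R))
  | [], r, z, s, h1, h2, h3, _, h5 => by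
    refine ⟨z, h5, (RunLS.end (k := .tm) h1).of_eq (St.ext_get fun j => ?_)⟩
    simp only [St.get_set, mulAux]
    split_ifs <;> simp_all
  | b :: t, r, z, s, h1, h2, h3, h4, h5 => by
    have hz : (addW z z).length = L := (length_addW rfl).trans h5
    have hr : (addW r z).length = L := (length_addW (h4.trans h5.symm)).trans h4
    obtain ⟨z', hz', ih⟩ := runLS_mul (TM := TM) (X := X) (R := R) hN hN1 t
      (if b then addW r z else r) (addW z z)
      (((s.set .tm (t :: TM)).set .x ((if b then addW r z else r) :: X)).set .R1 (addW z z :: R))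
      (by simp [St.get_set]) (by simp [St.get_set]) (by simp [St.get_set])
      (by split_ifs <;> assumption) hz
    have h1' : RunS N (if b then .seq (dup .R1 .w) (add .x .w) else .skip) (s.set .tm (t :: TM))
        ((s.set .tm (t :: TM)).set .x ((if b then addW r z else r) :: X)) := by
      cases b
      · refine (RunS.skip _).of_eq (St.ext_get fun j => ?_)
        simp only [St.get_set]
        split_ifs <;> simp_all
      · refine (runS_dup (w := z) (l := R) ?_ (h5.trans_le hN) (by decide) (by decide)
          (by decide)).seq ((runS_add (x := r) (A := X) (y := z) (B := s.get .w) ?_ ?_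
            (h4.trans h5.symm) (h4.trans_le hN) hN1 (by decide) (by decide) (by decide)
            (by decide) (by decide)).of_eq (St.ext_get fun j => ?_))
        · simp [St.get_set, h3]
        · simp [St.get_set, h2]
        · simp [St.get_set]
        · simp only [St.get_set]
          split_ifs <;> simp_all
    refine ⟨z', hz', (RunLS.bit (k := .tm) h1 (h1'.seq ((runS_dup (w := z) (l := R) ?_
      (h5.trans_le hN) (by decide) (by decide) (by decide)).seq ((runS_add (x := z) (A := R)
        (y := z) (B := s.get .w) ?_ ?_ rfl (h5.trans_le hN) hN1 (by decide) (by decide) (by decide)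
        (by decide) (by decide)).of_eq (St.ext_get fun j => ?_)))) ih).of_eq
      (St.ext_get fun j => ?_)⟩
    · simp [St.get_set, h3]
    · simp [St.get_set, h3]
    · simp [St.get_set]
    · simp only [St.get_set]
      split_ifs <;> simp_all
    · simp only [St.get_set, mulAux]
      split_ifs <;> simp_all

lemma runS_mul {L : ℕ} (hN : L ≤ N) (hN1 : 1 ≤ N) {TM R Z : List (List Bool)}
    {t z : List Bool} (h0 : s.get .z0 = List.replicate L false :: Z) (h1 : s.get .tm = t :: TM)
    (h2 : s.get .R1 = z :: R) (h3 : t.length = L) (h4 : z.length = L) :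
    RunS N mul s ((s.set .tm (mulW t z :: TM)).set .R1 R) := by
  obtain ⟨z', hz', hl⟩ := runLS_mul (TM := TM) (X := s.get .x) (R := R) hN hN1 t
    (List.replicate L false) z
    (s.set .x (List.replicate L false :: s.get .x)) (by simp [St.get_set, h1])
    (by simp [St.get_set]) (by simp [St.get_set, h2]) (by simp) h4
  have hm : (mulW t z).length ≤ N := by rw [length_mulW (h3.trans h4.symm), h3]; exact hN
  have hm' : mulAux t (List.replicate L false) z = mulW t z := by rw [mulW, h3]
  rw [hm'] at hl
  refine (runS_dup h0 (by simpa using hN) (by decide) (by decide) (by decide)).seq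
    ((hl.runS (h3.trans_le hN)).seq ((runS_drop (w := z') (l := R) ?_ (hz'.trans_le hN)).seq
      ((runS_rev (w := mulW t z) (l := s.get .x) ?_ hm (by decide)).seq
        ((runS_rev (w := (mulW t z).reverse) (l := s.get .u) ?_ (by simpa using hm)
          (by decide)).of_eq (St.ext_get fun j => ?_)))))
  · simp [St.get_set]
  · simp [St.get_set]
  · simp [St.get_set]
  · simp only [St.get_set]
    split_ifs <;> simp_all

/-- The body of the loop for the intersection of sets. -/
def meetBody (x : Bool) : Prog Reg :=
  .pop .y fun y => if x && y.getD false then setFlag else .skip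

/-- Remove the top words of `a` and `y` and put a flag on `fl` that says whether they meet. -/
def meet (a : Reg) : Prog Reg :=
  .seq (.new .fl) (.seq (.push .fl false) (.seq (.loop a meetBody) (drop .y)))

/-- The word on `y` may be longer than the one on `a`, as it is for the words `maskW` and for the
all-ones word; the unread rest stays behind and is dropped by `meet`. -/
lemma runLS_meet (hay : a ≠ .y) (hfl : a ≠ .fl) {Y FL : List (List Bool)} :
    ∀ (x y : List Bool) (f : Bool) (s : St), s.get a = x :: A → s.get .y = y :: Y →
      s.get .fl = [f] :: FL → x.length ≤ y.length →
      RunLS N a meetBody x.length s (((s.set a A).set .y (y.drop x.length :: Y)).set .fl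
        ([f || meetW x y] :: FL))
  | [], y, f, s, h1, h2, h3, _ => by
    refine (RunLS.end h1).of_eq (St.ext_get fun j => ?_)
    simp only [St.get_set, meetW]
    split_ifs <;> simp_all
  | x :: xs, y :: ys, f, s, h1, h2, h3, h4 => by
    have ih := runLS_meet hay hfl (Y := Y) (FL := FL) xs ys (f || (x && y))
      (((s.set a (xs :: A)).set .y (ys :: Y)).set .fl ([f || (x && y)] :: FL))
      (by simp only [St.get_set]; split_ifs <;> simp_all)
      (by simp only [St.get_set]; split_ifs <;> simp_all)
      (by simp only [St.get_set]; split_ifs <;> simp_all) (Nat.le_of_succ_le_succ h4)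
    refine (RunLS.bit h1 (RunS.pop_bit (b := y) (w := ys) (l := Y) ?_ ?_) ih).of_eq
      (St.ext_get fun j => ?_)
    · simp only [St.get_set]; split_ifs <;> simp_all
    · cases hxy : x && y
      · refine RunS.of_eq (s' := (s.set a (xs :: A)).set .y (ys :: Y)) ?_
          (St.ext_get fun j => ?_)
        · simpa [hxy] using RunS.skip _
        · simp only [St.get_set]; split_ifs <;> simp_all
      · have := runS_setFlag (N := N) (s := (s.set a (xs :: A)).set .y (ys :: Y)) (x := f)
          (l := FL) (by simp only [St.get_set]; split_ifs <;> simp_all)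
        simpa [hxy] using this
    · simp only [St.get_set, meetW]
      split_ifs <;> simp_all [Bool.or_assoc]

lemma runS_meet (hay : a ≠ .y) (hfl : a ≠ .fl) {Y : List (List Bool)} {x y : List Bool}
    (hx : s.get a = x :: A) (hy : s.get .y = y :: Y) (h : x.length ≤ y.length)
    (hN : y.length ≤ N) :
    RunS N (meet a) s (((s.set a A).set .y Y).set .fl ([meetW x y] :: s.get .fl)) := by
  have hl := runLS_meet (N := N) (A := A) (Y := Y) (FL := s.get .fl) hay hfl x y false
    (s.set .fl ([false] :: s.get .fl))
    (by simp only [St.get_set]; split_ifs <;> simp_all)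
    (by simp only [St.get_set]; split_ifs <;> simp_all)
    (by simp only [St.get_set]; split_ifs <;> simp_all) h
  refine (RunS.new _ _).seq (((RunS.push (w := []) (l := s.get .fl) ?_ _).of_eq ?_).seq
    ((hl.runS (h.trans hN)).seq ((runS_drop (w := y.drop x.length) (l := Y) ?_ ?_).of_eq
      (St.ext_get fun j => ?_))))
  · simp only [St.get_set]; split_ifs <;> simp_all
  · exact St.set_set _ _ _ _
  · simp only [St.get_set]; split_ifs <;> simp_all
  · simp only [List.length_drop]; omega
  · simp only [St.get_set]; split_ifs <;> simp_all

end arithmetic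

end DomSetTreeDepth
namespace DomSetTreeDepth

/-! ### Instances, and routines on rows, children and weights -/

/-- The data of an instance: the number `n` of vertices, the length `L` of numbers, a bound `N` for
the number of iterations of loops, the rows `A` and `P` of the adjacency matrix and of the parent
matrix, and the number `cx`. -/
structure Par : Type where
  (n L N : ℕ)
  (A P : List (List Bool))
  cx : List Bool
  length_A : A.length = n
  length_of_mem_A : ∀ r ∈ A, r.length = n
  length_P : P.length = n
  length_of_mem_P : ∀ r ∈ P, r.length = n
  length_cx : cx.length = L
  L_pos : 1 ≤ L
  n_le : 2 * n + 1 ≤ N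
  L_le : L ≤ N

namespace Par

/-- The number `0`. -/
def zero (p : Par) : List Bool := List.replicate p.L false

/-- The number `1`. -/
def one (p : Par) : List Bool := true :: List.replicate (p.L - 1) false

/-- The number `-1`. -/
def negOne (p : Par) : List Bool := List.replicate p.L true

@[simp] lemma length_zero (p : Par) : p.zero.length = p.L := by simp [zero]

@[simp] lemma length_one (p : Par) : p.one.length = p.L := by
  have := p.L_pos
  simp [one]; omega

@[simp] lemma length_negOne (p : Par) : p.negOne.length = p.L := by simp [negOne]

end Par

/-- The stacks that are constant during the main part of the computation. -/
def Reg.isConst : Reg → Bool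
  | .nn | .z0 | .o1 | .cx | .cm | .A | .P => true
  | _ => false

/-- The constant stacks have their intended contents. -/
structure Env (p : Par) (s : St) : Prop where
  nn : s.get .nn = [List.replicate p.n false]
  z0 : s.get .z0 = [p.zero]
  o1 : s.get .o1 = [p.one]
  cx : s.get .cx = [p.cx]
  cm : s.get .cm = [p.negOne]
  A : s.get .A = p.A
  P : s.get .P = p.P

lemma Env.set {p : Par} {s : St} (h : Env p s) {k : Reg} (hk : k.isConst = false)
    (v : List (List Bool)) : Env p (s.set k v) := by
  have H : ∀ j : Reg, j.isConst = true → (s.set k v).get j = s.get j := fun j hj =>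
    St.get_set_ne _ _ (by rintro rfl; simp [hj] at hk)
  exact ⟨(H _ rfl).trans h.nn, (H _ rfl).trans h.z0, (H _ rfl).trans h.o1, (H _ rfl).trans h.cx,
    (H _ rfl).trans h.cm, (H _ rfl).trans h.A, (H _ rfl).trans h.P⟩

/-- The states of a vertex: it belongs to the set, nothing is required of it, or it neither belongs
to the set nor has a neighbour there. -/
inductive Color : Type
  | taken | free | banned
  deriving DecidableEq

section words

/-- The set of all `i` such that the `i`-th row meets the set `b` (if `pol` is `true`) or does not
(if `pol` is `false`). -/
def kidsW (pol : Bool) (b : List Bool) (P : List (List Bool)) : List Bool :=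
  P.map fun r => meetW r b == pol

/-- Multiply `t` by the numbers in `zs` whose rows in `P` meet the set `b` (if `pol` is `true`) or
do not (if `pol` is `false`). -/
def prodW (pol : Bool) (b : List Bool) (l : List (List Bool × List Bool)) (t : List Bool) :
    List Bool :=
  l.foldl (fun t rz => if meetW rz.1 b == pol then mulW t rz.2 else t) t

lemma length_prodW {pol : Bool} {b : List Bool} {L : ℕ} (l : List (List Bool × List Bool))
    {t : List Bool} (ht : t.length = L) (hl : ∀ rz ∈ l, rz.2.length = L) :
    (prodW pol b l t).length = L := by
  induction l generalizing t with
  | nil => exact ht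
  | cons a l ih =>
    refine ih ?_ fun rz h => hl rz (List.mem_cons_of_mem _ h)
    have := hl a List.mem_cons_self
    dsimp only
    split_ifs
    · rw [length_mulW (ht.trans this.symm), ht]
    · exact ht

/-- The weight of a vertex with row `r` of the adjacency matrix and with color `c`, where `T` and
`F` are the sets of the taken and of the banned vertices above it. -/
def termW (p : Par) (T F r : List Bool) : Color → List Bool
  | .taken => if meetW r F then p.zero else p.cx
  | .free => p.one
  | .banned => if meetW r T then p.zero else p.negOne

lemma length_termW (p : Par) (T F r : List Bool) (c : Color) : (termW p T F r c).length = p.L := by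
  cases c <;> simp only [termW] <;> (try split_ifs) <;> simp [p.length_cx]

/-- The set `{i}`. -/
def maskW (n i : ℕ) : List Bool := List.replicate i false ++ true :: List.replicate n false

/-- The contribution of the color `c` to the numbers of all vertices, added to the numbers `acc`. -/
def combineW (p : Par) (c : Color) (T F : List Bool) (zs acc : List (List Bool)) :
    List (List Bool) :=
  (p.A.zip acc).mapIdx fun i ra =>
    addW ra.2 (prodW true (maskW p.n i) (p.P.zip zs) (termW p T F ra.1 c))

lemma length_combineW {p : Par} {c : Color} {T F : List Bool} {zs acc : List (List Bool)}
    (h : acc.length = p.n) : (combineW p c T F zs acc).length = p.n := by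
  simp [combineW, p.length_A, h]

end words

section routines

variable {p : Par} {s : St}

/-- Multiply the top word of `tm` by the numbers of the top vector of `rv` that are selected by the
set on `ms`. -/
def kidsProd (pol : Bool) : Prog Reg :=
  .seq (dupVec .P .P1) (.seq (dupVec .rv .R1) (times (.seq (dup .ms .y) (.seq (meet .P1)
    (cnd (if pol then mul else drop .R1) (if pol then drop .R1 else mul))))))

/-- The loop runs in parallel through the parent rows on `P1` and the numbers on `R1`, with the
partial product on `tm`. The row of u meets the set {v} exactly if v is the parent of u, so a mask
with `pol = true` selects children; the all-ones word with `pol = false` selects the vertices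
without a parent, the roots. -/
lemma runS_kidsProd (h : Env p s) (pol : Bool) {zs RV MS TM : List (List Bool)} {b t : List Bool}
    (hzs : zs.length = p.n) (hz : ∀ z ∈ zs, z.length = p.L) (hrv : s.get .rv = zs ++ RV)
    (hms : s.get .ms = b :: MS) (hb : p.n ≤ b.length) (hbN : b.length ≤ p.N)
    (htm : s.get .tm = t :: TM) (ht : t.length = p.L) :
    RunS p.N (kidsProd pol) s (s.set .tm (prodW pol b (p.P.zip zs) t :: TM)) := by
  have hn := p.n_le
  have hLN := p.L_le
  have hL := p.L_pos
  refine (runS_dupVec (ws := p.P) (l := []) h.nn (by omega) p.length_P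
    (fun w hw => by rw [p.length_of_mem_P w hw]; omega) (by simpa using h.P)
    (by decide) (by decide) (by decide) (by decide) (by decide) (by decide) (by decide)
    (by decide)).seq ((runS_dupVec (ws := zs) (l := RV) (h.set rfl _).nn (by omega) hzs
    (fun w hw => by rw [hz w hw]; omega) (by simpa [St.get_set] using hrv)
    (by decide) (by decide) (by decide) (by decide) (by decide) (by decide) (by decide)
    (by decide)).seq (runS_times (p.P.zip zs) (by simp [p.length_P, hzs]) (by omega)
    ((h.set rfl _).set rfl _).nn
    (fun d r => ((s.set .P1 (r.map Prod.fst ++ s.get .P1)).set .R1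
      (r.map Prod.snd ++ s.get .R1)).set .tm (prodW pol b d.reverse t :: TM)) ?_ ?_ ?_))
  · rw [List.map_fst_zip (by rw [p.length_P, hzs]), List.map_snd_zip (by rw [p.length_P, hzs])]
    refine St.ext_get fun j => ?_
    simp only [St.get_set, prodW]
    split_ifs <;> simp_all
  · intro d x r C hd
    have hd2 : ∀ rz ∈ d.reverse, rz.2.length = p.L := fun rz hrz =>
      hz _ (List.of_mem_zip (a := rz.1) (b := rz.2)
        (by rw [← hd]; exact List.mem_append_left _ hrz)).2
    have hxm : x ∈ p.P.zip zs := by rw [← hd]; simp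
    have hx1 : x.1.length = p.n :=
      p.length_of_mem_P _ (List.of_mem_zip (a := x.1) (b := x.2) hxm).1
    have hx2 : x.2.length = p.L := hz _ (List.of_mem_zip (a := x.1) (b := x.2) hxm).2
    have hq := length_prodW (pol := pol) (b := b) d.reverse ht hd2
    have hstep : prodW pol b (x :: d).reverse t =
        if (meetW x.1 b == pol) = true then mulW (prodW pol b d.reverse t) x.2 else
          prodW pol b d.reverse t := by
      simp [prodW, List.foldl_append]
    refine (runS_dup (w := b) (l := MS) ?_ hbN (by decide) (by decide) (by decide)).seq
      ((runS_meet (x := x.1) (y := b) (A := r.map Prod.fst ++ s.get .P1) (Y := s.get .y)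
        (by decide) (by decide) ?_ ?_ (hx1.trans_le hb) hbN).seq
      (runS_cnd (x := meetW x.1 b) (l := s.get .fl) ?_ ?_))
    · simp [St.get_set, hms]
    · simp [St.get_set]
    · simp [St.get_set]
    · simp [St.get_set]
    · by_cases hc : (meetW x.1 b == pol) = true
      · have : (if meetW x.1 b = true then (if pol = true then mul else drop .R1) else
            (if pol = true then drop .R1 else mul)) = mul := by
          cases hm : meetW x.1 b <;> cases pol <;> simp_all
        rw [this]
        rw [if_pos hc] at hstep
        refine (runS_mul (L := p.L) (t := prodW pol b d.reverse t) (z := x.2) (TM := TM) (Z := [])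
          (R := r.map Prod.snd ++ s.get .R1) (by omega) (by omega) ?_ ?_ ?_ hq hx2).of_eq
          (St.ext_get fun j => ?_)
        · simp [St.get_set, h.z0, Par.zero]
        · simp [St.get_set]
        · simp [St.get_set]
        · simp only [St.get_set, hstep]
          split_ifs <;> simp_all
      · have : (if meetW x.1 b = true then (if pol = true then mul else drop .R1) else
            (if pol = true then drop .R1 else mul)) = drop .R1 := by
          cases hm : meetW x.1 b <;> cases pol <;> simp_all
        rw [this]
        rw [if_neg hc] at hstep
        refine (runS_drop (w := x.2) (l := r.map Prod.snd ++ s.get .R1) ?_ (by omega)).of_eq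
          (St.ext_get fun j => ?_)
        · simp [St.get_set]
        · simp only [St.get_set, hstep]
          split_ifs <;> simp_all
  · refine St.ext_get fun j => ?_
    simp only [St.get_set, List.reverse_reverse]
    split_ifs <;> simp_all

/-- Put the set of the children of the set on `ms` on `B`. -/
def kidsSet (pol : Bool) : Prog Reg :=
  .seq (dupVec .P .P1) (.seq (.new .x) (.seq (times (.seq (dup .ms .y) (.seq (meet .P1)
    (cnd (.push .x pol) (.push .x !pol))))) (rev .x .B)))

lemma runS_kidsSet (h : Env p s) (pol : Bool) {MS : List (List Bool)} {b : List Bool}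
    (hms : s.get .ms = b :: MS) (hb : p.n ≤ b.length) (hbN : b.length ≤ p.N) :
    RunS p.N (kidsSet pol) s (s.set .B (kidsW pol b p.P :: s.get .B)) := by
  have hn := p.n_le
  have H : RunS p.N (times (.seq (dup .ms .y) (.seq (meet .P1)
      (cnd (.push .x pol) (.push .x !pol))))) ((s.set .P1 (p.P ++ s.get .P1)).set .x
        ([] :: s.get .x)) (s.set .x ((kidsW pol b p.P).reverse :: s.get .x)) := by
    refine runS_times p.P p.length_P (by omega) ((h.set rfl _).set rfl _).nn
      (fun d r => (s.set .P1 (r ++ s.get .P1)).set .x (kidsW pol b d :: s.get .x)) ?_ ?_ ?_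
    · simp [kidsW]
    · intro d x r C hd
      have hx1 : x.length = p.n := p.length_of_mem_P _ (by rw [← hd]; simp)
      refine (runS_dup (w := b) (l := MS) ?_ hbN (by decide) (by decide) (by decide)).seq
        ((runS_meet (x := x) (y := b) (A := r ++ s.get .P1) (Y := s.get .y)
          (by decide) (by decide) ?_ ?_ (hx1.trans_le hb) hbN).seq
        (runS_cnd (x := meetW x b) (l := s.get .fl) ?_ ?_))
      · simp [St.get_set, hms]
      · simp [St.get_set]
      · simp [St.get_set]
      · simp [St.get_set]
      · have : (if meetW x b = true then Prog.push Reg.x pol else .push .x !pol) =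
            .push .x (meetW x b == pol) := by
          cases meetW x b <;> simp
        rw [this]
        refine (RunS.push (w := kidsW pol b d) (l := s.get .x) ?_ _).of_eq (St.ext_get fun j => ?_)
        · simp [St.get_set]
        · simp only [St.get_set, kidsW, List.map_cons]
          split_ifs <;> simp_all
    · refine St.ext_get fun j => ?_
      simp only [St.get_set, kidsW, List.map_reverse]
      split_ifs <;> simp_all
  refine (runS_dupVec (ws := p.P) (l := []) h.nn (by omega) p.length_P
    (fun w hw => by rw [p.length_of_mem_P w hw]; omega) (by simpa using h.P)
    (by decide) (by decide) (by decide) (by decide) (by decide) (by decide) (by decide)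
    (by decide)).seq ((RunS.new _ _).seq ((H.of_eq rfl).seq
      ((runS_rev (w := (kidsW pol b p.P).reverse) (l := s.get .x) ?_ ?_ (by decide)).of_eq
        (St.ext_get fun j => ?_))))
  · simp [St.get_set]
  · simp only [kidsW, List.length_reverse, List.length_map, p.length_P]; omega
  · simp only [St.get_set]
    split_ifs <;> simp_all

/-- Put a second copy of the top word of `k` on `k`. -/
def copyTop (k : Reg) : Prog Reg := .seq (dup k .x) (.seq (rev .x .u) (rev .u k))

/-- `dup` needs two distinct stacks, so the copy takes a detour through `x` and `u`, whose two
reversals cancel. -/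
lemma runS_copyTop {N : ℕ} {k : Reg} {w : List Bool} {l : List (List Bool)}
    (h : s.get k = w :: l) (hw : w.length ≤ N) (hx : k ≠ .x) (hu : k ≠ .u) :
    RunS N (copyTop k) s (s.set k (w :: s.get k)) := by
  refine (runS_dup h hw hx hu (by decide)).seq ((runS_rev (w := w) (l := s.get .x)
    (St.get_set_self _ _ _) hw (by decide)).seq
    ((runS_rev (w := w.reverse) (l := s.get .u) ?_ (by simpa using hw) hu.symm).of_eq
      (St.ext_get fun j => ?_)))
  · simp [St.get_set]
  · simp only [St.get_set]
    split_ifs <;> simp_all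

/-- The body of the loop for the union of sets. -/
def unionBody (a : Bool) : Prog Reg := .pop .y fun b => .push .u (a || b.getD false)

/-- Put the union of the sets on top of `k` and of `B` on `k`. -/
def union (k : Reg) : Prog Reg :=
  .seq (dup k .x) (.seq (dup .B .y) (.seq (.new .u) (.seq (.loop .x unionBody)
    (.seq (drop .y) (rev .u k)))))

/-- The union of sets. -/
def orW (x y : List Bool) : List Bool := List.zipWith or x y

lemma runLS_union {N : ℕ} {X Y U : List (List Bool)} : ∀ (x y v : List Bool) (s : St),
    s.get .x = x :: X → s.get .y = y :: Y → s.get .u = v :: U → x.length = y.length →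
    RunLS N .x unionBody x.length s
      (((s.set .x X).set .y ([] :: Y)).set .u (((orW x y).reverse ++ v) :: U))
  | [], [], v, s, h1, h2, h3, _ => by
    refine (RunLS.end h1).of_eq (St.ext_get fun j => ?_)
    simp only [St.get_set, orW]
    split_ifs <;> simp_all
  | x :: xs, y :: ys, v, s, h1, h2, h3, h4 => by
    have ih := runLS_union (N := N) (X := X) (Y := Y) (U := U) xs ys ((x || y) :: v)
      (((s.set .x (xs :: X)).set .y (ys :: Y)).set .u (((x || y) :: v) :: U))
      (by simp [St.get_set]) (by simp [St.get_set]) (by simp [St.get_set]) (Nat.succ.inj h4)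
    refine (RunLS.bit h1 (RunS.pop_bit (b := y) (w := ys) (l := Y) ?_
      ((RunS.push (w := v) (l := U) ?_ _).of_eq (St.ext_get fun j => ?_))) ih).of_eq
      (St.ext_get fun j => ?_)
    · simp [St.get_set, h2]
    · simp [St.get_set, h3]
    · simp only [St.get_set]
      split_ifs <;> simp_all
    · simp only [St.get_set, orW]
      split_ifs <;> simp_all

lemma runS_union {N : ℕ} {k : Reg} {x y : List Bool} {l B : List (List Bool)}
    (hk : s.get k = x :: l) (hB : s.get .B = y :: B) (h : x.length = y.length) (hN : x.length ≤ N)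
    (hx : k ≠ .x) (hy : k ≠ .y) (hu : k ≠ .u) :
    RunS N (union k) s (s.set k (orW x y :: s.get k)) := by
  have hl := runLS_union (N := N) (X := s.get .x) (Y := s.get .y) (U := s.get .u) x y []
    (((s.set .x (x :: s.get .x)).set .y (y :: s.get .y)).set .u ([] :: s.get .u))
    (by simp [St.get_set]) (by simp [St.get_set]) (by simp [St.get_set]) h
  refine (runS_dup hk hN hx hu (by decide)).seq ((runS_dup (w := y) (l := B) ?_ (by omega)
    (by decide) (by decide) (by decide)).seq (((RunS.new _ _).of_eq ?_).seq ((hl.runS hN).seq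
    ((runS_drop (w := []) (l := s.get .y) ?_ (by simp)).seq
    ((runS_rev (w := (orW x y).reverse) (l := s.get .u) ?_ ?_ hu.symm).of_eq
      (St.ext_get fun j => ?_))))))
  · simp [St.get_set, hB]
  · simp [St.get_set]
  · simp [St.get_set]
  · simp [St.get_set]
  · simp [orW]; omega
  · simp only [St.get_set]
    split_ifs <;> simp_all

/-- Put the weight of the color `c` for the top row of `A1` on `tm`. -/
def initTerm : Color → Prog Reg
  | .taken => .seq (dup .F .y) (.seq (meet .A1) (cnd (dup .z0 .tm) (dup .cx .tm)))
  | .free => .seq (drop .A1) (dup .o1 .tm)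
  | .banned => .seq (dup .T .y) (.seq (meet .A1) (cnd (dup .z0 .tm) (dup .cm .tm)))

lemma runS_initTerm (h : Env p s) (c : Color) {A1 Ts Fs : List (List Bool)} {r T F : List Bool}
    (hA : s.get .A1 = r :: A1) (hT : s.get .T = T :: Ts) (hF : s.get .F = F :: Fs)
    (hr : r.length = p.n) (hTn : T.length = p.n) (hFn : F.length = p.n) :
    RunS p.N (initTerm c) s ((s.set .A1 A1).set .tm (termW p T F r c :: s.get .tm)) := by
  have hn := p.n_le
  have hLN := p.L_le
  have hcx := p.length_cx
  cases c with
  | taken =>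
    refine (runS_dup hF (by omega) (by decide) (by decide) (by decide)).seq
      ((runS_meet (x := r) (y := F) (A := A1) (Y := s.get .y) (by decide) (by decide) ?_ ?_
        (by omega) (by omega)).seq
      (runS_cnd (x := meetW r F) (l := s.get .fl) ?_ ?_))
    · simp [St.get_set, hA]
    · simp [St.get_set]
    · simp [St.get_set]
    · cases hm : meetW r F
      · refine (runS_dup (w := p.cx) (l := []) ?_ (by omega) (by decide) (by decide)
          (by decide)).of_eq (St.ext_get fun j => ?_)
        · simp [St.get_set, h.cx]
        · simp only [St.get_set, termW, hm]
          split_ifs <;> simp_all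
      · refine (runS_dup (w := p.zero) (l := []) ?_ (by simpa using hLN) (by decide) (by decide)
          (by decide)).of_eq (St.ext_get fun j => ?_)
        · simp [St.get_set, h.z0]
        · simp only [St.get_set, termW, hm]
          split_ifs <;> simp_all
  | free =>
    refine (runS_drop hA (by omega)).seq ((runS_dup (w := p.one) (l := []) ?_
      (by simpa using hLN) (by decide) (by decide) (by decide)).of_eq (St.ext_get fun j => ?_))
    · simp [St.get_set, h.o1]
    · simp only [St.get_set, termW]
      split_ifs <;> simp_all
  | banned =>
    refine (runS_dup hT (by omega) (by decide) (by decide) (by decide)).seq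
      ((runS_meet (x := r) (y := T) (A := A1) (Y := s.get .y) (by decide) (by decide) ?_ ?_
        (by omega) (by omega)).seq
      (runS_cnd (x := meetW r T) (l := s.get .fl) ?_ ?_))
    · simp [St.get_set, hA]
    · simp [St.get_set]
    · simp [St.get_set]
    · cases hm : meetW r T
      · refine (runS_dup (w := p.negOne) (l := []) ?_ (by simpa using hLN) (by decide) (by decide)
          (by decide)).of_eq (St.ext_get fun j => ?_)
        · simp [St.get_set, h.cm]
        · simp only [St.get_set, termW, hm]
          split_ifs <;> simp_all
      · refine (runS_dup (w := p.zero) (l := []) ?_ (by simpa using hLN) (by decide) (by decide)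
          (by decide)).of_eq (St.ext_get fun j => ?_)
        · simp [St.get_set, h.z0]
        · simp only [St.get_set, termW, hm]
          split_ifs <;> simp_all

end routines

end DomSetTreeDepth
namespace DomSetTreeDepth

/-! ### The contribution of one colour to the numbers of all vertices -/

section combine

variable {p : Par} {s : St}

/-- The body of the loop of `combine`. -/
def combineBody (c : Color) : Prog Reg :=
  .seq (initTerm c) (.seq (kidsProd true) (.seq (add .acc .tm) (.seq (rev .acc .acc2)
    (.push .ms false))))

/-- Add the contribution of the color `c` to the top vector of `acc` and remove the vector on
`rv`. -/
def combine (c : Color) : Prog Reg :=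
  .seq (dup .nn .ms) (.seq (.push .ms true) (.seq (dupVec .A .A1) (.seq (times (combineBody c))
    (.seq (drop .ms) (.seq (revVec .acc2 .acc) (dropVec .rv))))))

/-- The number that `combine` adds to that of the vertex `i` with row `r` of the adjacency
matrix. -/
def summandW (p : Par) (c : Color) (T F : List Bool) (zs : List (List Bool)) (i : ℕ)
    (r : List Bool) : List Bool :=
  prodW true (maskW p.n i) (p.P.zip zs) (termW p T F r c)

lemma length_summandW {p : Par} {c : Color} {T F : List Bool} {zs : List (List Bool)}
    (hz : ∀ z ∈ zs, z.length = p.L) (i : ℕ) (r : List Bool) :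
    (summandW p c T F zs i r).length = p.L :=
  length_prodW _ (length_termW _ _ _ _ _) fun rz hrz =>
    hz _ (List.of_mem_zip (a := rz.1) (b := rz.2) hrz).2

lemma length_of_mem_combineW {p : Par} {c : Color} {T F : List Bool} {zs acc : List (List Bool)}
    (hz : ∀ z ∈ zs, z.length = p.L) (ha : ∀ a ∈ acc, a.length = p.L) :
    ∀ w ∈ combineW p c T F zs acc, w.length = p.L := by
  intro w hw
  obtain ⟨i, hi, rfl⟩ := List.mem_mapIdx.1 hw
  have := ha _ (List.of_mem_zip (a := (p.A.zip acc)[i].1) (b := (p.A.zip acc)[i].2)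
    (List.getElem_mem hi)).2
  exact (length_addW (this.trans (length_summandW hz i _).symm)).trans this

lemma length_maskW (n i : ℕ) : (maskW n i).length = i + n + 1 := by
  simp [maskW]; omega

lemma runS_combineBody (h : Env p s) (c : Color) {r a T F : List Bool} {i : ℕ}
    {zs A1 ACC MS Ts Fs RV : List (List Bool)}
    (hT : s.get .T = T :: Ts) (hF : s.get .F = F :: Fs) (hTn : T.length = p.n)
    (hFn : F.length = p.n) (hzs : zs.length = p.n) (hz : ∀ z ∈ zs, z.length = p.L)
    (hrv : s.get .rv = zs ++ RV) (hacc : s.get .acc = a :: ACC) (ha : a.length = p.L)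
    (hA1 : s.get .A1 = r :: A1) (hr : r.length = p.n) (hms : s.get .ms = maskW p.n i :: MS)
    (hi : i < p.n) :
    RunS p.N (combineBody c) s ((((s.set .A1 A1).set .acc ACC).set .acc2
      ((addW a (summandW p c T F zs i r)).reverse :: s.get .acc2)).set .ms
        (maskW p.n (i + 1) :: MS)) := by
  have hn := p.n_le
  have hLN := p.L_le
  have hL := p.L_pos
  have hmask := length_maskW p.n i
  have hq : (summandW p c T F zs i r).length = p.L := length_summandW hz i r
  have hq' : (addW a (summandW p c T F zs i r)).length = p.L :=
    (length_addW (ha.trans hq.symm)).trans ha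
  -- A single `push` shifts the mask from one vertex to the next. The trailing zeros of `maskW` keep
  -- every mask at least as long as a row, and its maximal length 2n + 1 accounts for the bound
  -- `Par.n_le`.
  have hmk : maskW p.n (i + 1) = false :: maskW p.n i := by simp [maskW, List.replicate_succ]
  refine (runS_initTerm h c hA1 hT hF hr hTn hFn).seq
    ((runS_kidsProd (b := maskW p.n i) (t := termW p T F r c) (TM := s.get .tm)
      ((h.set rfl _).set rfl _) true hzs hz (RV := RV) (MS := MS) ?_ ?_ (by omega)
      (by omega) ?_ (length_termW _ _ _ _ _)).seq
    ((runS_add (x := a) (y := summandW p c T F zs i r) (A := ACC) (B := s.get .tm) ?_ ?_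
      (ha.trans hq.symm) (by omega) (by omega) (by decide) (by decide) (by decide) (by decide)
      (by decide)).seq
    ((runS_rev (w := addW a (summandW p c T F zs i r)) (l := ACC) ?_ (by omega)
      (by decide)).seq
    ((RunS.push (w := maskW p.n i) (l := MS) ?_ _).of_eq
      (St.ext_get fun j => ?_)))))
  · simpa [St.get_set] using hrv
  · simpa [St.get_set] using hms
  · simp [St.get_set]
  · simpa [St.get_set] using hacc
  · simp [St.get_set, summandW]
  · simp [St.get_set]
  · simpa [St.get_set] using hms
  · simp only [St.get_set, hmk]
    clear hacc hA1 hms hrv hT hF h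
    split_ifs <;> simp_all

lemma runS_combineLoop (h : Env p s) (c : Color) {T F : List Bool}
    {zs acc A1 ACC MS Ts Fs RV : List (List Bool)}
    (hT : s.get .T = T :: Ts) (hF : s.get .F = F :: Fs) (hTn : T.length = p.n)
    (hFn : F.length = p.n) (hzs : zs.length = p.n) (hz : ∀ z ∈ zs, z.length = p.L)
    (hrv : s.get .rv = zs ++ RV) (hacc : s.get .acc = acc ++ ACC) (hal : acc.length = p.n)
    (ha : ∀ a ∈ acc, a.length = p.L) (hA1 : s.get .A1 = p.A ++ A1)
    (hms : s.get .ms = maskW p.n 0 :: MS) :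
    RunS p.N (times (combineBody c)) s ((((s.set .A1 A1).set .acc ACC).set .acc2
      (((combineW p c T F zs acc).map List.reverse).reverse ++ s.get .acc2)).set .ms
        (maskW p.n p.n :: MS)) := by
  have hn := p.n_le
  set f : ℕ → List Bool × List Bool → List Bool := fun i ra =>
    addW ra.2 (summandW p c T F zs i ra.1) with hf
  have hAl : p.A.length = acc.length := by rw [p.length_A, hal]
  refine runS_times (p.A.zip acc) (by simp [p.length_A, hal]) (by omega) h.nn
    (fun d r => (((s.set .A1 (r.map Prod.fst ++ A1)).set .acc (r.map Prod.snd ++ ACC)).set .acc2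
      (((d.reverse.mapIdx f).map List.reverse).reverse ++ s.get .acc2)).set .ms
        (maskW p.n d.length :: MS)) ?_ ?_ ?_
  · rw [List.map_fst_zip hAl.le, List.map_snd_zip hAl.ge, ← hA1, ← hacc]
    refine St.ext_get fun j => ?_
    simp only [St.get_set]
    split_ifs <;> simp_all
  · intro d x r C hd
    have hdl : d.length < p.n := by
      have := congrArg List.length hd
      simp [p.length_A, hal] at this
      omega
    have hxm : x ∈ p.A.zip acc := by rw [← hd]; simp
    have hx1 : x.1.length = p.n :=
      p.length_of_mem_A _ (List.of_mem_zip (a := x.1) (b := x.2) hxm).1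
    have hx2 : x.2.length = p.L := ha _ (List.of_mem_zip (a := x.1) (b := x.2) hxm).2
    have hstep : ((x :: d).reverse.mapIdx f) = d.reverse.mapIdx f ++ [f d.length x] := by
      rw [List.reverse_cons, List.mapIdx_concat, List.length_reverse]
    refine (runS_combineBody (r := x.1) (a := x.2) (T := T) (F := F) (i := d.length) (zs := zs)
      (A1 := r.map Prod.fst ++ A1) (ACC := r.map Prod.snd ++ ACC) (MS := MS) (Ts := Ts) (Fs := Fs)
      (RV := RV) (((((h.set rfl _).set rfl _).set rfl _).set rfl _).set rfl _) c ?_ ?_ hTn hFn hzs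
      hz ?_ ?_ hx2 ?_ hx1 ?_ hdl).of_eq (St.ext_get fun j => ?_)
    · simpa [St.get_set] using hT
    · simpa [St.get_set] using hF
    · simpa [St.get_set] using hrv
    · simp [St.get_set]
    · simp [St.get_set]
    · simp [St.get_set]
    · simp only [St.get_set, hstep, List.length_cons]
      clear hacc hA1 hms hrv hT hF h
      split_ifs <;> simp_all
  · refine St.ext_get fun j => ?_
    have hcw : combineW p c T F zs acc = (p.A.zip acc).mapIdx f := rfl
    simp only [St.get_set, List.reverse_reverse, hcw, List.length_reverse, List.length_zip,
      p.length_A, hal, min_self]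
    clear hacc hA1 hms hrv hT hF h
    split_ifs <;> simp_all

/-- The zeros on `nn` with a `true` in front form the mask of vertex 0. The body leaves the new sums
on `acc2` in reverse, each of them reversed as well; `revVec` restores both orders on `acc`. -/
lemma runS_combine (h : Env p s) (c : Color) {T F : List Bool}
    {zs acc Ts Fs RV ACC : List (List Bool)}
    (hT : s.get .T = T :: Ts) (hF : s.get .F = F :: Fs) (hTn : T.length = p.n)
    (hFn : F.length = p.n) (hzs : zs.length = p.n) (hz : ∀ z ∈ zs, z.length = p.L)
    (hrv : s.get .rv = zs ++ RV) (hacc : s.get .acc = acc ++ ACC) (hal : acc.length = p.n)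
    (ha : ∀ a ∈ acc, a.length = p.L) :
    RunS p.N (combine c) s ((s.set .acc (combineW p c T F zs acc ++ ACC)).set .rv RV) := by
  have hn := p.n_le
  have hLN := p.L_le
  have hL := p.L_pos
  refine (runS_dup (w := List.replicate p.n false) (l := []) h.nn (by simp; omega) (by decide)
    (by decide) (by decide)).seq ((RunS.push (w := List.replicate p.n false) (l := s.get .ms)
      (St.get_set_self _ _ _) _).seq
    ((runS_dupVec (ws := p.A) (l := []) ((h.set rfl _).set rfl _).nn (by omega) p.length_A
      (fun w hw => by rw [p.length_of_mem_A w hw]; omega)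
      (by simpa [St.get_set] using h.A) (by decide) (by decide) (by decide) (by decide) (by decide)
      (by decide) (by decide) (by decide)).seq
    ((runS_combineLoop (T := T) (F := F) (zs := zs) (acc := acc) (A1 := s.get .A1) (ACC := ACC)
      (MS := s.get .ms) (Ts := Ts) (Fs := Fs) (RV := RV)
      (((h.set rfl _).set rfl _).set rfl _) c ?_ ?_ hTn hFn hzs hz ?_ ?_ hal ha ?_ ?_).seq
    ((runS_drop (w := maskW p.n p.n) (l := s.get .ms) ?_ (by rw [length_maskW]; omega)).seq
    ((runS_revVec (n := p.n) (ws := ((combineW p c T F zs acc).map List.reverse).reverse)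
      (l := s.get .acc2) ?_ (by omega) (by simpa using length_combineW hal) ?_ ?_ (by decide)
      (by decide) (by decide)).seq
    ((runS_dropVec (n := p.n) (ws := zs) (l := RV) ?_ (by omega) hzs
      (fun w hw => by rw [hz w hw]; omega) ?_ (by decide)).of_eq (St.ext_get fun j => ?_)))))))
  · simpa [St.get_set] using hT
  · simpa [St.get_set] using hF
  · simpa [St.get_set] using hrv
  · simpa [St.get_set] using hacc
  · simp [St.get_set]
  · simp [St.get_set, maskW]
  · simp [St.get_set]
  · simp [St.get_set, h.nn]
  · intro w hw
    simp only [List.mem_reverse, List.mem_map] at hw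
    obtain ⟨v, hv, rfl⟩ := hw
    rw [List.length_reverse, length_of_mem_combineW hz ha v hv]
    omega
  · simp [St.get_set]
  · simp [St.get_set, h.nn]
  · simp [St.get_set, hrv]
  · simp only [St.get_set]
    clear hacc hrv hT hF h
    split_ifs <;> simp_all

end combine

/-! ### Descending to the next level -/

/-- The code of a color on the stack `D`. -/
def Color.code : Color → List Bool
  | .taken => [false]
  | .free => [true, false]
  | .banned => [true, true]

/-- The set of the taken vertices above the vertices of the next level, where `b` is the present
level and `c` its color. -/
def nextT (c : Color) (b T : List Bool) : List Bool := if c = .taken then orW T b else T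

/-- The set of the banned vertices above the vertices of the next level, where `b` is the present
level and `c` its color. -/
def nextF (c : Color) (b F : List Bool) : List Bool := if c = .banned then orW F b else F

/-- Put the code of `c` on the top word of `D`. -/
def pushColor : Color → Prog Reg
  | .taken => .push .D false
  | .free => .seq (.push .D false) (.push .D true)
  | .banned => .seq (.push .D true) (.push .D true)

/-- Start the recursion for the next level if the present one is given the color `c`. -/
def enter (c : Color) : Prog Reg :=
  .seq (pushColor c) (.seq (if c = .taken then union .T else copyTop .T)
    (.seq (if c = .banned then union .F else copyTop .F)
    (.seq (dup .B .ms) (.seq (kidsSet true) (.seq (drop .ms) (.push .M true))))))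

/-- The sets of the present level stay below those of the new one, because they are needed again for
the return and for the remaining colours. -/
lemma runS_enter {p : Par} {s : St} (h : Env p s) (c : Color) {b T F d m : List Bool}
    {B Ts Fs D M : List (List Bool)} (hB : s.get .B = b :: B) (hT : s.get .T = T :: Ts)
    (hF : s.get .F = F :: Fs) (hD : s.get .D = d :: D) (hM : s.get .M = m :: M)
    (hbn : b.length = p.n) (hTn : T.length = p.n) (hFn : F.length = p.n) :
    RunS p.N (enter c) s (((((s.set .D ((c.code ++ d) :: D)).set .T (nextT c b T :: s.get .T)).set
      .F (nextF c b F :: s.get .F)).set .B (kidsW true b p.P :: s.get .B)).set .M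
        ((true :: m) :: M)) := by
  have hn := p.n_le
  have h1 : RunS p.N (pushColor c) s (s.set .D ((c.code ++ d) :: D)) := by
    cases c
    · exact RunS.push hD _
    · exact (RunS.push hD _).seq ((RunS.push (St.get_set_self _ _ _) _).of_eq (St.set_set _ _ _ _))
    · exact (RunS.push hD _).seq ((RunS.push (St.get_set_self _ _ _) _).of_eq (St.set_set _ _ _ _))
  have h2 : ∀ s' : St, s'.get .T = T :: Ts → s'.get .B = b :: B →
      RunS p.N (if c = .taken then union .T else copyTop .T) s'
        (s'.set .T (nextT c b T :: s'.get .T)) := by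
    intro s' h1 h2
    unfold nextT
    split_ifs
    · exact runS_union h1 h2 (by omega) (by omega) (by decide) (by decide) (by decide)
    · exact runS_copyTop h1 (by omega) (by decide) (by decide)
  have h3 : ∀ s' : St, s'.get .F = F :: Fs → s'.get .B = b :: B →
      RunS p.N (if c = .banned then union .F else copyTop .F) s'
        (s'.set .F (nextF c b F :: s'.get .F)) := by
    intro s' h1 h2
    unfold nextF
    split_ifs
    · exact runS_union h1 h2 (by omega) (by omega) (by decide) (by decide) (by decide)
    · exact runS_copyTop h1 (by omega) (by decide) (by decide)
  refine h1.seq ((h2 _ ?_ ?_).seq ((h3 _ ?_ ?_).seq ((runS_dup (w := b) (l := B) ?_ (by omega)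
    (by decide) (by decide) (by decide)).seq ((runS_kidsSet (p := p) (b := b) (MS := s.get .ms)
      ?_ true ?_ (by omega) (by omega)).seq ((runS_drop (w := b) (l := s.get .ms) ?_
      (by omega)).seq ((RunS.push (w := m) (l := M) ?_ _).of_eq (St.ext_get fun j => ?_)))))))
  · simp [St.get_set, hT]
  · simp [St.get_set, hB]
  · simp [St.get_set, hF]
  · simp [St.get_set, hB]
  · simp [St.get_set, hB]
  · exact (((h.set rfl _).set rfl _).set rfl _).set rfl _
  · simp [St.get_set]
  · simp [St.get_set]
  · simp [St.get_set, hM]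
  · simp only [St.get_set]
    split_ifs <;> simp_all

end DomSetTreeDepth
namespace DomSetTreeDepth

/-! ### The iterations of the main loop -/

/-- The end of a call of the recursion: the sets of the present level are removed. -/
def leave : Prog Reg := .seq (drop .B) (.seq (drop .T) (drop .F))

/-- Branch on whether the set on top of `B` is nonempty. -/
def ifNonempty (q q' : Prog Reg) : Prog Reg :=
  .seq (dup .B .x) (.seq (dup .B .y) (.seq (meet .x) (cnd q q')))

lemma runS_ifNonempty {N : ℕ} {q q' : Prog Reg} {s s' : St} {b : List Bool} {B : List (List Bool)}
    (hB : s.get .B = b :: B) (hb : b.length ≤ N)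
    (h : RunS N (if meetW b b = true then q else q') s s') : RunS N (ifNonempty q q') s s' := by
  refine (runS_dup hB hb (by decide) (by decide) (by decide)).seq
    ((runS_dup (w := b) (l := B) ?_ hb (by decide) (by decide) (by decide)).seq
    (((runS_meet (x := b) (y := b) (A := s.get .x) (Y := s.get .y) (by decide) (by decide) ?_ ?_
      le_rfl hb).of_eq (s'' := s.set .fl ([meetW b b] :: s.get .fl)) (St.ext_get fun j => ?_)).seq
    (runS_cnd (St.get_set_self _ _ _) ?_)))
  · simpa [St.get_set] using hB
  · simp [St.get_set]
  · simp [St.get_set]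
  · simp only [St.get_set]
    split_ifs <;> simp_all
  · rwa [St.set_set, St.set_get]

/-- The body of the main loop. In the mode `true` the vector of the numbers of the vertices on the
top level of `B` is to be computed; in the mode `false` the vector of the next level has been
computed for one of the colors of the present level. -/
def mainBody : Bool → Prog Reg
  | true => ifNonempty (.seq (fill .z0 .acc) (enter .taken))
      (.seq leave (.seq (fill .z0 .rv) (.push .M false)))
  | false => .pop .D fun o =>
      if o = none then .skip else if o = some false then .seq (combine .taken) (enter .free) else
        .pop .D fun o => if o = some false then .seq (combine .free) (enter .banned) else
          .seq (combine .banned) (.seq leave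
            (.seq (revVec .acc .acc2) (.seq (revVec .acc2 .rv) (.push .M false))))

/-- The contents of the stacks during the main loop. -/
def conf (s : St) (B T F acc rv : List (List Bool)) (D M : List Bool) : St :=
  ((((((s.set .B B).set .T T).set .F F).set .acc acc).set .rv rv).set .D [D]).set .M [M]

lemma conf_set_M (s : St) (B T F acc rv : List (List Bool)) (D M M' : List Bool) :
    (conf s B T F acc rv D M).set .M [M'] = conf s B T F acc rv D M' := St.set_set _ _ _ _

lemma Env.conf {p : Par} {s : St} (h : Env p s) (B T F acc rv : List (List Bool))
    (D M : List Bool) : Env p (conf s B T F acc rv D M) :=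
  ((((((h.set rfl _).set rfl _).set rfl _).set rfl _).set rfl _).set rfl _).set rfl _

lemma length_nextT {c : Color} {b T : List Bool} {n : ℕ} (hb : b.length = n) (hT : T.length = n) :
    (nextT c b T).length = n := by
  unfold nextT orW; split_ifs <;> simp [hb, hT]

lemma length_nextF {c : Color} {b F : List Bool} {n : ℕ} (hb : b.length = n) (hF : F.length = n) :
    (nextF c b F).length = n := by
  unfold nextF orW; split_ifs <;> simp [hb, hF]

section steps

variable {p : Par} {s : St} {b T F D : List Bool} {B Ts Fs acc ACC zs : List (List Bool)}

lemma runS_leave {s : St} {N : ℕ} (hB : s.get .B = b :: B) (hT : s.get .T = T :: Ts)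
    (hF : s.get .F = F :: Fs) (hb : b.length ≤ N) (hTn : T.length ≤ N) (hFn : F.length ≤ N) :
    RunS N leave s (((s.set .B B).set .T Ts).set .F Fs) := by
  refine (runS_drop hB hb).seq ((runS_drop (w := T) (l := Ts) ?_ hTn).seq
    (runS_drop (w := F) (l := Fs) ?_ hFn))
  · simp [St.get_set, hT]
  · simp [St.get_set, hF]

lemma runS_call (h : Env p s) (hbn : b.length = p.n) (hTn : T.length = p.n)
    (hFn : F.length = p.n) (hb : meetW b b = true) :
    RunS p.N (mainBody true) (conf s (b :: B) (T :: Ts) (F :: Fs) ACC [] D [])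
      (conf s (kidsW true b p.P :: b :: B) (nextT .taken b T :: T :: Ts)
        (nextF .taken b F :: F :: Fs) (List.replicate p.n p.zero ++ ACC) []
        (Color.taken.code ++ D) [true]) := by
  have hn := p.n_le
  have hLN := p.L_le
  have hE := h.conf (b :: B) (T :: Ts) (F :: Fs) ACC [] D []
  refine runS_ifNonempty (b := b) (B := B) ?_ (by omega) ?_
  · simp [conf, St.get_set]
  · rw [if_pos hb]
    refine (runS_fill (w := p.zero) (l := []) hE.nn (by omega) ?_ (by simpa using hLN) (by decide) (by decide)
      (by decide) (by decide) (by decide)).seq ((runS_enter (p := p) (b := b) (T := T) (F := F)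
        (d := D) (m := []) (B := B) (Ts := Ts) (Fs := Fs) (D := []) (M := []) ?_ _ ?_ ?_ ?_ ?_ ?_
        hbn hTn hFn).of_eq (St.ext_get fun j => ?_))
    · simp [conf, St.get_set, h.z0]
    · exact hE.set rfl _
    · simp [conf, St.get_set]
    · simp [conf, St.get_set]
    · simp [conf, St.get_set]
    · simp [conf, St.get_set]
    · simp [conf, St.get_set]
    · simp only [conf, St.get_set]
      clear h hE
      split_ifs <;> simp_all

/-- On an empty level there is nothing to compute. The zeros returned are never multiplied into
anything relevant, since no vertex of the level above has a child. -/
lemma runS_leaf (h : Env p s) (hbn : b.length = p.n) (hTn : T.length = p.n)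
    (hFn : F.length = p.n) (hb : meetW b b = false) :
    RunS p.N (mainBody true) (conf s (b :: B) (T :: Ts) (F :: Fs) ACC [] D [])
      (conf s B Ts Fs ACC (List.replicate p.n p.zero) D [false]) := by
  have hn := p.n_le
  have hLN := p.L_le
  have hE := h.conf (b :: B) (T :: Ts) (F :: Fs) ACC [] D []
  refine runS_ifNonempty (b := b) (B := B) ?_ (by omega) ?_
  · simp [conf, St.get_set]
  · rw [hb, if_neg Bool.false_ne_true]
    refine (runS_leave (b := b) (T := T) (F := F) (B := B) (Ts := Ts) (Fs := Fs) ?_ ?_ ?_ (by omega)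
      (by omega) (by omega)).seq ((runS_fill (n := p.n) (w := p.zero) (l := [])
      ?_ (by omega) ?_ (by simpa using hLN) (by decide) (by decide)
      (by decide) (by decide) (by decide)).seq
      ((RunS.push (w := []) (l := []) ?_ _).of_eq (St.ext_get fun j => ?_)))
    · simp [conf, St.get_set]
    · simp [conf, St.get_set]
    · simp [conf, St.get_set]
    · simp [conf, St.get_set, h.nn]
    · simp [conf, St.get_set, h.z0]
    · simp [conf, St.get_set]
    · simp only [conf, St.get_set]
      clear h hE
      split_ifs <;> simp_all

lemma runS_combine_enter (h : Env p s) (c c' : Color) (hbn : b.length = p.n) (hTn : T.length = p.n)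
    (hFn : F.length = p.n) (hzs : zs.length = p.n) (hz : ∀ z ∈ zs, z.length = p.L)
    (hal : acc.length = p.n) (ha : ∀ a ∈ acc, a.length = p.L) :
    RunS p.N (.seq (combine c) (enter c'))
      (conf s (b :: B) (T :: Ts) (F :: Fs) (acc ++ ACC) zs D [])
      (conf s (kidsW true b p.P :: b :: B) (nextT c' b T :: T :: Ts)
        (nextF c' b F :: F :: Fs) (combineW p c T F zs acc ++ ACC) [] (c'.code ++ D) [true]) := by
  have hn := p.n_le
  have hE := h.conf (b :: B) (T :: Ts) (F :: Fs) (acc ++ ACC) zs D []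
  refine (runS_combine (T := T) (F := F) (zs := zs) (acc := acc) (Ts := Ts) (Fs := Fs) (RV := [])
    (ACC := ACC) hE c ?_ ?_ hTn hFn hzs hz ?_ ?_ hal ha).seq ((runS_enter (p := p) (b := b) (T := T)
    (F := F) (d := D) (m := []) (B := B) (Ts := Ts) (Fs := Fs) (D := []) (M := [])
    ((hE.set rfl _).set rfl _) c' ?_ ?_ ?_ ?_ ?_ hbn hTn hFn).of_eq (St.ext_get fun j => ?_))
  · simp [conf, St.get_set]
  · simp [conf, St.get_set]
  · simp [conf, St.get_set]
  · simp [conf, St.get_set]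
  · simp [conf, St.get_set]
  · simp [conf, St.get_set]
  · simp [conf, St.get_set]
  · simp [conf, St.get_set]
  · simp [conf, St.get_set]
  · simp only [conf, St.get_set]
    clear h hE
    split_ifs <;> simp_all

lemma get_conf_D {s : St} {B T F acc rv : List (List Bool)} {D M : List Bool} :
    (conf s B T F acc rv D M).get .D = [D] := by simp [conf, St.get_set]

lemma conf_set_D {s : St} {B T F acc rv : List (List Bool)} {D D' M : List Bool} :
    (conf s B T F acc rv D M).set .D [D'] = conf s B T F acc rv D' M := by
  refine St.ext_get fun j => ?_
  simp only [conf, St.get_set]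
  split_ifs <;> simp_all

lemma runS_ret_taken (h : Env p s) (hbn : b.length = p.n) (hTn : T.length = p.n)
    (hFn : F.length = p.n) (hzs : zs.length = p.n) (hz : ∀ z ∈ zs, z.length = p.L)
    (hal : acc.length = p.n) (ha : ∀ a ∈ acc, a.length = p.L) :
    RunS p.N (mainBody false)
      (conf s (b :: B) (T :: Ts) (F :: Fs) (acc ++ ACC) zs (Color.taken.code ++ D) [])
      (conf s (kidsW true b p.P :: b :: B) (nextT .free b T :: T :: Ts)
        (nextF .free b F :: F :: Fs) (combineW p .taken T F zs acc ++ ACC) []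
        (Color.free.code ++ D) [true]) := by
  refine RunS.pop_bit (b := false) (w := D) (l := []) get_conf_D ?_
  rw [conf_set_D]
  exact runS_combine_enter h .taken .free hbn hTn hFn hzs hz hal ha

lemma runS_ret_free (h : Env p s) (hbn : b.length = p.n) (hTn : T.length = p.n)
    (hFn : F.length = p.n) (hzs : zs.length = p.n) (hz : ∀ z ∈ zs, z.length = p.L)
    (hal : acc.length = p.n) (ha : ∀ a ∈ acc, a.length = p.L) :
    RunS p.N (mainBody false)
      (conf s (b :: B) (T :: Ts) (F :: Fs) (acc ++ ACC) zs (Color.free.code ++ D) [])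
      (conf s (kidsW true b p.P :: b :: B) (nextT .banned b T :: T :: Ts)
        (nextF .banned b F :: F :: Fs) (combineW p .free T F zs acc ++ ACC) []
        (Color.banned.code ++ D) [true]) := by
  refine RunS.pop_bit (b := true) (w := false :: D) (l := []) get_conf_D
    (RunS.pop_bit (b := false) (w := D) (l := []) (St.get_set_self _ _ _) ?_)
  rw [conf_set_D, conf_set_D]
  exact runS_combine_enter h .free .banned hbn hTn hFn hzs hz hal ha

/-- `banned` is the last colour: the sum over the colours is complete, the frame is removed and the
sum becomes the result on `rv`. Two applications of `revVec` keep its order. -/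
lemma runS_ret_banned (h : Env p s) (hbn : b.length = p.n) (hTn : T.length = p.n)
    (hFn : F.length = p.n) (hzs : zs.length = p.n) (hz : ∀ z ∈ zs, z.length = p.L)
    (hal : acc.length = p.n) (ha : ∀ a ∈ acc, a.length = p.L) :
    RunS p.N (mainBody false)
      (conf s (b :: B) (T :: Ts) (F :: Fs) (acc ++ ACC) zs (Color.banned.code ++ D) [])
      (conf s B Ts Fs ACC (combineW p .banned T F zs acc) D [false]) := by
  have hn := p.n_le
  have hLN := p.L_le
  refine RunS.pop_bit (b := true) (w := true :: D) (l := []) get_conf_D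
    (RunS.pop_bit (b := true) (w := D) (l := []) (St.get_set_self _ _ _) ?_)
  rw [conf_set_D, conf_set_D]
  have hE := h.conf (b :: B) (T :: Ts) (F :: Fs) (acc ++ ACC) zs D []
  have hlen := length_of_mem_combineW (p := p) (c := .banned) (T := T) (F := F) hz ha
  refine (runS_combine (T := T) (F := F) (zs := zs) (acc := acc) (Ts := Ts) (Fs := Fs) (RV := [])
    (ACC := ACC) hE .banned ?_ ?_ hTn hFn hzs hz ?_ ?_ hal ha).seq ((runS_leave (b := b) (T := T)
    (F := F) (B := B) (Ts := Ts) (Fs := Fs) ?_ ?_ ?_ (by omega) (by omega) (by omega)).seq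
    ((runS_revVec (n := p.n) (ws := combineW p .banned T F zs acc) (l := ACC) ?_ (by omega)
      (length_combineW hal) (fun w hw => by rw [hlen w hw]; exact hLN) ?_ (by decide) (by decide)
      (by decide)).seq
    ((runS_revVec (n := p.n) (ws := (combineW p .banned T F zs acc).reverse.map List.reverse)
      (l := s.get .acc2) ?_ (by omega) (by simpa using length_combineW hal) ?_ ?_ (by decide)
      (by decide) (by decide)).seq
    ((RunS.push (w := []) (l := []) ?_ _).of_eq (St.ext_get fun j => ?_)))))
  · simp [conf, St.get_set]
  · simp [conf, St.get_set]
  · simp [conf, St.get_set]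
  · simp [conf, St.get_set]
  · simp [conf, St.get_set]
  · simp [conf, St.get_set]
  · simp [conf, St.get_set]
  · simp [conf, St.get_set, h.nn]
  · simp [conf, St.get_set]
  · simp [conf, St.get_set, h.nn]
  · intro w hw
    simp only [List.mem_reverse, List.mem_map] at hw
    obtain ⟨v, hv, rfl⟩ := hw
    rw [List.length_reverse, hlen v hv]
    omega
  · simp [conf, St.get_set]
  · simp [conf, St.get_set]
  · simp only [conf, St.get_set]
    clear h hE
    split_ifs <;> simp_all

end steps

/-! ### Number of iterations and space of the recursion -/

/-- `Iter N m i s s'`: after `i` iterations of the main loop, `s` has become `s'`, and the stores at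
the beginning of these iterations have size at most `m`. -/
inductive Iter (N m : ℕ) : ℕ → St → St → Prop
  | refl (s : St) : Iter N m 0 s s
  | step {i : ℕ} {s s' s'' : St} {b : Bool} {w : List Bool} {l : List (List Bool)} :
      s.get .M = (b :: w) :: l → RunS N (mainBody b) (s.set .M (w :: l)) s' →
      s.get.size ≤ m → Iter N m i s' s'' → Iter N m (i + 1) s s''

lemma Iter.trans {N m i j : ℕ} {s s' s'' : St} (h : Iter N m i s s') (h' : Iter N m j s' s'') :
    Iter N m (i + j) s s'' := by
  induction h with
  | refl => simpa using h'
  | step h1 h2 h3 _ ih =>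
    rw [add_right_comm]
    exact .step h1 h2 h3 (ih h')

/-- A bound for the time of an iteration of the main loop. -/
noncomputable def mainCost (N : ℕ) : ℕ :=
  (mainBody false).cost.eval N + (mainBody true).cost.eval N

/-- Adding up the time of all iterations would give exponential space. Instead, every iteration
starts from a store of size at most `m`, and within it the size grows by at most its own time
`mainCost N`. -/
lemma Iter.run {N m i : ℕ} {s s' : St} (h : Iter N m i s s') {m' t' : ℕ}
    (hm : m + mainCost N ≤ m') {s'' : St} (hr : Run m' (.loop .M mainBody) s'.get s''.get t') :
    ∃ t ≤ i * (1 + mainCost N) + t', Run m' (.loop .M mainBody) s.get s''.get t := by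
  induction h with
  | refl => exact ⟨t', by omega, hr⟩
  | @step i s s' _ b w l h1 h2 h3 _ ih =>
    obtain ⟨t1, ht1, r1⟩ := ih hr
    obtain ⟨t2, ht2, r2⟩ := h2
    have hc : (mainBody b).cost.eval N ≤ mainCost N := by
      unfold mainCost; cases b <;> omega
    have hsz : (s.set .M (w :: l)).get.size ≤ s.get.size := size_update_word h1
    refine ⟨t2 + 1 + t1, ?_, .loop_bit b w l h1 (by omega) (r2.of_size_add_le (by omega)) r1⟩
    rw [add_mul, one_mul]
    omega

/-- The vector of the numbers of the vertices, correct on the level `b`, if there are at most `j`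
further levels including `b`. -/
def solveW (p : Par) : ℕ → List Bool → List Bool → List Bool → List (List Bool)
  | 0, _, _, _ => List.replicate p.n p.zero
  | j + 1, b, T, F =>
    if meetW b b then
      combineW p .banned T F (solveW p j (kidsW true b p.P) (nextT .banned b T) (nextF .banned b F))
        (combineW p .free T F (solveW p j (kidsW true b p.P) (nextT .free b T) (nextF .free b F))
          (combineW p .taken T F
            (solveW p j (kidsW true b p.P) (nextT .taken b T) (nextF .taken b F))
            (List.replicate p.n p.zero)))
    else List.replicate p.n p.zero

lemma length_solveW (p : Par) : ∀ (j : ℕ) (b T F : List Bool), (solveW p j b T F).length = p.n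
  | 0, _, _, _ => by simp [solveW]
  | j + 1, b, T, F => by
    unfold solveW
    split_ifs
    · exact length_combineW (length_combineW (length_combineW (by simp)))
    · simp

lemma length_of_mem_solveW (p : Par) : ∀ (j : ℕ) (b T F : List Bool),
    ∀ w ∈ solveW p j b T F, w.length = p.L
  | 0, _, _, _, w, hw => by
    rw [List.eq_of_mem_replicate hw, Par.length_zero]
  | j + 1, b, T, F, w, hw => by
    unfold solveW at hw
    split_ifs at hw
    · exact length_of_mem_combineW (length_of_mem_solveW p j _ _ _)
        (length_of_mem_combineW (length_of_mem_solveW p j _ _ _)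
          (length_of_mem_combineW (length_of_mem_solveW p j _ _ _) fun a ha => by
            rw [List.eq_of_mem_replicate ha, Par.length_zero])) w hw
    · rw [List.eq_of_mem_replicate hw, Par.length_zero]

lemma length_encodeWords {ws : List (List Bool)} {L : ℕ} (h : ∀ w ∈ ws, w.length = L) :
    (encodeWords ws).length = ws.length * (L + 1) := by
  induction ws with
  | nil => simp
  | cons w ws ih =>
    have h1 := h w List.mem_cons_self
    have h2 := ih fun v hv => h v (List.mem_cons_of_mem _ hv)
    rw [encodeWords] at h2 ⊢
    simp only [List.flatMap_cons, List.length_append, h2, List.length_map, h1, List.length_cons,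
      List.length_nil]
    ring

lemma length_encodeWords_cons (w : List Bool) (ws : List (List Bool)) :
    (encodeWords (w :: ws)).length = w.length + 1 + (encodeWords ws).length := by
  simp [encodeWords]
  omega

lemma size_set_le (s : St) (k : Reg) (v : List (List Bool)) :
    (s.set k v).get.size ≤ s.get.size + (encodeWords v).length :=
  Store.size_update_le (by omega)

lemma size_conf_le (s : St) (B T F acc rv : List (List Bool)) (D M : List Bool) :
    (conf s B T F acc rv D M).get.size ≤ s.get.size + (encodeWords B).length +
      (encodeWords T).length + (encodeWords F).length + (encodeWords acc).length +
      (encodeWords rv).length + D.length + M.length + 2 := by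
  have h1 := size_set_le s .B B
  have h2 := size_set_le (s.set .B B) .T T
  have h3 := size_set_le ((s.set .B B).set .T T) .F F
  have h4 := size_set_le (((s.set .B B).set .T T).set .F F) .acc acc
  have h5 := size_set_le ((((s.set .B B).set .T T).set .F F).set .acc acc) .rv rv
  have h6 := size_set_le (((((s.set .B B).set .T T).set .F F).set .acc acc).set .rv rv) .D [D]
  have h7 := size_set_le ((((((s.set .B B).set .T T).set .F F).set .acc acc).set .rv rv).set .D [D])
    .M [M]
  simp only [length_encodeWords_cons, encodeWords_nil, List.length_nil] at h6 h7
  unfold conf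
  omega

/-- A bound for the space that one level of the recursion needs. -/
def levelSize (p : Par) : ℕ := 3 * (p.n + 1) + 2 * (p.n * (p.L + 1)) + 10

/-- Induction on the number `j` of levels that may remain; the assumption on the iterate says that
the `j`-th generation below `b` is empty. A nonempty level costs one call, three recursive
computations and three returns, so the count becomes at most three times the old bound plus 4, that
is, `i + 2` triples; it starts from `i = 1`. A frame holds a set on each of `B`, `T` and `F`, a
vector of sums and a colour code of at most two bits; together with the vector on `rv` this fits
into `levelSize`. -/
theorem iter_solve {p : Par} {s : St} (h : Env p s) {m : ℕ} : ∀ (j : ℕ) {b T F D : List Bool}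
    {B Ts Fs ACC : List (List Bool)} (_ : b.length = p.n) (_ : T.length = p.n)
    (_ : F.length = p.n)
    (_ : meetW ((fun b => kidsW true b p.P)^[j] b) ((fun b => kidsW true b p.P)^[j] b) = false)
    (_ : s.get.size + (encodeWords B).length + (encodeWords Ts).length + (encodeWords Fs).length +
      (encodeWords ACC).length + D.length + (j + 1) * levelSize p ≤ m),
    ∃ i, i + 2 ≤ 3 ^ (j + 1) ∧ Iter p.N m i (conf s (b :: B) (T :: Ts) (F :: Fs) ACC [] D [true])
      (conf s B Ts Fs ACC (solveW p j b T F) D [false]) := by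
  intro j
  induction j with
  | zero =>
    intro b T F D B Ts Fs ACC hb hT hF hj hm
    refine ⟨1, by norm_num, .step (b := true) (w := []) (l := []) (St.get_set_self _ _ _) ?_ ?_
      (.refl _)⟩
    · rw [conf_set_M]
      exact runS_leaf h hb hT hF hj
    · have := size_conf_le s (b :: B) (T :: Ts) (F :: Fs) ACC [] D [true]
      simp only [length_encodeWords_cons, encodeWords_nil, List.length_nil, List.length_cons,
        levelSize] at this hm
      omega
  | succ j ih =>
    intro b T F D B Ts Fs ACC hb hT hF hj hm
    -- This covers the stores in which the present level is on top; those of deeper levels are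
    -- covered by the induction hypothesis.
    have hstep : ∀ (c : Bool) (acc rv : List (List Bool)) (D' : List Bool),
        (encodeWords acc).length ≤ p.n * (p.L + 1) →
        (encodeWords rv).length ≤ p.n * (p.L + 1) → D'.length ≤ 2 →
        (conf s (b :: B) (T :: Ts) (F :: Fs) (acc ++ ACC) rv (D' ++ D) [c]).get.size ≤ m := by
      intro c acc rv D' h1 h2 h3
      have := size_conf_le s (b :: B) (T :: Ts) (F :: Fs) (acc ++ ACC) rv (D' ++ D) [c]
      simp only [length_encodeWords_cons, encodeWords_append, List.length_nil,
        List.length_cons, List.length_append] at this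
      have h4 : levelSize p ≤ (j + 1 + 1) * levelSize p := Nat.le_mul_of_pos_left _ (by omega)
      simp only [levelSize] at h4 hm
      omega
    have hvec : ∀ ws : List (List Bool), ws.length = p.n → (∀ w ∈ ws, w.length = p.L) →
        (encodeWords ws).length ≤ p.n * (p.L + 1) := fun ws h1 h2 => by
      rw [length_encodeWords h2, h1]
    have hz0 : ∀ w ∈ List.replicate p.n p.zero, w.length = p.L := fun w hw => by
      rw [List.eq_of_mem_replicate hw, Par.length_zero]
    by_cases hbb : meetW b b = true
    · have hsub : ∀ (c : Color) (acc : List (List Bool)),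
          (encodeWords acc).length ≤ p.n * (p.L + 1) → ∃ i, i + 2 ≤ 3 ^ (j + 1) ∧ Iter p.N m i
            (conf s (kidsW true b p.P :: b :: B) (nextT c b T :: T :: Ts) (nextF c b F :: F :: Fs)
              (acc ++ ACC) [] (c.code ++ D) [true])
            (conf s (b :: B) (T :: Ts) (F :: Fs) (acc ++ ACC)
              (solveW p j (kidsW true b p.P) (nextT c b T) (nextF c b F)) (c.code ++ D)
              [false]) := by
        intro c acc hacc
        refine ih (by simp [kidsW, p.length_P]) (length_nextT hb hT) (length_nextF hb hF)
          (by simpa using hj) ?_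
        have hc : c.code.length ≤ 2 := by cases c <;> simp [Color.code]
        simp only [length_encodeWords_cons, encodeWords_append, List.length_append]
        rw [add_mul (j + 1), one_mul] at hm
        have : levelSize p = 3 * (p.n + 1) + 2 * (p.n * (p.L + 1)) + 10 := rfl
        omega
      have hl := length_solveW p j
      have hl' := length_of_mem_solveW p j
      set sub := fun c => solveW p j (kidsW true b p.P) (nextT c b T) (nextF c b F) with hsubdef
      set a1 := combineW p .taken T F (sub .taken) (List.replicate p.n p.zero) with ha1
      set a2 := combineW p .free T F (sub .free) a1 with ha2
      have l1 : a1.length = p.n := length_combineW (by simp)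
      have l2 : a2.length = p.n := length_combineW l1
      have m1 : ∀ w ∈ a1, w.length = p.L := length_of_mem_combineW (hl' _ _ _) hz0
      have m2 : ∀ w ∈ a2, w.length = p.L := length_of_mem_combineW (hl' _ _ _) m1
      obtain ⟨i1, hi1, it1⟩ := hsub .taken (List.replicate p.n p.zero) (hvec _ (by simp) hz0)
      obtain ⟨i2, hi2, it2⟩ := hsub .free a1 (hvec _ l1 m1)
      obtain ⟨i3, hi3, it3⟩ := hsub .banned a2 (hvec _ l2 m2)
      have s0 : Iter p.N m 1 (conf s (b :: B) (T :: Ts) (F :: Fs) ACC [] D [true]) _ :=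
        .step (b := true) (w := []) (l := []) (St.get_set_self _ _ _)
          (by rw [conf_set_M]; exact runS_call h hb hT hF hbb)
          (by simpa using hstep true [] [] [] (by simp) (by simp) (by simp)) (.refl _)
      have s1 : Iter p.N m 1 (conf s (b :: B) (T :: Ts) (F :: Fs)
          (List.replicate p.n p.zero ++ ACC) (sub .taken) (Color.taken.code ++ D) [false]) _ :=
        .step (b := false) (w := []) (l := []) (St.get_set_self _ _ _)
          (by
            rw [conf_set_M]
            exact runS_ret_taken h hb hT hF (hl _ _ _) (hl' _ _ _) (by simp) hz0)
          (hstep _ _ _ _ (hvec _ (by simp) hz0) (hvec _ (hl _ _ _) (hl' _ _ _)) (by simp [Color.code]))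
          (.refl _)
      have s2 : Iter p.N m 1 (conf s (b :: B) (T :: Ts) (F :: Fs)
          (a1 ++ ACC) (sub .free) (Color.free.code ++ D) [false]) _ :=
        .step (b := false) (w := []) (l := []) (St.get_set_self _ _ _)
          (by
            rw [conf_set_M]
            exact runS_ret_free h hb hT hF (hl _ _ _) (hl' _ _ _) l1 m1)
          (hstep _ _ _ _ (hvec _ l1 m1) (hvec _ (hl _ _ _) (hl' _ _ _)) (by simp [Color.code]))
          (.refl _)
      have s3 : Iter p.N m 1 (conf s (b :: B) (T :: Ts) (F :: Fs)
          (a2 ++ ACC) (sub .banned) (Color.banned.code ++ D) [false]) _ :=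
        .step (b := false) (w := []) (l := []) (St.get_set_self _ _ _)
          (by
            rw [conf_set_M]
            exact runS_ret_banned h hb hT hF (hl _ _ _) (hl' _ _ _) l2 m2)
          (hstep _ _ _ _ (hvec _ l2 m2) (hvec _ (hl _ _ _) (hl' _ _ _)) (by simp [Color.code]))
          (.refl _)
      have hsol : solveW p (j + 1) b T F = combineW p .banned T F (sub .banned) a2 := by
        rw [solveW, if_pos hbb]
      rw [hsol]
      refine ⟨_, ?_, s0.trans (it1.trans (s1.trans (it2.trans (s2.trans (it3.trans s3)))))⟩
      rw [pow_succ 3 (j + 1)]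
      omega
    · have hbb' : meetW b b = false := by simpa using hbb
      have hsol : solveW p (j + 1) b T F = List.replicate p.n p.zero := by
        rw [solveW, if_neg hbb]
      rw [hsol]
      refine ⟨1, ?_, .step (b := true) (w := []) (l := []) (St.get_set_self _ _ _) ?_ ?_
        (.refl _)⟩
      -- A branch may stop before the `j` levels are used up; its single iteration is within the
      -- bound.
      · have : 0 < 3 ^ (j + 1) := by positivity
        rw [pow_succ]
        omega
      · rw [conf_set_M]
        exact runS_leaf h hb hT hF hbb'
      · simpa using hstep true [] [] [] (by simp) (by simp) (by simp)

end DomSetTreeDepth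
namespace DomSetTreeDepth

/-! ### Constants and output -/

section routines

variable {N : ℕ} {s : St}

/-- Put as many bits `b` on the top word of `k` as the top word of `x` has, and remove the
latter. -/
def extend (k : Reg) (b : Bool) : Prog Reg := .loop .x fun _ => .push k b

lemma runS_extend {k : Reg} {w v : List Bool} {X l : List (List Bool)} (b : Bool)
    (hx : s.get .x = w :: X) (hk : s.get k = v :: l) (hw : w.length ≤ N) (hkx : k ≠ .x) :
    RunS N (extend k b) s ((s.set .x X).set k ((List.replicate w.length b ++ v) :: l)) := by
  refine RunS.loop_word (fun d _ => s.set k ((List.replicate d.length b ++ v) :: l)) hx hw ?_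
    (fun d a r _ => ?_) (St.ext_get fun j => ?_)
  · simp [← hk, St.set_get]
  · refine (RunS.push (w := List.replicate d.length b ++ v) (l := l) ?_ b).of_eq
      (St.ext_get fun j => ?_)
    · simp [St.get_set, hkx]
    · simp only [St.get_set, List.length_cons, List.replicate_succ]
      split_ifs <;> simp_all
  · simp only [St.get_set, List.length_reverse]
    split_ifs <;> simp_all

/-- Given `n + 1` in unary on `ee`, put `(n + 1) ^ 2` in unary on `z0`. -/
def makeZero : Prog Reg :=
  .seq (.new .z0) (timesOf .ee (.seq (dup .ee .x) (extend .z0 false)))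

lemma runS_makeZero {e : ℕ} (he : s.get .ee = [List.replicate e false]) (hN : e ≤ N) :
    RunS N makeZero s (s.set .z0 (List.replicate (e * e) false :: s.get .z0)) := by
  refine (RunS.new _ _).seq (runS_timesOf (List.replicate e ()) (n := e) (by simp) hN ?_
    (by decide) (by decide)
    (fun d _ => s.set .z0 (List.replicate (d.length * e) false :: s.get .z0)) ?_
    (fun d x r C _ => ?_) (St.ext_get fun j => ?_))
  · simpa [St.get_set] using he
  · simp
  · refine (runS_dup (w := List.replicate e false) (l := []) ?_ (by simpa using hN) (by decide)
      (by decide) (by decide)).seq ((runS_extend (w := List.replicate e false)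
        (v := List.replicate (d.length * e) false) (X := s.get .x) (l := s.get .z0) false ?_ ?_
        (by simpa using hN) (by decide)).of_eq (St.ext_get fun j => ?_))
    · simpa [St.get_set] using he
    · simp [St.get_set]
    · simp [St.get_set]
    · have : (d.length + 1) * e = e + d.length * e := by ring
      simp only [St.get_set, List.length_replicate, List.length_cons, this, List.replicate_add]
      split_ifs <;> simp_all
  · simp only [St.get_set, List.length_reverse, List.length_replicate]
    split_ifs <;> simp_all

/-- Doubling a number `i` times. -/
def doubleW (i : ℕ) (w : List Bool) : List Bool := (fun w => addW w w)^[i] w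

lemma length_doubleW (i : ℕ) (w : List Bool) : (doubleW i w).length = w.length := by
  induction i with
  | zero => rfl
  | succ i ih => rw [doubleW, Function.iterate_succ_apply', length_addW rfl]; exact ih

/-- Put the number `2 ^ (n + 1)` on `cx`. -/
def makePow : Prog Reg :=
  .seq (dup .o1 .cx) (timesOf .ee (.seq (dup .cx .w) (add .cx .w)))

lemma runS_makePow {e : ℕ} (he : s.get .ee = [List.replicate e false]) (hN : e ≤ N) {w : List Bool}
    {l : List (List Bool)} (ho : s.get .o1 = w :: l) (hw : w.length ≤ N) (hN1 : 1 ≤ N) :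
    RunS N makePow s (s.set .cx (doubleW e w :: s.get .cx)) := by
  refine (runS_dup ho hw (by decide) (by decide) (by decide)).seq
    (runS_timesOf (List.replicate e ()) (n := e) (by simp) hN ?_
    (by decide) (by decide) (fun d _ => s.set .cx (doubleW d.length w :: s.get .cx)) rfl
    (fun d x r C _ => ?_) (St.ext_get fun j => ?_))
  · simpa [St.get_set] using he
  · have hd := length_doubleW d.length w
    refine (runS_dup (w := doubleW d.length w) (l := s.get .cx) ?_ (by omega) (by decide)
      (by decide) (by decide)).seq ((runS_add (x := doubleW d.length w) (y := doubleW d.length w)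
        (A := s.get .cx) (B := s.get .w) ?_ ?_ rfl (by omega) hN1 (by decide) (by decide)
        (by decide) (by decide) (by decide)).of_eq (St.ext_get fun j => ?_))
    · simp [St.get_set]
    · simp [St.get_set]
    · simp [St.get_set]
    · have : doubleW (d.length + 1) w = addW (doubleW d.length w) (doubleW d.length w) := by
        simp [doubleW, Function.iterate_succ_apply']
      simp only [St.get_set, List.length_cons, this]
      split_ifs <;> simp_all
  · simp only [St.get_set, List.length_reverse, List.length_replicate]
    split_ifs <;> simp_all

/-- A binary number, most significant digit first and with leading zeros, in the format of the
output. -/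
def stripW (c : List Bool) : List Bool := (c.dropWhile not).reverse

/-- Move a bit from `x` to `out` unless it is a leading zero. -/
def outputBit : Prog Reg :=
  .pop .x fun b => .pop .fl fun f => .seq (.push .fl (b.getD false || f.getD false))
    (if (b.getD false || f.getD false) = true then .push .out (b.getD false) else .skip)

/-- Move a number with leading zeros from `x` to `out`. -/
def outputNumber : Prog Reg :=
  .seq (.new .out) (.seq (.new .fl) (.seq (.push .fl false) (.seq (timesOf .ee outputBit)
    (drop .fl))))

/-- The flag on `fl` records whether a one has been seen; up to then zeros are suppressed. Digits
arrive with the most significant one first, so pushing them leaves the least significant one on top,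
as in `Nat.bits`. -/
lemma runS_outputNumber {e : ℕ} (he : s.get .ee = [List.replicate e false]) (hN : e ≤ N)
    (hN1 : 1 ≤ N) {c r : List Bool} {X : List (List Bool)} (hx : s.get .x = (c ++ r) :: X)
    (hc : c.length = e) :
    RunS N outputNumber s ((s.set .x (r :: X)).set .out (stripW c :: s.get .out)) := by
  refine (RunS.new _ _).seq ((RunS.new _ _).seq ((RunS.push (w := []) (l := s.get .fl) ?_ _).seq
    ((runS_timesOf c hc hN ?_ (by decide) (by decide)
      (fun d t => ((s.set .x ((t ++ r) :: X)).set .fl ([d.any id] :: s.get .fl)).set .out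
        (stripW d.reverse :: s.get .out)) (St.ext_get fun j => ?_) (fun d b t C _ => ?_) rfl).seq
    ((runS_drop (w := [c.reverse.any id]) (l := s.get .fl) ?_ (by simpa using hN1)).of_eq
      (St.ext_get fun j => ?_)))))
  · simp [St.get_set]
  · simpa [St.get_set] using he
  · simp only [St.get_set, stripW]
    split_ifs <;> simp_all
  · refine RunS.pop_bit (b := b) (w := t ++ r) (l := X) ?_ (RunS.pop_bit (b := d.any id) (w := [])
      (l := s.get .fl) ?_ ((RunS.push (w := []) (l := s.get .fl) ?_ _).seq ?_))
    · simp [St.get_set]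
    · simp [St.get_set]
    · simp [St.get_set]
    · have hstrip : stripW (b :: d).reverse =
          if (b || d.any id) = true then b :: stripW d.reverse else stripW d.reverse := by
        simp only [stripW, List.reverse_cons, List.dropWhile_append]
        by_cases hd : d.any id = true
        · have : (d.reverse.dropWhile not).isEmpty = false := by
            rw [List.isEmpty_eq_false_iff]
            intro h
            rw [List.dropWhile_eq_nil_iff] at h
            obtain ⟨a, ha, hat⟩ := List.any_eq_true.1 hd
            have := h a (by simpa using ha)
            simp_all
          simp [this, hd]
        · have : d.reverse.dropWhile not = [] := by
            rw [List.dropWhile_eq_nil_iff]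
            intro a ha
            cases a
            · rfl
            · exact absurd (List.any_eq_true.2 ⟨true, by simpa using ha, rfl⟩) hd
          cases b <;> simp [this, hd]
      by_cases hb : (b || d.any id) = true
      · rw [if_pos hb] at hstrip
        have hb' : ((some b).getD false || (some (d.any id)).getD false) = true := hb
        rw [if_pos hb']
        refine (RunS.push (w := stripW d.reverse) (l := s.get .out) ?_ _).of_eq
          (St.ext_get fun j => ?_)
        · simp [St.get_set]
        · simp only [St.get_set, hstrip, Option.getD_some, List.any_cons, id]
          split_ifs <;> simp_all
      · rw [if_neg hb] at hstrip
        have hb' : ¬ ((some b).getD false || (some (d.any id)).getD false) = true := hb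
        rw [if_neg hb']
        refine (RunS.skip _).of_eq (St.ext_get fun j => ?_)
        simp only [St.get_set, hstrip, Option.getD_some, List.any_cons, id]
        split_ifs <;> simp_all
  · simp [St.get_set]
  · simp only [St.get_set, List.reverse_reverse]
    split_ifs <;> simp_all

/-- Move numbers with leading zeros from the top word of `x` to `out`. -/
def output : Prog Reg := .seq (timesOf .ee outputNumber) (drop .x)

/-- The last number read ends on top of `out`, which explains the reversal: the block of the highest
coefficient is read first, and q_0 comes out on top. -/
lemma runS_output {e : ℕ} (he : s.get .ee = [List.replicate e false]) (hN : e ≤ N)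
    (hN1 : 1 ≤ N) {cs : List (List Bool)} {X : List (List Bool)}
    (hx : s.get .x = cs.flatten :: X) (hc : ∀ c ∈ cs, c.length = e) (hcs : cs.length = e) :
    RunS N output s ((s.set .x X).set .out ((cs.map stripW).reverse ++ s.get .out)) := by
  refine (runS_timesOf cs hcs hN he (by decide) (by decide)
    (fun d r => (s.set .x (r.flatten :: X)).set .out (d.map stripW ++ s.get .out))
    (St.ext_get fun j => ?_) (fun d c r C hd => ?_) rfl).seq
    ((runS_drop (w := []) (l := X) ?_ (by simp)).of_eq (St.ext_get fun j => ?_))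
  · simp only [St.get_set]
    split_ifs <;> simp_all
  · refine (runS_outputNumber (e := e) (c := c) (r := r.flatten) (X := X) ?_ hN hN1 ?_
      (hc c (by rw [← hd]; simp))).of_eq (St.ext_get fun j => ?_)
    · simpa [St.get_set] using he
    · simp [St.get_set]
    · simp only [St.get_set, List.map_cons]
      split_ifs <;> simp_all
  · simp [St.get_set]
  · simp only [St.get_set, List.map_reverse]
    split_ifs <;> simp_all

end routines

end DomSetTreeDepth
namespace DomSetTreeDepth

/-! ### The complete program -/

/-- The state in which all stacks are empty. -/
def St.empty : St := fun _ => []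

@[simp] lemma St.get_empty (k : Reg) : St.empty.get k = [] := rfl

/-- The contents of the constant stacks during the main part of the computation. -/
def Par.base (p : Par) : St :=
  (((((((St.empty.set .nn [List.replicate p.n false]).set .ee
    [List.replicate (p.n + 1) false]).set .A p.A).set .P p.P).set .z0 [p.zero]).set .o1
      [p.one]).set .cm [p.negOne]).set .cx [p.cx]

lemma Par.env_base (p : Par) : Env p p.base := by
  constructor <;> simp [Par.base, St.get_set]

/-- The roots of the forest. -/
def Par.roots (p : Par) : List Bool := kidsW false p.negOne p.P

/-- Read the number of vertices. -/
def readSize : Prog Reg :=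
  .seq (dup .inp .x) (.seq (.new .nn) (.seq (extend .nn false)
    (.seq (.new .ee) (.seq (.push .ee false) (.seq (dup .nn .x) (extend .ee false))))))

/-- Read the matrices. -/
def readMatrices : Prog Reg :=
  .seq (revVec .inp .u) (.seq (revVec .u .A) (.seq (revVec .inp .u) (revVec .u .P)))

/-- Write the constants. -/
def writeConstants : Prog Reg :=
  .seq makeZero (.seq (dup .z0 .o1) (.seq (.pop .o1 fun _ => .push .o1 true)
    (.seq (dup .z0 .x) (.seq (.new .cm) (.seq (extend .cm true) makePow)))))

/-- Prepare the call of the recursion for the roots. -/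
def callRoots : Prog Reg :=
  .seq (dup .cm .ms) (.seq (kidsSet false) (.seq (drop .ms) (.seq (dup .nn .T) (.seq (dup .nn .F)
    (.seq (.new .D) (.seq (.new .M) (.push .M true)))))))

/-- Prepare the main loop. -/
def prepare : Prog Reg :=
  .seq readSize (.seq readMatrices (.seq writeConstants callRoots))

/-- Remove the constants. -/
def cleanUp : Prog Reg :=
  .seq (dropVec .A) (.seq (dropVec .P) (.seq (drop .nn) (.seq (drop .ee) (.seq (drop .z0)
    (.seq (drop .o1) (.seq (drop .cm) (drop .cx)))))))

/-- Multiply the numbers of the roots and write the output. -/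
def finalize : Prog Reg :=
  .seq (dup .cm .ms) (.seq (dup .o1 .tm) (.seq (kidsProd false) (.seq (drop .ms)
    (.seq (dropVec .rv) (.seq (rev .tm .x) (.seq output cleanUp))))))

/-- The program that counts dominating sets. -/
def countProg : Prog Reg :=
  .pop .inp fun o => if o = none then .seq (.new .out) (.push .out true) else
    .seq (.push .inp (o.getD false)) (.seq prepare (.seq (.loop .M mainBody) finalize))

section

variable {p : Par} {s : St}

/-- The number of vertices is the length of the first row, hence the assumption that there is one.
-/
lemma runS_readSize (hn : 0 < p.n) (hN : p.n + 1 ≤ p.N) {l : List (List Bool)}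
    (h : s.get .inp = p.A ++ l) (hnn : s.get .nn = []) (hee : s.get .ee = []) :
    RunS p.N readSize s ((s.set .nn [List.replicate p.n false]).set .ee
      [List.replicate (p.n + 1) false]) := by
  obtain ⟨r, A', hA⟩ : ∃ r A', p.A = r :: A' := by
    have := p.length_A
    cases hA : p.A with
    | nil => simp [hA] at this; omega
    | cons r A' => exact ⟨r, A', rfl⟩
  have hr : r.length = p.n := p.length_of_mem_A r (by simp [hA])
  refine (runS_dup (w := r) (l := A' ++ l) (by rw [h, hA]; rfl) (by omega) (by decide) (by decide)
    (by decide)).seq ((RunS.new _ _).seq ((runS_extend (w := r) (v := []) (X := s.get .x) (l := [])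
    false ?_ ?_ (by omega) (by decide)).seq ((RunS.new _ _).seq ((RunS.push (w := []) (l := []) ?_
    _).seq ((runS_dup (w := List.replicate p.n false) (l := []) ?_ (by simp; omega) (by decide)
    (by decide) (by decide)).seq ((runS_extend (w := List.replicate p.n false) (v := [false])
      (X := s.get .x) (l := []) false ?_ ?_ (by simp; omega) (by decide)).of_eq
        (St.ext_get fun j => ?_)))))))
  · simp [St.get_set]
  · simp [St.get_set, hnn]
  · simp [St.get_set, hee]
  · simp [St.get_set, hr]
  · simp [St.get_set]
  · simp [St.get_set]
  · simp only [St.get_set, List.length_replicate, List.replicate_succ']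
    split_ifs <;> simp_all

lemma runS_readMatrices (hnn : s.get .nn = [List.replicate p.n false])
    (h : s.get .inp = p.A ++ p.P) (hA : s.get .A = []) (hP : s.get .P = []) :
    RunS p.N readMatrices s (((s.set .inp []).set .A p.A).set .P p.P) := by
  have hn := p.n_le
  have hA' : ∀ w ∈ p.A, w.length ≤ p.N := fun w hw => by rw [p.length_of_mem_A w hw]; omega
  have hP' : ∀ w ∈ p.P, w.length ≤ p.N := fun w hw => by rw [p.length_of_mem_P w hw]; omega
  have hrev : ∀ l : List (List Bool), (∀ w ∈ l, w.length ≤ p.N) →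
      ∀ w ∈ l.reverse.map List.reverse, w.length ≤ p.N := by
    intro l hl w hw
    simp only [List.mem_reverse, List.mem_map] at hw
    obtain ⟨v, hv, rfl⟩ := hw
    simpa using hl v hv
  refine (runS_revVec (n := p.n) (ws := p.A) (l := p.P) hnn (by omega) p.length_A hA' h (by decide)
    (by decide) (by decide)).seq ((runS_revVec (n := p.n) (ws := p.A.reverse.map List.reverse)
      (l := s.get .u) ?_ (by omega) (by simpa using p.length_A) (hrev _ hA') ?_ (by decide)
      (by decide) (by decide)).seq ((runS_revVec (n := p.n) (ws := p.P) (l := []) ?_ (by omega)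
      p.length_P hP' ?_ (by decide) (by decide) (by decide)).seq ((runS_revVec (n := p.n)
      (ws := p.P.reverse.map List.reverse) (l := s.get .u) ?_ (by omega)
      (by simpa using p.length_P) (hrev _ hP') ?_ (by decide)
      (by decide) (by decide)).of_eq (St.ext_get fun j => ?_))))
  · simpa [St.get_set] using hnn
  · simp [St.get_set]
  · simpa [St.get_set] using hnn
  · simp [St.get_set]
  · simpa [St.get_set] using hnn
  · simp [St.get_set]
  · simp only [St.get_set]
    split_ifs <;> simp_all

lemma runS_writeConstants (hL : p.L = (p.n + 1) * (p.n + 1)) (hcx : p.cx = doubleW (p.n + 1) p.one)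
    (hN : p.n + 1 ≤ p.N) (hee : s.get .ee = [List.replicate (p.n + 1) false])
    (hz : s.get .z0 = []) (ho : s.get .o1 = []) (hcm : s.get .cm = []) (hcx0 : s.get .cx = []) :
    RunS p.N writeConstants s ((((s.set .z0 [p.zero]).set .o1 [p.one]).set .cm [p.negOne]).set .cx
      [p.cx]) := by
  have hLN := p.L_le
  have hz' : p.zero = false :: List.replicate (p.L - 1) false := by
    have := p.L_pos
    rw [Par.zero, ← List.replicate_succ, Nat.sub_add_cancel this]
  refine ((runS_makeZero hee hN).of_eq (s'' := s.set .z0 [p.zero]) ?_).seq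
    ((runS_dup (w := p.zero) (l := []) ?_ (by simpa using hLN) (by decide) (by decide)
      (by decide)).seq
    -- The number 1 arises from 0 by changing its lowest digit.
    ((RunS.pop_bit (b := false) (w := List.replicate (p.L - 1) false) (l := []) ?_
      (RunS.push (w := List.replicate (p.L - 1) false) (l := []) ?_ true)).seq
    ((runS_dup (w := p.zero) (l := []) ?_ (by simpa using hLN) (by decide) (by decide)
      (by decide)).seq ((RunS.new _ _).seq
    ((runS_extend (w := p.zero) (v := []) (X := s.get .x) (l := []) true ?_ ?_
      (by simpa using hLN) (by decide)).seq
    ((runS_makePow (e := p.n + 1) (w := p.one) (l := []) ?_ hN ?_ (by simpa using hLN)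
      (by omega)).of_eq (St.ext_get fun j => ?_)))))))
  · rw [hz, ← hL]; rfl
  · simp [St.get_set]
  · simp [St.get_set, ho, hz']
  · simp [St.get_set]
  · simp [St.get_set]
  · simp [St.get_set]
  · simp [St.get_set, hcm]
  · simp [St.get_set, hee]
  · simp [St.get_set, Par.one]
  · have h1 : true :: List.replicate (p.L - 1) false = p.one := rfl
    have h2 : List.replicate p.L true = p.negOne := rfl
    simp only [St.get_set, Par.length_zero, List.append_nil, h1, h2, ← hcx]
    split_ifs <;> simp_all

/-- The all-ones word serves as the set of all vertices: a root is a vertex whose parent row does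
not meet it. The unary number on `nn`, a word of `n` zeros, doubles as the empty set for `T` and
`F`. -/
lemma runS_callRoots (h : Env p s) (hnL : p.n ≤ p.L) :
    RunS p.N callRoots s ((((((s.set .B (p.roots :: s.get .B)).set .T
      (List.replicate p.n false :: s.get .T)).set .F (List.replicate p.n false :: s.get .F)).set .D
        ([] :: s.get .D)).set .M ([true] :: s.get .M))) := by
  have hn := p.n_le
  have hLN := p.L_le
  refine (runS_dup (w := p.negOne) (l := []) h.cm (by simpa using hLN) (by decide) (by decide)
    (by decide)).seq ((runS_kidsSet (b := p.negOne) (MS := s.get .ms) (h.set rfl _) false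
      (St.get_set_self _ _ _) (by simpa using hnL) (by simpa using hLN)).seq ((runS_drop
      (w := p.negOne) (l := s.get .ms) ?_ (by simpa using hLN)).seq
    ((runS_dup (w := List.replicate p.n false) (l := []) ?_ (by simp; omega) (by decide)
      (by decide) (by decide)).seq
    ((runS_dup (w := List.replicate p.n false) (l := []) ?_ (by simp; omega) (by decide)
      (by decide) (by decide)).seq
    ((RunS.new _ _).seq ((RunS.new _ _).seq ((RunS.push (w := []) (l := s.get .M) ?_ _).of_eq
      (St.ext_get fun j => ?_))))))))
  · simp [St.get_set]
  · simp [St.get_set, h.nn]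
  · simp [St.get_set, h.nn]
  · simp [St.get_set]
  · have hr : kidsW false p.negOne p.P = p.roots := rfl
    simp only [St.get_set, hr]
    clear h
    split_ifs <;> simp_all

/-- The state before the main loop. -/
def Par.start (p : Par) : St :=
  conf p.base [p.roots] [List.replicate p.n false] [List.replicate p.n false] [] [] [] [true]

lemma runS_prepare (hn : 0 < p.n) (hL : p.L = (p.n + 1) * (p.n + 1))
    (hcx : p.cx = doubleW (p.n + 1) p.one) :
    RunS p.N prepare (St.empty.set .inp (p.A ++ p.P)) p.start := by
  have hN := p.n_le
  have hnL : p.n ≤ p.L := by rw [hL]; nlinarith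
  refine (runS_readSize (p := p) (l := p.P) hn (by omega) ?_ ?_ ?_).seq ((runS_readMatrices ?_ ?_
    ?_ ?_).seq (((runS_writeConstants hL hcx (by omega) ?_ ?_ ?_ ?_ ?_).of_eq
    (s'' := p.base) (St.ext_get fun j => ?_)).seq ((runS_callRoots p.env_base hnL).of_eq
    (St.ext_get fun j => ?_))))
  · simp [St.get_set]
  · simp [St.get_set]
  · simp [St.get_set]
  · simp [St.get_set]
  · simp [St.get_set]
  · simp [St.get_set]
  · simp [St.get_set]
  · simp [St.get_set]
  · simp [St.get_set]
  · simp [St.get_set]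
  · simp [St.get_set]
  · simp [St.get_set]
  · simp only [Par.base, St.get_set]
    split_ifs <;> simp_all
  · cases j <;> simp [Par.start, conf, Par.base, St.get_set]

lemma runS_cleanUp {l : List (List Bool)} (hN : p.n + 1 ≤ p.N) :
    RunS p.N cleanUp (p.base.set .out l) (St.empty.set .out l) := by
  have hn := p.n_le
  have hLN := p.L_le
  have hcx := p.length_cx
  refine (runS_dropVec (n := p.n) (ws := p.A) (l := []) ?_ (by omega) p.length_A
    (fun w hw => by rw [p.length_of_mem_A w hw]; omega) ?_ (by decide)).seq
    ((runS_dropVec (n := p.n) (ws := p.P) (l := []) ?_ (by omega) p.length_P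
      (fun w hw => by rw [p.length_of_mem_P w hw]; omega) ?_ (by decide)).seq
    ((runS_drop (w := List.replicate p.n false) (l := []) ?_ (by simp; omega)).seq
    ((runS_drop (w := List.replicate (p.n + 1) false) (l := []) ?_ (by simp; omega)).seq
    ((runS_drop (w := p.zero) (l := []) ?_ (by simpa using hLN)).seq
    ((runS_drop (w := p.one) (l := []) ?_ (by simpa using hLN)).seq
    ((runS_drop (w := p.negOne) (l := []) ?_ (by simpa using hLN)).seq
    ((runS_drop (w := p.cx) (l := []) ?_ (by omega)).of_eq (St.ext_get fun j => ?_))))))))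
  · simp [Par.base, St.get_set]
  · simp [Par.base, St.get_set]
  · simp [Par.base, St.get_set]
  · simp [Par.base, St.get_set]
  · simp [Par.base, St.get_set]
  · simp [Par.base, St.get_set]
  · simp [Par.base, St.get_set]
  · simp [Par.base, St.get_set]
  · simp [Par.base, St.get_set]
  · simp [Par.base, St.get_set]
  · cases j <;> simp [Par.base, St.get_set]

/-- The final number. -/
def resultW (p : Par) (zs : List (List Bool)) : List Bool :=
  prodW false p.negOne (p.P.zip zs) p.one

lemma runS_finalize (hnL : p.n ≤ p.L) {zs cs : List (List Bool)} (hzs : zs.length = p.n)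
    (hz : ∀ z ∈ zs, z.length = p.L) (hcs : (resultW p zs).reverse = cs.flatten)
    (hc : ∀ c ∈ cs, c.length = p.n + 1) (hcl : cs.length = p.n + 1) (hN : p.n + 1 ≤ p.N) :
    RunS p.N finalize (p.base.set .rv zs) (St.empty.set .out (cs.map stripW).reverse) := by
  have hn := p.n_le
  have hLN := p.L_le
  have hE := p.env_base.set (k := .rv) rfl zs
  have hres : (resultW p zs).length = p.L := length_prodW _ (by simp) fun rz hrz =>
    hz _ (List.of_mem_zip (a := rz.1) (b := rz.2) hrz).2
  refine (runS_dup (w := p.negOne) (l := []) hE.cm (by simpa using hLN) (by decide) (by decide)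
    (by decide)).seq ((runS_dup (w := p.one) (l := []) (hE.set rfl _).o1 (by simpa using hLN)
    (by decide) (by decide) (by decide)).seq ((runS_kidsProd (zs := zs) (RV := [])
    (MS := []) (TM := []) (b := p.negOne) (t := p.one)
    ((hE.set rfl _).set rfl _) false hzs hz ?_ ?_ (by simpa using hnL) (by simpa using hLN) ?_
    (by simp)).seq ((runS_drop (w := p.negOne) (l := []) ?_ (by simpa using hLN)).seq
    ((runS_dropVec (n := p.n) (ws := zs) (l := []) ?_ (by omega) hzs
      (fun w hw => by rw [hz w hw]; omega) ?_ (by decide)).seq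
    ((runS_rev (w := resultW p zs) (l := []) ?_ (by omega) (by decide)).seq
    (((runS_output (e := p.n + 1) (cs := cs) (X := []) ?_ hN (by omega) ?_ hc hcl).of_eq
      (s'' := p.base.set .out (cs.map stripW).reverse) (St.ext_get fun j => ?_)).seq
    (runS_cleanUp hN)))))))
  · simp [St.get_set]
  · simp [Par.base, St.get_set]
  · simp [Par.base, St.get_set]
  · simp [Par.base, St.get_set]
  · simp [Par.base, St.get_set]
  · simp [St.get_set]
  · simp [St.get_set, resultW]
  · simp [Par.base, St.get_set]
  · simp [Par.base, St.get_set, hcs]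
  · cases j <;> simp [Par.base, St.get_set]

end

lemma conf_conf (s : St) (B T F acc rv B' T' F' acc' rv' : List (List Bool))
    (D M D' M' : List Bool) :
    conf (conf s B T F acc rv D M) B' T' F' acc' rv' D' M' = conf s B' T' F' acc' rv' D' M' := by
  refine St.ext_get fun j => ?_
  cases j <;> simp [conf, St.get_set]

/-- The polynomial of the running time. -/
noncomputable def timePoly : Polynomial ℕ :=
  (prepare.cost + finalize.cost + 3 * (mainBody false).cost + 3 * (mainBody true).cost + 8).comp
    ((Polynomial.X + 1) ^ 2)

/-- The polynomial of the space. -/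
noncomputable def spacePoly : Polynomial ℕ :=
  (prepare.cost + finalize.cost + (mainBody false).cost + (mainBody true).cost).comp
    ((Polynomial.X + 1) ^ 2) + (2 * (Polynomial.X * (Polynomial.X + 1)) +
    (Polynomial.X + 2) * (3 * (Polynomial.X + 1) +
      2 * (Polynomial.X * ((Polynomial.X + 1) ^ 2 + 1)) + 10) + 10)

/-- Preparation and final phase run once, within polynomial time and hence polynomial space; the
main loop gets its two separate bounds from `iter_solve` and `Iter.run`. The blocks `cs` have the
most significant digit first and the highest coefficient first. -/
theorem run_countProg (p : Par) (hn : 0 < p.n) (hL : p.L = (p.n + 1) * (p.n + 1))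
    (hN : p.N = (p.n + 1) ^ 2) (hcx : p.cx = doubleW (p.n + 1) p.one) {j : ℕ} (hjn : j ≤ p.n)
    (hj : meetW ((fun b => kidsW true b p.P)^[j] p.roots)
      ((fun b => kidsW true b p.P)^[j] p.roots) = false) {cs : List (List Bool)}
    (hcs : (resultW p (solveW p j p.roots (List.replicate p.n false)
      (List.replicate p.n false))).reverse = cs.flatten)
    (hc : ∀ c ∈ cs, c.length = p.n + 1) (hcl : cs.length = p.n + 1) :
    ∃ t, t + 1 ≤ 3 ^ j * timePoly.eval p.n ∧ Run (spacePoly.eval p.n) countProg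
      (Store.single .inp (p.A ++ p.P)) (Store.single .out (cs.map stripW).reverse) t ∧
        (Store.single Reg.out (cs.map stripW).reverse).size ≤ spacePoly.eval p.n := by
  have hnL : p.n ≤ p.L := by rw [hL]; nlinarith
  have hN1 : p.n + 1 ≤ p.N := by rw [hN]; nlinarith
  have hroots : p.roots.length = p.n := by simp [Par.roots, kidsW, p.length_P]
  obtain ⟨r, A', hA⟩ : ∃ r A', p.A = r :: A' := by
    have := p.length_A
    cases hA : p.A with
    | nil => simp [hA] at this; omega
    | cons r A' => exact ⟨r, A', rfl⟩
  obtain ⟨b, r, rfl⟩ : ∃ b r', r = b :: r' := by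
    have : r.length = p.n := p.length_of_mem_A r (by simp [hA])
    cases r with
    | nil => simp at this; omega
    | cons b r' => exact ⟨b, r', rfl⟩
  set zs := solveW p j p.roots (List.replicate p.n false) (List.replicate p.n false) with hzs
  obtain ⟨t1, ht1, r1⟩ := runS_prepare hn hL hcx
  obtain ⟨t3, ht3, r3⟩ := runS_finalize (p := p) hnL (length_solveW p j _ _ _)
    (length_of_mem_solveW p j _ _ _) hcs hc hcl hN1
  have hsz0 : (St.empty.set .inp (p.A ++ p.P)).get.size = 2 * (p.n * (p.n + 1)) := by
    have h1 : ∀ w ∈ p.A ++ p.P, w.length = p.n := by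
      intro w hw
      rcases List.mem_append.1 hw with h | h
      exacts [p.length_of_mem_A w h, p.length_of_mem_P w h]
    unfold Store.size
    rw [Finset.sum_eq_single Reg.inp]
    · rw [St.get_set_self, length_encodeWords h1, List.length_append, p.length_A, p.length_P]
      ring
    · intro k _ hk
      rw [St.get_set_ne _ _ hk]
      rfl
    · simp
  have hsz1 := r1.size_le
  have hEs : Env p p.start := p.env_base.conf _ _ _ _ _ _ _
  set m := spacePoly.eval p.n with hm
  have hm' : m = prepare.cost.eval p.N + finalize.cost.eval p.N + mainCost p.N +
      (2 * (p.n * (p.n + 1)) + (p.n + 2) * levelSize p + 10) := by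
    have : p.L = (p.n + 1) ^ 2 := by rw [hL, sq]
    rw [hm, spacePoly, mainCost, levelSize, hN, this]
    simp [Polynomial.eval_comp]
    ring
  -- As `j ≤ n`, a summand of `n + 2` frames in the space polynomial suffices, with at least one to
  -- spare.
  have hle : (j + 1) * levelSize p + levelSize p ≤ (p.n + 2) * levelSize p := by
    have : (j + 1 + 1) * levelSize p ≤ (p.n + 2) * levelSize p :=
      Nat.mul_le_mul_right _ (by omega)
    calc _ = (j + 1 + 1) * levelSize p := by ring
      _ ≤ _ := this
  obtain ⟨i, hi, it⟩ := iter_solve (p := p) (s := p.start) hEs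
    (m := p.start.get.size + (j + 1) * levelSize p) j (b := p.roots)
    (T := List.replicate p.n false) (F := List.replicate p.n false) (D := []) (B := []) (Ts := [])
    (Fs := []) (ACC := []) hroots (by simp) (by simp) hj (by simp)
  have hstart : conf p.start [p.roots] [List.replicate p.n false] [List.replicate p.n false] [] []
      [] [true] = p.start := conf_conf _ _ _ _ _ _ _ _ _ _ _ _ _ _ _
  rw [hstart, ← hzs] at it
  have hszend : (conf p.start [] [] [] [] zs [] [false]).get.size ≤
      p.start.get.size + levelSize p := by
    have := size_conf_le p.start [] [] [] [] zs [] [false]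
    rw [length_encodeWords (length_of_mem_solveW p j _ _ _), length_solveW] at this
    simp only [encodeWords_nil, List.length_nil, List.length_cons, levelSize] at this ⊢
    omega
  -- After the return from the roots, `D` holds only an empty word. The four steps read the mode,
  -- remove that word, skip, and remove the empty word of `M`, which ends the loop.
  have hend : Run m (.loop .M mainBody) (conf p.start [] [] [] [] zs [] [false]).get
      (p.base.set .rv zs).get 4 := by
    have hlast : ((conf p.start [] [] [] [] zs [] []).set .D []).set .M [] = p.base.set .rv zs := by
      refine St.ext_get fun k => ?_
      cases k <;> simp [Par.start, Par.base, conf, St.get_set]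
    have hsD : ((conf p.start [] [] [] [] zs [] []).set .D []).get.size ≤
        (conf p.start [] [] [] [] zs [] []).get.size :=
      size_update_end get_conf_D
    have hsM : (conf p.start [] [] [] [] zs [] []).get.size ≤
        (conf p.start [] [] [] [] zs [] [false]).get.size := by
      have := size_update_word (s := (conf p.start [] [] [] [] zs [] [false]).get) (k := .M)
        (b := false) (w := []) (l := []) (St.get_set_self _ _ _)
      rwa [St.update_get, conf_set_M] at this
    refine Run.loop_bit (t := 2) (t' := 1) false [] [] (St.get_set_self _ _ _) (by omega) ?_
      (s' := ((conf p.start [] [] [] [] zs [] []).set .D []).get) ?_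
    · rw [St.update_get, conf_set_M]
      exact Run.pop_end (t := 1) [] get_conf_D (by omega) (Run.skip _ (by
        rw [St.update_get]; omega))
    · rw [← hlast]
      refine Run.loop_end [] ?_ (by omega)
      simp [conf, St.get_set]
  rw [← hzs] at r3
  obtain ⟨t2, ht2, r2⟩ := it.run (m' := m) (by omega) hend
  have hsz3 : (p.base.set .rv zs).get.size ≤ p.start.get.size + levelSize p + 4 := by
    have := hend.size_le
    omega
  have hsz4 := r3.size_le
  refine ⟨1 + (t1 + (t2 + t3)) + 1, ?_, ?_, ?_⟩
  · have h1 : timePoly.eval p.n = prepare.cost.eval p.N + finalize.cost.eval p.N +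
        3 * mainCost p.N + 8 := by
      rw [timePoly, mainCost, hN]
      simp [Polynomial.eval_comp]
      ring
    have h3 : 1 ≤ 3 ^ j := Nat.one_le_pow _ _ (by norm_num)
    -- This is where the factor `3 ^ j` in the time comes from; the surplus factor 3 is the
    -- coefficient of `mainBody` in `timePoly`.
    have h4 : (i + 2) * (1 + mainCost p.N) ≤ 3 ^ (j + 1) * (1 + mainCost p.N) :=
      Nat.mul_le_mul_right _ hi
    have h5 : 3 ^ j * (prepare.cost.eval p.N + finalize.cost.eval p.N + 3 * mainCost p.N + 8) =
        3 ^ j * (prepare.cost.eval p.N + finalize.cost.eval p.N + 5) +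
          3 ^ (j + 1) * (1 + mainCost p.N) := by
      rw [pow_succ]; ring
    have h6 : prepare.cost.eval p.N + finalize.cost.eval p.N + 5 ≤
        3 ^ j * (prepare.cost.eval p.N + finalize.cost.eval p.N + 5) :=
      Nat.le_mul_of_pos_left _ (by omega)
    rw [h1, h5]
    rw [add_mul i 2] at h4
    omega
  · have hinp : (Store.single Reg.inp (p.A ++ p.P)) Reg.inp = (b :: r) :: (A' ++ p.P) := by
      simp [Store.single, hA]
    have hs0 : (Store.single Reg.inp (p.A ++ p.P)).size = 2 * (p.n * (p.n + 1)) := hsz0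
    have hsw := size_update_word hinp
    refine Run.pop_bit b r (A' ++ p.P) hinp (by omega) ?_
    rw [if_neg (by simp)]
    refine Run.seq (s' := (St.empty.set .inp (p.A ++ p.P)).get) ?_
      (Run.seq (r1.of_size_add_le (by omega)) (Run.seq r2 (r3.of_size_add_le (by omega))))
    have := Run.push (m := m) (Function.update (Store.single Reg.inp (p.A ++ p.P)) Reg.inp
      (r :: (A' ++ p.P))) .inp b r (A' ++ p.P) (by simp) (by omega)
    rw [Function.update_idem] at this
    have h2 : Function.update (Store.single Reg.inp (p.A ++ p.P)) Reg.inp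
        ((b :: r) :: (A' ++ p.P)) = (St.empty.set .inp (p.A ++ p.P)).get := by
      rw [← hinp, Function.update_eq_self]
      rfl
    rw [h2] at this
    exact this
  · have : (Store.single Reg.out (cs.map stripW).reverse).size ≤
        (p.base.set .rv zs).get.size + t3 := hsz4
    omega

/-- Without vertices the input word is empty, which the first `pop` notices; the empty set is the
only dominating set, and the output is the single number 1. -/
theorem run_countProg_zero : Run 10 countProg (Store.single .inp [])
    (Store.single .out [[true]]) 3 := by
  have h0 : (Store.single Reg.inp []) = fun _ => ([] : List (List Bool)) := by
    funext k
    simp [Store.single]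
  have hs0 : Store.size (fun _ : Reg => ([] : List (List Bool))) = 0 := by simp [Store.size]
  have hs1 : Store.size (Store.single Reg.out [[]]) ≤ 0 + 1 := by
    rw [← hs0]
    exact Store.size_update_le (by simp)
  rw [h0]
  refine Run.pop_nil rfl (by omega) ?_
  rw [if_pos rfl]
  have := Run.push (m := 10) (Store.single Reg.out [[]]) .out true [] [] (by simp [Store.single])
    (by omega)
  rw [Store.single, Function.update_idem] at this
  exact Run.seq (Run.new _ _ (by omega)) this

end DomSetTreeDepth
namespace DomSetTreeDepth

/-! ### Words as residues modulo 2^L -/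

section values

/-- The number with the given binary digits, least significant digit first. -/
def val : List Bool → ℕ
  | [] => 0
  | b :: w => b.toNat + 2 * val w

/-- The witness `d` is the carry that `addc` drops; modulo 2 to the word length the addition is
exact. -/
lemma exists_val_addc : ∀ (c : Bool) (x y : List Bool), x.length = y.length →
    ∃ d, val (addc c x y) + 2 ^ x.length * d = val x + val y + c.toNat
  | c, [], [], _ => ⟨c.toNat, by simp [addc, val]⟩
  | c, a :: x, b :: y, h => by
    obtain ⟨d, hd⟩ := exists_val_addc (maj a b c) x y (Nat.succ.inj h)
    refine ⟨d, ?_⟩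
    have : (a ^^ (b ^^ c)).toNat + 2 * (maj a b c).toNat = a.toNat + b.toNat + c.toNat := by
      cases a <;> cases b <;> cases c <;> rfl
    simp only [addc, val, List.length_cons, pow_succ]
    linarith

lemma val_lt : ∀ w : List Bool, val w < 2 ^ w.length
  | [] => by simp [val]
  | b :: w => by
    have := val_lt w
    have := Bool.toNat_le b
    simp only [val, List.length_cons, pow_succ]
    omega

lemma val_append : ∀ v w : List Bool, val (v ++ w) = val v + 2 ^ v.length * val w
  | [], w => by simp [val]
  | b :: v, w => by
    simp only [List.cons_append, val, val_append v w, List.length_cons, pow_succ]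
    ring

lemma eq_of_val_eq : ∀ {v w : List Bool}, v.length = w.length → val v = val w → v = w
  | [], [], _, _ => rfl
  | a :: v, b :: w, h, h' => by
    simp only [val] at h'
    have hab : a = b := by
      cases a <;> cases b <;> simp at h' ⊢ <;> omega
    subst hab
    rw [eq_of_val_eq (Nat.succ.inj h) (by omega)]

lemma val_replicate_false (l : ℕ) : val (List.replicate l false) = 0 := by
  induction l with
  | zero => rfl
  | succ l ih => simp [List.replicate_succ, val, ih]

lemma val_replicate_true (l : ℕ) : val (List.replicate l true) + 1 = 2 ^ l := by
  induction l with
  | zero => rfl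
  | succ l ih =>
    rw [List.replicate_succ, val, pow_succ, ← ih]
    simp
    ring

variable {L : ℕ}

/-- The number with the given binary digits modulo `2 ^ L`. -/
def valZ (L : ℕ) (w : List Bool) : ZMod (2 ^ L) := (val w : ZMod (2 ^ L))

lemma two_pow_eq_zero : (2 : ZMod (2 ^ L)) ^ L = 0 := by
  have := ZMod.natCast_self (2 ^ L)
  rwa [Nat.cast_pow, Nat.cast_ofNat] at this

lemma valZ_addW {x y : List Bool} (hx : x.length = L) (hy : y.length = L) :
    valZ L (addW x y) = valZ L x + valZ L y := by
  obtain ⟨d, hd⟩ := exists_val_addc false x y (hx.trans hy.symm)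
  have := congrArg (Nat.cast : ℕ → ZMod (2 ^ L)) hd
  rw [hx] at this
  push_cast at this
  rw [two_pow_eq_zero] at this
  simpa [valZ, addW] using this

lemma valZ_mulAux : ∀ (t : List Bool) {r z : List Bool}, r.length = L → z.length = L →
    valZ L (mulAux t r z) = valZ L r + valZ L t * valZ L z
  | [], r, z, _, _ => by simp [mulAux, valZ, val]
  | b :: t, r, z, hr, hz => by
    have hzz : (addW z z).length = L := (length_addW rfl).trans hz
    have hrz : (addW r z).length = L := (length_addW (hr.trans hz.symm)).trans hr
    have hv : valZ L (b :: t) = (b.toNat : ZMod (2 ^ L)) + 2 * valZ L t := by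
      simp [valZ, val]
    cases b
    · rw [mulAux, if_neg (by simp), valZ_mulAux t hr hzz, valZ_addW hz hz, hv]
      simp
      ring
    · rw [mulAux, if_pos rfl, valZ_mulAux t hrz hzz, valZ_addW hz hz, valZ_addW hr hz, hv]
      simp
      ring

lemma valZ_mulW {t z : List Bool} (ht : t.length = L) (hz : z.length = L) :
    valZ L (mulW t z) = valZ L t * valZ L z := by
  rw [mulW, valZ_mulAux t (by simpa using ht) hz, valZ, val_replicate_false]
  simp

lemma valZ_doubleW {w : List Bool} (hw : w.length = L) (i : ℕ) :
    valZ L (doubleW i w) = 2 ^ i * valZ L w := by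
  induction i with
  | zero => simp [doubleW]
  | succ i ih =>
    have hd := (length_doubleW i w).trans hw
    have : doubleW (i + 1) w = addW (doubleW i w) (doubleW i w) :=
      Function.iterate_succ_apply' _ _ _
    rw [this, valZ_addW hd hd, ih]
    ring

@[simp] lemma Par.valZ_zero (p : Par) : valZ p.L p.zero = 0 := by
  simp [Par.zero, valZ, val_replicate_false]

@[simp] lemma Par.valZ_one (p : Par) : valZ p.L p.one = 1 := by
  simp [Par.one, valZ, val, val_replicate_false]

-- Two's complement: adding 1 to the all-ones word gives 2^L, which vanishes.
@[simp] lemma Par.valZ_negOne (p : Par) : valZ p.L p.negOne = -1 := by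
  have := congrArg (Nat.cast : ℕ → ZMod (2 ^ p.L)) (val_replicate_true p.L)
  push_cast at this
  rw [two_pow_eq_zero] at this
  exact eq_neg_of_add_eq_zero_left this

lemma valZ_prodW (pol : Bool) (b : List Bool) (l : List (List Bool × List Bool)) {t : List Bool}
    (ht : t.length = L) (hl : ∀ rz ∈ l, rz.2.length = L) :
    valZ L (prodW pol b l t) =
      valZ L t * (l.map fun rz => if meetW rz.1 b = pol then valZ L rz.2 else 1).prod := by
  induction l generalizing t with
  | nil => simp [prodW]
  | cons a l ih =>
    have ha := hl a List.mem_cons_self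
    have hl' : ∀ rz ∈ l, rz.2.length = L := fun rz h => hl rz (List.mem_cons_of_mem _ h)
    rw [List.map_cons, List.prod_cons, ← mul_assoc]
    by_cases h : meetW a.1 b = pol
    · have : prodW pol b (a :: l) t = prodW pol b l (mulW t a.2) := by simp [prodW, h]
      rw [this, ih ((length_mulW (ht.trans ha.symm)).trans ht) hl', valZ_mulW ht ha, if_pos h]
    · have : prodW pol b (a :: l) t = prodW pol b l t := by simp [prodW, h]
      rw [this, ih ht hl', if_neg h, mul_one]

end values

/-! ### Words as sets of vertices -/

section sets

lemma meetW_eq_true_iff : ∀ {x y : List Bool},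
    meetW x y = true ↔ ∃ i : ℕ, x[i]? = some true ∧ y[i]? = some true
  | [], _ => by simp [meetW]
  | _ :: _, [] => by simp [meetW]
  | a :: x, b :: y => by
    rw [meetW, Bool.or_eq_true, meetW_eq_true_iff, Bool.and_eq_true]
    constructor
    · rintro (⟨rfl, rfl⟩ | ⟨i, h⟩)
      · exact ⟨0, rfl, rfl⟩
      · exact ⟨i + 1, h⟩
    · rintro ⟨i | i, h⟩
      · exact .inl (by simpa using h)
      · exact .inr ⟨i, by simpa using h⟩

variable {n : ℕ}

open Classical in
/-- A set of vertices as a word. -/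
noncomputable def rowW (s : Set (Fin n)) : List Bool :=
  (List.finRange n).map fun v => decide (v ∈ s)

@[simp] lemma length_rowW (s : Set (Fin n)) : (rowW s).length = n := by simp [rowW]

lemma getElem?_rowW {s : Set (Fin n)} {i : ℕ} :
    (rowW s)[i]? = some true ↔ ∃ h : i < n, (⟨i, h⟩ : Fin n) ∈ s := by
  by_cases h : i < n <;> simp [rowW, h]

lemma rowW_empty : rowW (∅ : Set (Fin n)) = List.replicate n false := by
  simp [rowW, List.map_const']

lemma meetW_rowW_iff {s t : Set (Fin n)} : meetW (rowW s) (rowW t) = true ↔ (s ∩ t).Nonempty := by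
  rw [meetW_eq_true_iff]
  simp only [getElem?_rowW]
  exact ⟨fun ⟨i, ⟨h, h1⟩, _, h2⟩ => ⟨⟨i, h⟩, h1, h2⟩, fun ⟨i, h1, h2⟩ => ⟨i, ⟨i.2, h1⟩, i.2, h2⟩⟩

lemma meetW_maskW_iff {s : Set (Fin n)} {v : Fin n} :
    meetW (rowW s) (maskW n v) = true ↔ v ∈ s := by
  rw [meetW_eq_true_iff]
  simp only [getElem?_rowW]
  have hm : ∀ i : ℕ, (maskW n v)[i]? = some true ↔ i = v := by
    intro i
    rw [maskW, List.getElem?_append]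
    split_ifs with h
    · have : i < v := by simpa using h
      simp [this]
      omega
    · obtain ⟨j, rfl⟩ : ∃ j, i = v + j := ⟨i - v, by simp at h; omega⟩
      cases j <;> simp [List.getElem?_replicate]
  simp only [hm]
  exact ⟨fun ⟨i, ⟨h, h1⟩, h2⟩ => by subst h2; exact h1, fun h => ⟨v, ⟨v.2, h⟩, rfl⟩⟩

lemma meetW_replicate_iff {s : Set (Fin n)} {l : ℕ} (h : n ≤ l) :
    meetW (rowW s) (List.replicate l true) = true ↔ s.Nonempty := by
  rw [meetW_eq_true_iff]
  simp only [getElem?_rowW]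
  exact ⟨fun ⟨i, ⟨h, h1⟩, _⟩ => ⟨_, h1⟩, fun ⟨v, hv⟩ => ⟨v, ⟨v.2, hv⟩, by
    rw [List.getElem?_replicate, if_pos (by omega)]⟩⟩

lemma orW_rowW (s t : Set (Fin n)) : orW (rowW s) (rowW t) = rowW (s ∪ t) := by
  refine List.ext_getElem (by simp [orW]) fun i h1 h2 => ?_
  simp only [orW, rowW, List.getElem_zipWith, List.getElem_map]
  rw [Bool.eq_iff_iff]
  simp

lemma kidsW_rowW {pol : Bool} {b : List Bool} {P : Fin n → Set (Fin n)} :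
    kidsW pol b ((List.finRange n).map fun v => rowW (P v)) =
      rowW {v | meetW (rowW (P v)) b = pol} := by
  rw [kidsW, List.map_map, rowW]
  refine List.map_congr_left fun v _ => ?_
  rw [Bool.eq_iff_iff, Function.comp_apply, beq_iff_eq]
  exact (@decide_eq_true_iff _ (Classical.propDecidable _)).symm

end sets

/-! ### The recursion over a commutative ring -/

section recursion

variable {n : ℕ} {R : Type*} [CommRing R]

open Classical in
/-- The weight of the vertex `v` with color `c`, where `T` and `F` contain the taken and the banned
vertices above `v`, and taken vertices have weight `x`. -/
noncomputable def term (G : SimpleGraph (Fin n)) (x : R) (T F : Set (Fin n)) (v : Fin n) :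
    Color → R
  | .taken => if ∃ u ∈ F, G.Adj v u then 0 else x
  | .free => 1
  | .banned => if ∃ u ∈ T, G.Adj v u then 0 else -1

/-- The taken vertices above the next level, if the vertices of `B` have the color `c`. -/
def takenAbove (B T : Set (Fin n)) (c : Color) : Set (Fin n) := if c = .taken then T ∪ B else T

/-- The banned vertices above the next level, if the vertices of `B` have the color `c`. -/
def bannedAbove (B F : Set (Fin n)) (c : Color) : Set (Fin n) := if c = .banned then F ∪ B else F

/-- The vertices whose parents are in `B`. -/
def kids (par : Fin n → Option (Fin n)) (B : Set (Fin n)) : Set (Fin n) :=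
  {v | ∃ u ∈ B, par v = some u}

/-- The sum over all colors that the recursion computes for `v`. -/
noncomputable def colorSum (G : SimpleGraph (Fin n)) (par : Fin n → Option (Fin n)) (x : R)
    (T F : Set (Fin n)) (Z : Color → Fin n → R) (v : Fin n) : R :=
  ∑ c ∈ {Color.taken, Color.free, Color.banned},
    term G x T F v c * ∏ u, if par u = some v then Z c u else 1

open Classical in
/-- The recursion on the levels of the forest. -/
noncomputable def solve (G : SimpleGraph (Fin n)) (par : Fin n → Option (Fin n)) (x : R) :
    ℕ → Set (Fin n) → Set (Fin n) → Set (Fin n) → Fin n → R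
  | 0, _, _, _, _ => 0
  | j + 1, B, T, F, v =>
    if B.Nonempty then colorSum G par x T F
      (fun c => solve G par x j (kids par B) (takenAbove B T c) (bannedAbove B F c)) v
    else 0

end recursion

/-! ### The program on words computes the recursion -/

section interpretation

variable {n : ℕ} {G : SimpleGraph (Fin n)} {par : Fin n → Option (Fin n)} {p : Par}

/-- The instance that belongs to a graph and a forest. -/
structure Represents (p : Par) {n : ℕ} (G : SimpleGraph (Fin n)) (par : Fin n → Option (Fin n)) :
    Prop where
  n_eq : p.n = n
  A_eq : p.A = (List.finRange n).map fun v => rowW {w | G.Adj v w}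
  P_eq : p.P = (List.finRange n).map fun v => rowW {w | par v = some w}

lemma nextT_rowW (c : Color) (B T : Set (Fin n)) :
    nextT c (rowW B) (rowW T) = rowW (takenAbove B T c) := by
  cases c <;> simp [nextT, takenAbove, orW_rowW]

lemma nextF_rowW (c : Color) (B F : Set (Fin n)) :
    nextF c (rowW B) (rowW F) = rowW (bannedAbove B F c) := by
  cases c <;> simp [nextF, bannedAbove, orW_rowW]

lemma Represents.kidsW (h : Represents p G par) (B : Set (Fin n)) :
    kidsW true (rowW B) p.P = rowW (kids par B) := by
  rw [h.P_eq, kidsW_rowW]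
  congr 1
  ext v
  simp only [Set.mem_ofPred_eq, meetW_rowW_iff, kids]
  exact ⟨fun ⟨u, h1, h2⟩ => ⟨u, h2, h1⟩, fun ⟨u, h1, h2⟩ => ⟨u, h2, h1⟩⟩

lemma Represents.roots (h : Represents p G par) (hL : p.n ≤ p.L) :
    p.roots = rowW {v | par v = none} := by
  rw [Par.roots, h.P_eq, kidsW_rowW]
  congr 1
  ext v
  rw [Set.mem_ofPred_eq, ← Bool.not_eq_true, Par.negOne, meetW_replicate_iff (h.n_eq ▸ hL),
    Set.mem_ofPred_eq, Option.eq_none_iff_forall_ne_some]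
  exact ⟨fun h u hu => h ⟨u, hu⟩, fun h ⟨u, hu⟩ => h u hu⟩

lemma valZ_termW (T F : Set (Fin n)) (v : Fin n) (c : Color) :
    valZ p.L (termW p (rowW T) (rowW F) (rowW {w | G.Adj v w}) c) =
      term G (valZ p.L p.cx) T F v c := by
  have h : ∀ S : Set (Fin n), ({w | G.Adj v w} ∩ S).Nonempty ↔ ∃ u ∈ S, G.Adj v u := fun S =>
    ⟨fun ⟨u, h1, h2⟩ => ⟨u, h2, h1⟩, fun ⟨u, h1, h2⟩ => ⟨u, h2, h1⟩⟩
  cases c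
  · by_cases hF : ∃ u ∈ F, G.Adj v u
    · rw [termW, term, if_pos hF, if_pos (meetW_rowW_iff.2 ((h F).2 hF)), Par.valZ_zero]
    · rw [termW, term, if_neg hF, if_neg (by rwa [meetW_rowW_iff, h])]
  · rw [termW, term, Par.valZ_one]
  · by_cases hT : ∃ u ∈ T, G.Adj v u
    · rw [termW, term, if_pos hT, if_pos (meetW_rowW_iff.2 ((h T).2 hT)), Par.valZ_zero]
    · rw [termW, term, if_neg hT, if_neg (by rwa [meetW_rowW_iff, h]), Par.valZ_negOne]

lemma valZ_prodW_rowW (pol : Bool) (b : List Bool) {P : Fin n → Set (Fin n)} {L : ℕ}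
    {zs : List (List Bool)} (hz : ∀ w ∈ zs, w.length = L) {Z : Fin n → ZMod (2 ^ L)}
    (hZ : zs.map (valZ L) = (List.finRange n).map Z) {t : List Bool} (ht : t.length = L) :
    valZ L (prodW pol b (((List.finRange n).map fun v => rowW (P v)).zip zs) t) =
      valZ L t * ∏ u, if meetW (rowW (P u)) b = pol then Z u else 1 := by
  rw [valZ_prodW pol b _ ht fun rz h => hz _ (List.of_mem_zip (a := rz.1) (b := rz.2) h).2,
    Fin.prod_univ_def]
  congr 2
  have : ∀ l : List (List Bool × List Bool),
      (l.map fun rz => if meetW rz.1 b = pol then valZ L rz.2 else 1) =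
        (l.map (Prod.map id (valZ L))).map fun rz => if meetW rz.1 b = pol then rz.2 else 1 := by
    intro l; simp
  rw [this, ← List.zip_map, hZ, List.map_id, List.zip_map', List.map_map]
  rfl

/-- Compared entry by entry: for the vertex `i` the mask `maskW p.n i` selects the rows of the
children of `i`, so `prodW` multiplies the weight of `i` by their numbers. -/
lemma Represents.combineW (h : Represents p G par) (c : Color) (T F : Set (Fin n))
    {zs acc : List (List Bool)} (hz : ∀ w ∈ zs, w.length = p.L)
    {Z a : Fin n → ZMod (2 ^ p.L)} (hZ : zs.map (valZ p.L) = (List.finRange n).map Z)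
    (hac : ∀ w ∈ acc, w.length = p.L) (ha : acc.map (valZ p.L) = (List.finRange n).map a) :
    (combineW p c (rowW T) (rowW F) zs acc).map (valZ p.L) = (List.finRange n).map fun v =>
      a v + term G (valZ p.L p.cx) T F v c * ∏ u, if par u = some v then Z u else 1 := by
  have hzl : zs.length = n := by simpa using congrArg List.length hZ
  have hal : acc.length = n := by simpa using congrArg List.length ha
  refine List.ext_getElem ?_ fun i h1 h2 => ?_
  · rw [List.length_map, length_combineW (hal.trans h.n_eq.symm), h.n_eq]
    simp
  · have hi : i < n := by simpa using h2
    have hai : valZ p.L acc[i] = a ⟨i, hi⟩ := by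
      have := congrArg (fun l => l[i]?) ha
      simpa [hi, hal] using this
    have hr : ∀ h' : i < p.A.length, p.A[i] = rowW {w | G.Adj ⟨i, hi⟩ w} := by
      simp [h.A_eq]
    have hv : ∀ r : List Bool, valZ p.L (prodW true (maskW p.n i) (p.P.zip zs)
        (termW p (rowW T) (rowW F) r c)) = valZ p.L (termW p (rowW T) (rowW F) r c) *
          ∏ u, if par u = some ⟨i, hi⟩ then Z u else 1 := by
      intro r
      rw [h.P_eq, valZ_prodW_rowW true _ hz hZ (length_termW _ _ _ _ _)]
      simp only [h.n_eq, meetW_maskW_iff (v := (⟨i, hi⟩ : Fin n)), Set.mem_ofPred_eq]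
    simp only [DomSetTreeDepth.combineW, List.getElem_map, List.getElem_mapIdx, List.getElem_zip,
      List.getElem_finRange, Fin.cast_mk]
    rw [valZ_addW (hac _ (List.getElem_mem _)), hai, hv, hr, valZ_termW]
    exact length_prodW _ (length_termW _ _ _ _ _) fun rz h =>
        hz _ (List.of_mem_zip (a := rz.1) (b := rz.2) h).2

/-- The three nested uses of `combineW`, starting from zeros, add up the three summands of
`colorSum`. -/
lemma Represents.solveW (h : Represents p G par) : ∀ (j : ℕ) (B T F : Set (Fin n)),
    (solveW p j (rowW B) (rowW T) (rowW F)).map (valZ p.L) =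
      (List.finRange n).map (solve G par (valZ p.L p.cx) j B T F)
  | 0, B, T, F => by
    simp [DomSetTreeDepth.solveW, solve, h.n_eq, List.map_const']
  | j + 1, B, T, F => by
    rw [DomSetTreeDepth.solveW]
    simp only [nextT_rowW, nextF_rowW, h.kidsW]
    have h0 : (List.replicate p.n p.zero).map (valZ p.L) =
        (List.finRange n).map fun _ => (0 : ZMod (2 ^ p.L)) := by
      simp [h.n_eq, List.map_const']
    have h0' : ∀ w ∈ List.replicate p.n p.zero, w.length = p.L := fun w hw => by
      rw [List.eq_of_mem_replicate hw, Par.length_zero]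
    by_cases hB : B.Nonempty
    · rw [if_pos (by rw [meetW_rowW_iff]; simpa using hB)]
      have hl := fun (B T F : Set (Fin n)) => length_of_mem_solveW p j (rowW B) (rowW T) (rowW F)
      have c1 := h.combineW .taken T F (hl _ _ _) (h.solveW j (kids par B) (takenAbove B T .taken)
        (bannedAbove B F .taken)) h0' h0
      have l1 := length_of_mem_combineW (p := p) (c := .taken) (T := rowW T) (F := rowW F)
        (hl (kids par B) (takenAbove B T .taken) (bannedAbove B F .taken)) h0'
      have c2 := h.combineW .free T F (hl _ _ _) (h.solveW j (kids par B) (takenAbove B T .free)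
        (bannedAbove B F .free)) l1 c1
      have l2 := length_of_mem_combineW (p := p) (c := .free) (T := rowW T) (F := rowW F)
        (hl (kids par B) (takenAbove B T .free) (bannedAbove B F .free)) l1
      rw [h.combineW .banned T F (hl _ _ _) (h.solveW j _ _ _) l2 c2]
      refine List.map_congr_left fun v _ => ?_
      rw [solve, if_pos hB, colorSum, Finset.sum_insert (by decide), Finset.sum_insert (by decide),
        Finset.sum_singleton]
      ring
    · rw [if_neg (by rw [meetW_rowW_iff]; simpa using hB), h0]
      refine List.map_congr_left fun v _ => ?_
      rw [solve, if_neg hB]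

lemma Represents.valZ_resultW (h : Represents p G par) (hL : p.n ≤ p.L) (j : ℕ) :
    valZ p.L (resultW p (DomSetTreeDepth.solveW p j p.roots (List.replicate p.n false)
      (List.replicate p.n false))) = ∏ u, if par u = none then
        solve G par (valZ p.L p.cx) j {v | par v = none} ∅ ∅ u else 1 := by
  have hr : List.replicate p.n false = rowW (∅ : Set (Fin n)) := by rw [rowW_empty, h.n_eq]
  rw [resultW, h.P_eq, valZ_prodW_rowW false _ (length_of_mem_solveW p j _ _ _) (Z := solve G par
    (valZ p.L p.cx) j {v | par v = none} ∅ ∅) (by rw [h.roots hL, hr]; exact h.solveW j _ _ _)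
    p.length_one, Par.valZ_one, one_mul]
  refine Finset.prod_congr rfl fun u _ => if_congr ?_ rfl rfl
  rw [← Bool.not_eq_true, Par.negOne, meetW_replicate_iff (h.n_eq ▸ hL),
    Option.eq_none_iff_forall_ne_some]
  exact ⟨fun h u hu => h ⟨u, hu⟩, fun h ⟨u, hu⟩ => h u hu⟩

end interpretation

end DomSetTreeDepth
namespace DomSetTreeDepth

/-! ### The recursion counts dominating sets -/

instance : Fintype Color := ⟨{.taken, .free, .banned}, fun c => by cases c <;> decide⟩

section forest

variable {n : ℕ} {G : SimpleGraph (Fin n)} {par : Fin n → Option (Fin n)} {lev : Fin n → ℕ}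
  {R : Type*} [CommRing R] {x : R}

/-- `a` is a proper ancestor of `v`. -/
def Above (par : Fin n → Option (Fin n)) (a v : Fin n) : Prop :=
  Relation.TransGen (fun a b => par b = some a) a v

/-- The function `par` describes a rooted forest in which adjacent vertices are comparable, and
`lev` is the number of the vertices above a vertex, the vertex included. -/
structure IsLevel (G : SimpleGraph (Fin n)) (par : Fin n → Option (Fin n)) (lev : Fin n → ℕ) :
    Prop where
  root : ∀ v, par v = none → lev v = 1
  child : ∀ u v, par u = some v → lev u = lev v + 1
  comparable : ∀ u v, G.Adj u v → Above par u v ∨ Above par v u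

lemma Above.eq_or_above {a u v : Fin n} (h : Above par a u) (hv : par u = some v) :
    a = v ∨ Above par a v := by
  cases h with
  | single h => exact .inl (Option.some.inj (h.symm.trans hv))
  | tail h h' =>
    obtain rfl := Option.some.inj (h'.symm.trans hv)
    exact .inr h

namespace IsLevel

lemma lt (h : IsLevel G par lev) {a v : Fin n} (ha : Above par a v) : lev a < lev v := by
  induction ha with
  | single h' => rw [h.child _ _ h']; omega
  | tail _ h' ih => rw [h.child _ _ h']; omega

lemma pos (h : IsLevel G par lev) (v : Fin n) : 1 ≤ lev v := by
  cases hv : par v with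
  | none => rw [h.root v hv]
  | some u => rw [h.child v u hv]; omega

/-- Parents are unique, so the ancestors of `v` form a chain along which `lev` is strictly monotone.
-/
lemma eq_of_above (h : IsLevel G par lev) {a b v : Fin n} (ha : Above par a v) (hb : Above par b v)
    (hab : lev a = lev b) : a = b := by
  induction ha with
  | single h' =>
    rcases hb.eq_or_above h' with rfl | hb
    · rfl
    · exact absurd (h.lt hb) (by omega)
  | tail h1 h' ih =>
    rcases hb.eq_or_above h' with rfl | hb
    · exact absurd (h.lt h1) (by omega)
    · exact ih hb

end IsLevel

/-- The vertices of color `c` above `v`, together with all vertices on their levels. -/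
def upper (par : Fin n → Option (Fin n)) (lev : Fin n → ℕ) (f : Fin n → Color) (c : Color)
    (v : Fin n) : Set (Fin n) :=
  {u | lev u < lev v ∧ ∃ a, Above par a v ∧ lev a = lev u ∧ f a = c}

/-- The factor of the vertex `v` in the contribution of the coloring `f`. -/
noncomputable def factor (G : SimpleGraph (Fin n)) (par : Fin n → Option (Fin n))
    (lev : Fin n → ℕ) (x : R) (f : Fin n → Color) (v : Fin n) : R :=
  term G x (upper par lev f .taken v) (upper par lev f .banned v) v (f v)

namespace IsLevel

/-- This justifies colouring whole levels. A neighbour of `v` on a higher level is comparable with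
`v`, hence an ancestor, hence the only ancestor of `v` on its level; so it is the vertex whose
colour put the level into `upper`. -/
lemma exists_mem_upper (h : IsLevel G par lev) {f : Fin n → Color} {c : Color} {v : Fin n} :
    (∃ u ∈ upper par lev f c v, G.Adj v u) ↔ ∃ u, Above par u v ∧ f u = c ∧ G.Adj v u := by
  constructor
  · rintro ⟨u, ⟨hu, a, ha, hau, rfl⟩, hvu⟩
    rcases h.comparable v u hvu with h' | h'
    · exact absurd (h.lt h') (by omega)
    · obtain rfl := h.eq_of_above ha h' hau
      exact ⟨a, ha, rfl, hvu⟩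
  · rintro ⟨u, hu, rfl, hvu⟩
    exact ⟨u, ⟨h.lt hu, u, hu, rfl, rfl⟩, hvu⟩

/-- The passage from a vertex to its child changes `upper` exactly as `takenAbove` and `bannedAbove`
change the sets in the recursion. -/
lemma upper_child (h : IsLevel G par lev) {f : Fin n → Color} (c : Color) {u v : Fin n}
    (huv : par u = some v) : upper par lev f c u =
      if f v = c then upper par lev f c v ∪ {w | lev w = lev v} else upper par lev f c v := by
  have hl := h.child u v huv
  have key : ∀ w, w ∈ upper par lev f c u ↔
      w ∈ upper par lev f c v ∨ lev w = lev v ∧ f v = c := by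
    intro w
    constructor
    · rintro ⟨hw, a, ha, haw, hc⟩
      rcases ha.eq_or_above huv with rfl | ha
      · exact .inr ⟨haw.symm, hc⟩
      · exact .inl ⟨by rw [← haw]; exact h.lt ha, a, ha, haw, hc⟩
    · rintro (⟨hw, a, ha, haw, hc⟩ | ⟨hw, hc⟩)
      · exact ⟨by omega, a, ha.tail huv, haw, hc⟩
      · exact ⟨by omega, v, .single huv, hw.symm, hc⟩
  ext w
  rw [key]
  split_ifs with hc <;> simp [hc]

lemma upper_congr (h : IsLevel G par lev) {f g : Fin n → Color} (c : Color) {v : Fin n}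
    (hfg : ∀ a, lev a < lev v → f a = g a) : upper par lev f c v = upper par lev g c v := by
  ext u
  refine and_congr_right fun _ => exists_congr fun a => and_congr_right fun ha => ?_
  rw [hfg a (h.lt ha)]

lemma factor_congr (h : IsLevel G par lev) {f g : Fin n → Color} {v : Fin n}
    (hfg : ∀ a, lev a ≤ lev v → f a = g a) :
    factor G par lev x f v = factor G par lev x g v := by
  rw [factor, factor, hfg v le_rfl, h.upper_congr _ fun a ha => hfg a ha.le,
    h.upper_congr _ fun a ha => hfg a ha.le]

lemma kids_eq (h : IsLevel G par lev) {k : ℕ} (hk : 1 ≤ k) :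
    kids par {w | lev w = k} = {w | lev w = k + 1} := by
  ext u
  constructor
  · rintro ⟨v, rfl, huv⟩
    exact h.child u v huv
  · intro hu
    have hu' : lev u = k + 1 := hu
    cases huv : par u with
    | none => rw [h.root u huv] at hu'; omega
    | some v => exact ⟨v, by have := h.child u v huv; rw [Set.mem_ofPred_eq]; omega, huv⟩

/-- Every vertex of level `k + 1` has exactly one parent, and that lies on level `k`; exchanging the
two products leaves one factor for each of them. -/
lemma prod_kids (h : IsLevel G par lev) {k : ℕ} (hk : 1 ≤ k) (S : Fin n → R) :
    ∏ v, (if lev v = k then ∏ u, (if par u = some v then S u else 1) else 1) =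
      ∏ u, if lev u = k + 1 then S u else 1 := by
  have h1 : ∀ v, (if lev v = k then ∏ u, (if par u = some v then S u else 1) else 1) =
      ∏ u, if lev v = k ∧ par u = some v then S u else 1 := by
    intro v
    split_ifs with hv <;> simp [hv]
  simp only [h1]
  rw [Finset.prod_comm]
  refine Finset.prod_congr rfl fun u _ => ?_
  split_ifs with hu
  · obtain ⟨v, hv, huv⟩ : u ∈ kids par {w | lev w = k} := by rw [h.kids_eq hk]; exact hu
    rw [Finset.prod_eq_single v]
    · rw [if_pos ⟨hv, huv⟩]
    · intro w _ hw
      rw [if_neg]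
      rintro ⟨_, h'⟩
      exact hw (Option.some.inj (h'.symm.trans huv))
    · simp
  · refine Finset.prod_eq_one fun v _ => if_neg ?_
    rintro ⟨rfl, h'⟩
    exact hu (h.child u v h')

/-- The colorings that agree with `f` above the level `k`. -/
def extensions (lev : Fin n → ℕ) (k : ℕ) (f : Fin n → Color) : Finset (Fin n → Color) :=
  Fintype.piFinset fun v => if k ≤ lev v then Finset.univ else {f v}

lemma mem_extensions {k : ℕ} {f g : Fin n → Color} :
    g ∈ extensions lev k f ↔ ∀ v, lev v < k → g v = f v := by
  rw [extensions, Fintype.mem_piFinset]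
  refine forall_congr' fun v => ?_
  by_cases hv : k ≤ lev v
  · simp [hv]
  · simp [hv, not_le.1 hv]

/-- A colouring from level `k` on is chosen in two stages: level `k` first, then everything below.
The fibres are those of the map that forgets the colours below level `k`. -/
lemma sum_extensions {k : ℕ} (f : Fin n → Color) (H : (Fin n → Color) → R) :
    ∑ g ∈ Fintype.piFinset fun v => if lev v = k then Finset.univ else {f v},
      ∑ g' ∈ extensions lev (k + 1) g, H g' = ∑ g' ∈ extensions lev k f, H g' := by
  have hmem : ∀ g : Fin n → Color,
      g ∈ (Fintype.piFinset fun v => if lev v = k then Finset.univ else {f v}) ↔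
        ∀ v, lev v ≠ k → g v = f v := by
    intro g
    rw [Fintype.mem_piFinset]
    refine forall_congr' fun v => ?_
    by_cases hv : lev v = k <;> simp [hv]
  rw [← Finset.sum_fiberwise_of_maps_to (s := extensions lev k f)
    (g := fun g' v => if lev v = k then g' v else f v) (t := Fintype.piFinset fun v =>
      if lev v = k then Finset.univ else {f v})]
  · refine Finset.sum_congr rfl fun g hg => Finset.sum_congr ?_ fun _ _ => rfl
    rw [hmem] at hg
    ext g'
    rw [Finset.mem_filter, mem_extensions, mem_extensions]
    constructor
    · intro hg'
      refine ⟨fun v hv => (hg' v (by omega)).trans (hg v (by omega)), funext fun v => ?_⟩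
      split_ifs with hv
      · exact hg' v (by omega)
      · exact (hg v hv).symm
    · rintro ⟨h1, rfl⟩ v hv
      dsimp only
      split_ifs with hv'
      · rfl
      · exact h1 v (by omega)
  · intro g' _
    rw [hmem]
    intro v hv
    exact if_neg hv

/-- Distributivity turns the product over level `k` of sums over colours into a sum over the
colourings of that level. Each vertex may use its own colour, because its entry depends on the sets
belonging to its own ancestors only. By `prod_kids`, what remains is the same product for level `k +
1`, to which induction applies. -/
theorem prod_solve (h : IsLevel G par lev) : ∀ (j k : ℕ) (f : Fin n → Color), 1 ≤ k →
    (∀ v, lev v < k + j) →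
    ∏ v, (if lev v = k then solve G par x j {w | lev w = k} (upper par lev f .taken v)
      (upper par lev f .banned v) v else 1) =
    ∑ g ∈ extensions lev k f, ∏ v, if k ≤ lev v then factor G par lev x g v else 1
  | 0, k, f, _, hj => by
    have h1 : extensions lev k f = {f} := by
      ext g
      rw [mem_extensions, Finset.mem_singleton]
      exact ⟨fun hg => funext fun v => hg v (hj v), fun hg v _ => by rw [hg]⟩
    rw [h1, Finset.sum_singleton]
    refine Finset.prod_congr rfl fun v _ => ?_
    have := hj v
    rw [if_neg (by omega), if_neg (by omega)]
  | j + 1, k, f, hk, hj => by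
    -- Outside level `k` the sum ranges over the single colour `f v`, so that `Finset.prod_univ_sum`
    -- produces exactly the colourings that differ from `f` on level `k` only.
    have hE : ∀ v, (if lev v = k then solve G par x (j + 1) {w | lev w = k}
        (upper par lev f .taken v) (upper par lev f .banned v) v else 1) =
        ∑ c ∈ if lev v = k then Finset.univ else {f v}, if lev v = k then
          term G x (upper par lev f .taken v) (upper par lev f .banned v) v c *
            ∏ u, (if par u = some v then solve G par x j {w | lev w = k + 1}
              (takenAbove {w | lev w = k} (upper par lev f .taken v) c)
              (bannedAbove {w | lev w = k} (upper par lev f .banned v) c) u else 1) else 1 := by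
      intro v
      split_ifs with hv
      · rw [solve, if_pos ⟨v, hv⟩, h.kids_eq hk]
        rfl
      · simp
    rw [Finset.prod_congr rfl fun v _ => hE v, Finset.prod_univ_sum, ← sum_extensions]
    refine Finset.sum_congr rfl fun g hg => ?_
    have hgf : ∀ v, lev v < k → g v = f v := by
      intro v hv
      have := Fintype.mem_piFinset.1 hg v
      rwa [if_neg (by omega), Finset.mem_singleton] at this
    -- For a fixed colouring `g` of level `k`, the weight of `v` separates from the product over its
    -- children, and the sets in the recursive call become `upper` for `g` at the child.
    have hsplit : ∀ v, (if lev v = k then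
        term G x (upper par lev f .taken v) (upper par lev f .banned v) v (g v) *
          ∏ u, (if par u = some v then solve G par x j {w | lev w = k + 1}
            (takenAbove {w | lev w = k} (upper par lev f .taken v) (g v))
            (bannedAbove {w | lev w = k} (upper par lev f .banned v) (g v)) u else 1) else 1) =
        (if lev v = k then factor G par lev x g v else 1) *
          if lev v = k then ∏ u, (if par u = some v then solve G par x j {w | lev w = k + 1}
            (upper par lev g .taken u) (upper par lev g .banned u) u else 1) else 1 := by
      intro v
      split_ifs with hv
      · have hu : ∀ c, upper par lev f c v = upper par lev g c v := fun c =>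
          h.upper_congr c fun a ha => (hgf a (hv ▸ ha)).symm
        rw [factor, hu, hu]
        refine congrArg _ (Finset.prod_congr rfl fun u _ => ?_)
        split_ifs with huv
        · rw [h.upper_child .taken huv, h.upper_child .banned huv, hv]
          rfl
        · rfl
      · rw [one_mul]
    rw [Finset.prod_congr rfl fun v _ => hsplit v, Finset.prod_mul_distrib, h.prod_kids hk,
      h.prod_solve j (k + 1) g (by omega) (fun v => by have := hj v; omega), Finset.mul_sum]
    refine Finset.sum_congr rfl fun g' hg' => ?_
    rw [mem_extensions] at hg'
    rw [← Finset.prod_mul_distrib]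
    refine Finset.prod_congr rfl fun v _ => ?_
    rcases lt_trichotomy (lev v) k with hv | hv | hv
    · rw [if_neg (by omega), if_neg (by omega), if_neg (by omega), one_mul]
    · rw [if_pos hv, if_neg (by omega), if_pos (by omega), mul_one]
      exact h.factor_congr fun a ha => (hg' a (by omega)).symm
    · rw [if_neg (by omega), if_pos (by omega), if_pos (by omega), one_mul]

theorem prod_roots (h : IsLevel G par lev) {d : ℕ} (hd : ∀ v, lev v ≤ d) :
    ∏ v, (if par v = none then solve G par x d {v | par v = none} ∅ ∅ v else 1) =
      ∑ f : Fin n → Color, ∏ v, factor G par lev x f v := by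
  have hr : ∀ v, par v = none ↔ lev v = 1 := by
    intro v
    refine ⟨h.root v, fun hv => ?_⟩
    cases huv : par v with
    | none => rfl
    | some u =>
      have h1 := h.child v u huv
      have h2 := h.pos u
      omega
  have hu : ∀ v, lev v = 1 → ∀ (f : Fin n → Color) c, upper par lev f c v = ∅ := by
    intro v hv f c
    refine Set.eq_empty_of_forall_notMem fun u hu => ?_
    have h1 := hu.1
    have h2 := h.pos u
    omega
  have h1 := h.prod_solve (x := x) d 1 (fun _ => .free) le_rfl fun v => by have := hd v; omega
  have h2 : extensions lev 1 (fun _ => .free) = Finset.univ := by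
    refine Finset.eq_univ_iff_forall.2 fun g => mem_extensions.2 fun v hv => ?_
    have := h.pos v
    omega
  rw [h2] at h1
  simp only [hr]
  refine Eq.trans (Finset.prod_congr rfl fun v _ => ?_) (h1.trans
    (Finset.sum_congr rfl fun f _ => Finset.prod_congr rfl fun v _ => if_pos (h.pos v)))
  split_ifs with hv
  · rw [hu v hv, hu v hv]
  · rfl

end IsLevel

/-- The left side tests an edge at its lower end, the right side at its banned end. If some edge
joins a taken to a banned vertex, both products contain a zero; otherwise no test applies and the
factors agree. -/
lemma IsLevel.prod_factor (h : IsLevel G par lev) (f : Fin n → Color) :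
    ∏ v, factor G par lev x f v = ∏ v, term G x {u | f u = .taken} ∅ v (f v) := by
  by_cases hf : ∃ u v, G.Adj v u ∧ f u = .taken ∧ f v = .banned
  · obtain ⟨u, v, huv, hu, hv⟩ := hf
    have h2 : ∏ v, term G x {u | f u = .taken} ∅ v (f v) = 0 := by
      refine Finset.prod_eq_zero (Finset.mem_univ v) ?_
      rw [hv, term, if_pos ⟨u, hu, huv⟩]
    rw [h2]
    rcases h.comparable v u huv with h' | h'
    · refine Finset.prod_eq_zero (Finset.mem_univ u) ?_
      rw [factor, hu, term, if_pos (h.exists_mem_upper.2 ⟨v, h', hv, huv.symm⟩)]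
    · refine Finset.prod_eq_zero (Finset.mem_univ v) ?_
      rw [factor, hv, term, if_pos (h.exists_mem_upper.2 ⟨u, h', hu, huv⟩)]
  · refine Finset.prod_congr rfl fun v _ => ?_
    rw [factor]
    cases hv : f v
    · rw [term, term, if_neg, if_neg (by simp)]
      rw [h.exists_mem_upper]
      rintro ⟨u, _, hu, huv⟩
      exact hf ⟨v, u, huv.symm, hv, hu⟩
    · rfl
    · rw [term, term, if_neg, if_neg]
      · rintro ⟨u, hu, huv⟩
        exact hf ⟨u, v, huv, hu, hv⟩
      · rw [h.exists_mem_upper]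
        rintro ⟨u, _, hu, huv⟩
        exact hf ⟨u, v, huv, hu, hv⟩

-- Group the colourings by their set `S` of taken vertices and factor the sum over the other
-- colours. A vertex outside `S` contributes 1 from `free`, and from `banned` 0 or -1 according to
-- whether it has a neighbour in `S`: together, the indicator that it is dominated.
open Classical in
lemma sum_colorings (G : SimpleGraph (Fin n)) (x : R) :
    ∑ f : Fin n → Color, ∏ v, term G x {u | f u = .taken} ∅ v (f v) =
      ∑ S : Finset (Fin n), if IsDominatingSet G S then x ^ S.card else 0 := by
  rw [← Finset.sum_fiberwise (s := Finset.univ)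
    (g := fun f : Fin n → Color => Finset.univ.filter fun v => f v = .taken)]
  refine Finset.sum_congr rfl fun S _ => ?_
  have h1 : (Finset.univ.filter fun f : Fin n → Color =>
      -- The fibre over `S` is a product of sets, one for each vertex, which makes the sum factor.
      (Finset.univ.filter fun v => f v = .taken) = S) = Fintype.piFinset fun v =>
        if v ∈ S then {Color.taken} else {Color.free, Color.banned} := by
    ext f
    rw [Finset.mem_filter, Fintype.mem_piFinset, Finset.ext_iff]
    simp only [Finset.mem_univ, true_and, Finset.mem_filter]
    refine forall_congr' fun v => ?_
    by_cases hv : v ∈ S <;> cases hf : f v <;> simp [hv]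
  rw [h1, Finset.sum_congr rfl (g := fun f => ∏ v, term G x {u | u ∈ S} ∅ v (f v)),
    ← Finset.prod_univ_sum (f := fun v c => term G x {u | u ∈ S} ∅ v c)]
  · have h2 : ∀ v, ∑ c ∈ if v ∈ S then {Color.taken} else {Color.free, Color.banned},
        term G x {u | u ∈ S} ∅ v c =
          (if v ∈ S ∨ ∃ u ∈ S, G.Adj v u then 1 else 0) * if v ∈ S then x else 1 := by
      intro v
      by_cases hv : v ∈ S
      · simp [hv, term]
      · rw [if_neg hv, if_neg hv, Finset.sum_insert (by decide), Finset.sum_singleton]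
        by_cases hS : ∃ u ∈ S, G.Adj v u
        · rw [if_pos (.inr hS), term, term, if_pos (by simpa using hS)]
          ring
        · rw [if_neg (not_or.2 ⟨hv, hS⟩), term, term, if_neg (by simpa using hS)]
          ring
    simp only [h2]
    rw [Finset.prod_mul_distrib, Finset.prod_ite_mem, Finset.univ_inter, Finset.prod_const]
    by_cases hS : IsDominatingSet G S
    · rw [if_pos hS, Finset.prod_eq_one fun v _ => if_pos (hS v), one_mul]
    · rw [if_neg hS]
      obtain ⟨v, hv⟩ := not_forall.1 hS
      rw [Finset.prod_eq_zero (Finset.mem_univ v) (if_neg hv), zero_mul]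
  · intro f hf
    rw [← h1, Finset.mem_filter] at hf
    have : {u | f u = Color.taken} = {u | u ∈ S} := by
      rw [← hf.2]
      ext
      simp
    rw [this]

open Classical in
lemma sum_dominating (G : SimpleGraph (Fin n)) (x : R) :
    (∑ S : Finset (Fin n), if IsDominatingSet G S then x ^ S.card else 0) =
      ∑ i ∈ Finset.range (n + 1), (domCount G i : R) * x ^ i := by
  rw [← Finset.sum_fiberwise_of_maps_to (t := Finset.range (n + 1)) (g := Finset.card)]
  · refine Finset.sum_congr rfl fun i _ => ?_
    rw [domCount, ← nsmul_eq_mul, ← Finset.sum_const, Finset.sum_filter, Finset.sum_filter]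
    refine Finset.sum_congr rfl fun S _ => ?_
    by_cases h1 : S.card = i <;> by_cases h2 : IsDominatingSet G S <;> simp [h1, h2]
  · intro S _
    have := Finset.card_le_univ S
    rw [Fintype.card_fin] at this
    rw [Finset.mem_range]
    omega

theorem IsLevel.prod_roots_eq (h : IsLevel G par lev) {d : ℕ} (hd : ∀ v, lev v ≤ d) :
    ∏ v, (if par v = none then solve G par x d {v | par v = none} ∅ ∅ v else 1) =
      ∑ i ∈ Finset.range (n + 1), (domCount G i : R) * x ^ i := by
  rw [h.prod_roots hd, Finset.sum_congr rfl fun f _ => h.prod_factor f, sum_colorings,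
    sum_dominating]

/-- Roots have level 1, hence the shift between generation `j` and level `j + 1`. -/
lemma IsLevel.iterate_kids (h : IsLevel G par lev) (j : ℕ) :
    (kids par)^[j] {v | par v = none} = {w | lev w = j + 1} := by
  induction j with
  | zero =>
    ext v
    refine ⟨h.root v, fun hv => ?_⟩
    cases huv : par v with
    | none => exact huv
    | some u =>
      have h1 := h.child v u huv
      have h2 := h.pos u
      have h3 : lev v = 0 + 1 := hv
      omega
  | succ j ih => rw [Function.iterate_succ_apply', ih, h.kids_eq (by omega)]

end forest

end DomSetTreeDepth
namespace DomSetTreeDepth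

/-! ### Reading the coefficients off the digits -/

section decoding

/-- The word of length `k` of the binary digits of `m`. -/
def digitsW : ℕ → ℕ → List Bool
  | 0, _ => []
  | k + 1, m => decide (m % 2 = 1) :: digitsW k (m / 2)

@[simp] lemma length_digitsW : ∀ k m : ℕ, (digitsW k m).length = k
  | 0, _ => rfl
  | k + 1, m => by rw [digitsW, List.length_cons, length_digitsW k]

lemma val_digitsW : ∀ {k m : ℕ}, m < 2 ^ k → val (digitsW k m) = m
  | 0, m, h => by simp at h; simp [digitsW, val, h]
  | k + 1, m, h => by
    rw [pow_succ] at h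
    rw [digitsW, val, val_digitsW (k := k) (by omega)]
    rcases Nat.mod_two_eq_zero_or_one m with h | h <;> simp [h] <;> omega

lemma length_flatten_map {k : ℕ} {g : ℕ → List Bool} (hg : ∀ i, (g i).length = k) (m : ℕ) :
    ((List.range m).map g).flatten.length = k * m := by
  induction m with
  | zero => simp
  | succ m ih =>
    rw [List.range_succ, List.map_append, List.flatten_append, List.length_append, ih]
    simp [hg]
    ring

lemma val_flatten_map {k : ℕ} {g : ℕ → List Bool} (hg : ∀ i, (g i).length = k) (m : ℕ) :
    val ((List.range m).map g).flatten = ∑ i ∈ Finset.range m, val (g i) * (2 ^ k) ^ i := by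
  induction m with
  | zero => rfl
  | succ m ih =>
    rw [List.range_succ, List.map_append, List.flatten_append, val_append, ih,
      length_flatten_map hg, Finset.sum_range_succ, ← pow_mul]
    simp [mul_comm]

/-- Induction from the low end: the lowest digit survives if some higher digit is a one or if it is
a one itself, and `Nat.bits` obeys the same rule. -/
lemma stripW_reverse (w : List Bool) : stripW w.reverse = Nat.bits (val w) := by
  induction w with
  | nil => rfl
  | cons b w ih =>
    have hv : val (b :: w) = Nat.bit b (val w) := by
      cases b <;> simp [val, Nat.bit]
      omega
    rw [stripW] at ih ⊢
    rw [List.reverse_cons, List.dropWhile_append]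
    by_cases h0 : val w = 0
    · rw [h0, Nat.zero_bits, List.reverse_eq_nil_iff] at ih
      rw [hv, h0, ih]
      cases b
      · rfl
      · rw [Nat.bits_append_bit _ _ fun _ => rfl]
        rfl
    · rw [hv, Nat.bits_append_bit _ _ fun h => absurd h h0, ← ih, if_neg]
      · simp
      · intro h
        rw [List.isEmpty_iff.1 h] at ih
        have h1 := Nat.size_eq_bits_len (val w)
        rw [← ih] at h1
        exact h0 (Nat.size_eq_zero.1 h1.symm)

/-- The `q i` are the digits of the sum in base 2^k. Both words have `k * m` bits, so their values
lie below the modulus and congruence is equality. -/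
lemma eq_flatten_of_valZ_eq {k m : ℕ} {q : ℕ → ℕ} (hq : ∀ i, q i < 2 ^ k) {w : List Bool}
    (hw : w.length = k * m)
    (h : valZ (k * m) w = ∑ i ∈ Finset.range m, (q i : ZMod (2 ^ (k * m))) * (2 ^ k) ^ i) :
    w = ((List.range m).map fun i => digitsW k (q i)).flatten := by
  have hl := length_flatten_map (g := fun i => digitsW k (q i)) (fun i => length_digitsW k _) m
  have hv := val_flatten_map (g := fun i => digitsW k (q i)) (fun i => length_digitsW k _) m
  refine eq_of_val_eq (hw.trans hl.symm) ?_
  have h1 := val_lt w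
  have h2 := val_lt ((List.range m).map fun i => digitsW k (q i)).flatten
  rw [hw] at h1
  rw [hl] at h2
  have h3 : (val w : ZMod (2 ^ (k * m))) =
      (val ((List.range m).map fun i => digitsW k (q i)).flatten : ZMod (2 ^ (k * m))) := by
    rw [hv]
    refine Eq.trans h ?_
    push_cast
    exact Finset.sum_congr rfl fun i _ => by rw [val_digitsW (hq i)]
  rw [ZMod.natCast_eq_natCast_iff', Nat.mod_eq_of_lt h1, Nat.mod_eq_of_lt h2] at h3
  exact h3

end decoding

/-! ### Tree-depth decompositions as instances -/

namespace RootedForest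

variable {N : Type} {F : RootedForest N}

lemma tail_root {y : N} (h : F.parent y = none) : F.tail y = {y} := by
  ext a
  constructor
  · intro ha
    rcases Relation.ReflTransGen.cases_tail ha with rfl | ⟨x, _, hx⟩
    · rfl
    · rw [h] at hx
      cases hx
  · rintro rfl
    exact Relation.ReflTransGen.refl

lemma tail_child {x y : N} (h : F.parent y = some x) : F.tail y = insert y (F.tail x) := by
  ext a
  constructor
  · intro ha
    rcases Relation.ReflTransGen.cases_tail ha with rfl | ⟨z, hz, hzy⟩
    · exact .inl rfl
    · obtain rfl := Option.some.inj (hzy.symm.trans h)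
      exact .inr hz
  · rintro (rfl | ha)
    · exact Relation.ReflTransGen.refl
    · exact Relation.ReflTransGen.tail ha h

/-- A node above its own parent would lie on a cycle, against well-foundedness. Hence the tail gains
exactly one node from parent to child. -/
lemma notMem_tail {x y : N} (h : F.parent y = some x) : y ∉ F.tail x := fun hy =>
  (F.wf.transGen.irrefl).irrefl y (Relation.TransGen.tail' hy h)

lemma ncard_tail_le_depth [Finite N] (x : N) : (F.tail x).ncard ≤ F.depth :=
  le_ciSup (f := fun x => (F.tail x).ncard) (Set.finite_range _).bddAbove x

lemma depth_le_card [Finite N] : F.depth ≤ Nat.card N := by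
  cases isEmpty_or_nonempty N
  · rw [depth, ciSup_of_empty]
    exact Nat.zero_le _
  · exact ciSup_le fun x => Set.ncard_le_card _

end RootedForest

namespace TreeDepthDecomposition

variable {n : ℕ} {G : SimpleGraph (Fin n)} (D : TreeDepthDecomposition G)

/-- The parent function on the vertices. -/
def par (v : Fin n) : Option (Fin n) := (D.forest.parent (D.μ v)).map D.μ.symm

/-- The number of the ancestors of a vertex. -/
noncomputable def lev (v : Fin n) : ℕ := (D.forest.tail (D.μ v)).ncard

lemma finite_node : Finite D.Node := Finite.of_equiv _ D.μ

lemma par_eq_some_iff {u v : Fin n} : D.par u = some v ↔ D.forest.parent (D.μ u) = some (D.μ v) := by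
  rw [par, Option.map_eq_some_iff]
  constructor
  · rintro ⟨a, ha, rfl⟩
    rw [ha, Equiv.apply_symm_apply]
  · intro h
    exact ⟨_, h, Equiv.symm_apply_apply _ _⟩

lemma above_of_isAncestor {u v : Fin n} (h : D.forest.IsAncestor (D.μ u) (D.μ v)) (huv : u ≠ v) :
    Above D.par u v := by
  have h1 : Relation.ReflTransGen (fun a b => D.par b = some a) (D.μ.symm (D.μ u))
      (D.μ.symm (D.μ v)) := by
    refine Relation.ReflTransGen.lift D.μ.symm (fun a b hab => ?_) (D.μ u) (D.μ v) h
    change D.par (D.μ.symm b) = some (D.μ.symm a)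
    rw [par_eq_some_iff]
    simpa using hab
  rw [Equiv.symm_apply_apply, Equiv.symm_apply_apply,
    Relation.reflTransGen_iff_eq_or_transGen] at h1
  exact h1.resolve_left huv.symm

lemma isLevel : IsLevel G D.par D.lev where
  root v h := by
    rw [par, Option.map_eq_none_iff] at h
    rw [lev, RootedForest.tail_root h, Set.ncard_singleton]
  child u v h := by
    have := D.finite_node
    rw [par_eq_some_iff] at h
    rw [lev, RootedForest.tail_child h, Set.ncard_insert_of_notMem (RootedForest.notMem_tail h)
      (Set.toFinite _)]
    rfl
  comparable u v h := by
    rcases D.ancestor_of_adj u v h with h' | h'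
    · exact .inl (D.above_of_isAncestor h' h.ne)
    · exact .inr (D.above_of_isAncestor h' h.ne')

lemma lev_le_depth (v : Fin n) : D.lev v ≤ D.depth := by
  have := D.finite_node
  exact RootedForest.ncard_tail_le_depth _

lemma depth_le : D.depth ≤ n := by
  have := D.finite_node
  refine RootedForest.depth_le_card.trans ?_
  rw [← Nat.card_congr D.μ, Nat.card_fin]

/-- The instance given by a graph and a tree-depth decomposition. -/
noncomputable def toPar : Par where
  n := n
  L := (n + 1) * (n + 1)
  N := (n + 1) ^ 2
  A := (List.finRange n).map fun v => rowW {w | G.Adj v w}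
  P := (List.finRange n).map fun v => rowW {w | D.par v = some w}
  cx := doubleW (n + 1) (true :: List.replicate ((n + 1) * (n + 1) - 1) false)
  length_A := by simp
  length_of_mem_A r hr := by
    obtain ⟨v, _, rfl⟩ := List.mem_map.1 hr
    exact length_rowW _
  length_P := by simp
  length_of_mem_P r hr := by
    obtain ⟨v, _, rfl⟩ := List.mem_map.1 hr
    exact length_rowW _
  length_cx := by
    have : 0 < (n + 1) * (n + 1) := by positivity
    rw [length_doubleW, List.length_cons, List.length_replicate]
    omega
  L_pos := Nat.succ_le_of_lt (by positivity)
  n_le := by nlinarith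
  L_le := by rw [sq]

lemma represents : Represents D.toPar G D.par := ⟨rfl, rfl, rfl⟩

lemma encodeInput_eq : encodeInput G D = encodeWords (D.toPar.A ++ D.toPar.P) := by
  have hP : D.toPar.P = (List.finRange n).map fun v =>
      rowW {w | D.forest.parent (D.μ v) = some (D.μ w)} := by
    simp only [toPar, par_eq_some_iff]
  have h : ∀ R : Fin n → Fin n → Prop, encodeMatrix R =
      encodeWords ((List.finRange n).map fun v => rowW {w | R v w}) := by
    intro R
    rw [encodeMatrix, encodeWords, List.flatMap_map]
    refine List.flatMap_congr fun v _ => ?_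
    rw [rowW, List.map_map]
    rfl
  rw [hP, encodeWords_append, encodeInput, h, h]
  rfl

/-- The generation of number `D.depth` below the roots is the level `D.depth + 1`, which is empty.
-/
lemma meetW_kids : meetW ((fun b => kidsW true b D.toPar.P)^[D.depth] D.toPar.roots)
    ((fun b => kidsW true b D.toPar.P)^[D.depth] D.toPar.roots) = false := by
  have h1 : ∀ j, (fun b => kidsW true b D.toPar.P)^[j] D.toPar.roots =
      rowW {w | D.lev w = j + 1} := by
    intro j
    rw [← D.isLevel.iterate_kids]
    induction j with
    | zero => exact D.represents.roots (by change n ≤ (n + 1) * (n + 1); nlinarith)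
    | succ j ih => rw [Function.iterate_succ_apply', ih, Function.iterate_succ_apply',
        D.represents.kidsW]
  rw [h1, ← Bool.not_eq_true, meetW_rowW_iff]
  rintro ⟨w, hw, _⟩
  have h2 : D.lev w = D.depth + 1 := hw
  have h3 := D.lev_le_depth w
  omega

/-- The program evaluates the generating polynomial at 2^(n+1). There are 2^n sets of vertices in
all, so every coefficient fits into a block of `n + 1` bits, and `n + 1` blocks fill the word. -/
lemma resultW_eq : resultW D.toPar (solveW D.toPar D.depth D.toPar.roots
    (List.replicate n false) (List.replicate n false)) =
      ((List.range (n + 1)).map fun i => digitsW (n + 1) (domCount G i)).flatten := by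
  have hL : D.toPar.n ≤ D.toPar.L := by change n ≤ (n + 1) * (n + 1); nlinarith
  refine eq_flatten_of_valZ_eq (fun i => ?_) ?_ ?_
  · have h1 : domCount G i ≤ Fintype.card (Finset (Fin n)) := Finset.card_le_univ _
    rw [Fintype.card_finset, Fintype.card_fin] at h1
    exact h1.trans_lt (Nat.pow_lt_pow_right (by norm_num) (by omega))
  · exact length_prodW _ D.toPar.length_one fun rz h =>
      length_of_mem_solveW D.toPar _ _ _ _ _ (List.of_mem_zip (a := rz.1) (b := rz.2) h).2
  · have hcx : valZ D.toPar.L D.toPar.cx = 2 ^ (n + 1) := by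
      have : D.toPar.cx = doubleW (n + 1) D.toPar.one := rfl
      rw [this, valZ_doubleW D.toPar.length_one, Par.valZ_one, mul_one]
    refine (D.represents.valZ_resultW hL D.depth).trans ?_
    rw [hcx]
    exact D.isLevel.prod_roots_eq D.lev_le_depth

end TreeDepthDecomposition

/-! ### The main theorem -/

open Classical in
lemma domCount_fin_zero (G : SimpleGraph (Fin 0)) : domCount G 0 = 1 := by
  rw [domCount, Finset.card_eq_one]
  refine ⟨∅, Finset.eq_singleton_iff_unique_mem.2 ⟨?_, fun S _ => Subsingleton.elim _ _⟩⟩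
  rw [Finset.mem_filter]
  exact ⟨Finset.mem_univ _, fun v => v.elim0, rfl⟩

lemma outputs_countProg {n : ℕ} (G : SimpleGraph (Fin n)) (D : TreeDepthDecomposition G) :
    ∃ t, t + 1 ≤ 3 ^ D.depth * timePoly.eval n ∧ Run (spacePoly.eval n) countProg
      (Store.single .inp (D.toPar.A ++ D.toPar.P))
      (Store.single .out ((List.range (n + 1)).map fun i => Nat.bits (domCount G i))) t ∧
      (Store.single Reg.out ((List.range (n + 1)).map fun i => Nat.bits (domCount G i))).size ≤
        spacePoly.eval n := by
  rcases Nat.eq_zero_or_pos n with rfl | hn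
  · have hd := domCount_fin_zero G
    have h1 : ((List.range (0 + 1)).map fun i => Nat.bits (domCount G i)) = [[true]] := by
      simp [hd]
    have h2 : D.toPar.A ++ D.toPar.P = [] := rfl
    have h3 : 10 ≤ spacePoly.eval 0 := by
      rw [spacePoly]
      simp only [Polynomial.eval_add]
      simp
    have h4 : 4 ≤ 3 ^ D.depth * timePoly.eval 0 := by
      have : 8 ≤ timePoly.eval 0 := by
        rw [timePoly, Polynomial.eval_comp, Polynomial.eval_add]
        simp
      have := Nat.le_mul_of_pos_left (timePoly.eval 0) (pow_pos (by norm_num : 0 < 3) D.depth)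
      omega
    rw [h1, h2]
    have h5 : (Store.single Reg.inp []).size = 0 := by
      rw [Store.single, Function.update_eq_self_iff.2 rfl]
      simp [Store.size]
    have h6 := run_countProg_zero.size_le
    exact ⟨3, h4, run_countProg_zero.of_size_add_le (by omega), by omega⟩
  -- The result is read from its high end, so both the blocks and their bits appear in reverse;
  -- `stripW` and the stack `out` reverse them back.
  · have hcs : ((((List.range (n + 1)).map fun i =>
        (digitsW (n + 1) (domCount G i)).reverse).reverse).map stripW).reverse =
          (List.range (n + 1)).map fun i => Nat.bits (domCount G i) := by
      rw [List.map_reverse, List.reverse_reverse, List.map_map]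
      refine List.map_congr_left fun i _ => ?_
      have h1 : domCount G i ≤ Fintype.card (Finset (Fin n)) := Finset.card_le_univ _
      rw [Fintype.card_finset, Fintype.card_fin] at h1
      rw [Function.comp_apply, stripW_reverse,
        val_digitsW (h1.trans_lt (Nat.pow_lt_pow_right (by norm_num) (by omega)))]
    rw [← hcs]
    refine run_countProg D.toPar hn rfl rfl rfl D.depth_le D.meetW_kids ?_ ?_ ?_
    · refine (congrArg List.reverse D.resultW_eq).trans ?_
      rw [List.reverse_flatten, List.map_map]
      rfl
    · intro c hc
      obtain ⟨i, _, rfl⟩ := List.mem_map.1 (List.mem_reverse.1 hc)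
      rw [List.length_reverse, length_digitsW]
      rfl
    · rw [List.length_reverse, List.length_map, List.length_range]
      rfl

end DomSetTreeDepth
theorem mainTheorem11 :
    ∃ (M : Turing.TM2ComputableAux DomSetTreeDepth.Symbol DomSetTreeDepth.Symbol)
      (t b : Polynomial ℕ),
      (∀ k : M.tm.K, Finite (M.tm.Γ k)) ∧
      ∀ (n : ℕ) (G : SimpleGraph (Fin n)) (D : DomSetTreeDepth.TreeDepthDecomposition G),
        Nonempty (Turing.TM2OutputsInTime M.tm
          ((DomSetTreeDepth.encodeInput G D).map M.inputAlphabet.symm)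
          (some ((DomSetTreeDepth.encodeNumbers
            ((List.range (n + 1)).map (DomSetTreeDepth.domCount G))).map M.outputAlphabet.symm))
          (3 ^ D.depth * t.eval n)) ∧
        DomSetTreeDepth.RunsInSpace M.tm
          ((DomSetTreeDepth.encodeInput G D).map M.inputAlphabet.symm) (b.eval n) := by
  refine ⟨DomSetTreeDepth.countProg.aux .inp .out, DomSetTreeDepth.timePoly,
    DomSetTreeDepth.spacePoly, fun _ => inferInstanceAs (Finite (Option Bool)), fun n G D => ?_⟩
  obtain ⟨t, ht, hr, hs⟩ := DomSetTreeDepth.outputs_countProg G D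
  obtain ⟨⟨h1⟩, h2⟩ := hr.machine hs
  have hi : (DomSetTreeDepth.encodeInput G D).map
      (DomSetTreeDepth.countProg.aux DomSetTreeDepth.Reg.inp .out).inputAlphabet.symm =
        DomSetTreeDepth.encodeWords (D.toPar.A ++ D.toPar.P) := by
    rw [D.encodeInput_eq]
    exact List.map_id _
  have ho : (DomSetTreeDepth.encodeNumbers
      ((List.range (n + 1)).map (DomSetTreeDepth.domCount G))).map
        (DomSetTreeDepth.countProg.aux DomSetTreeDepth.Reg.inp .out).outputAlphabet.symm =
        DomSetTreeDepth.encodeWords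
          ((List.range (n + 1)).map fun i => Nat.bits (DomSetTreeDepth.domCount G i)) := by
    refine (List.map_id _).trans ?_
    rw [DomSetTreeDepth.encodeNumbers, DomSetTreeDepth.encodeWords, List.flatMap_map,
      List.flatMap_map]
  rw [hi, ho]
  exact ⟨⟨⟨h1.toEvalsTo, h1.steps_le_m.trans ht⟩⟩, h2⟩
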